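/- Let $d \ge 2$ be an integer. For rooted, unordered trees $H, G$, let $\mathrm{LCST}(H,G)$ be the largest number of vertices of a rooted tree that is isomorphic, with root mapped to root, both to a subtree of $H$ and to a subtree of $G$. Assume the Strong Exponential Time Hypothesis (SETH): for every $\varepsilon>0$ there is a $k$ such that $k$-SAT on $n$ variables cannot be solved in $O(2^{(1-\varepsilon)n}\,\mathrm{poly}(n))$ time. Then there is a constant $C$, depending only on $d$, such that for every $\varepsilon>0$ no algorithm computes $\mathrm{LCST}(H,G)$ in $O(n^{2-\varepsilon})$ time on all pairs of rooted trees $H, G$ in which every vertex has at most $d$ children and whose heights are at most $\log_d n + C\log\log n$, where $n=\max(|H|,|G|)$. (Algorithms are deterministic programs of a random access machine with logarithmic cost, which agrees with the word RAM up to factors polylogarithmic in the running time.) -/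

import Mathlib

/-! ### Random access machines with logarithmic cost -/

namespace RAM

/-- Arithmetic operations on natural numbers: addition, truncated subtraction, multiplication and
integer division. -/
inductive Op where
  | add
  | sub
  | mul
  | div

/-- The value of an arithmetic operation. -/
def Op.eval : Op → ℕ → ℕ → ℕ
  | .add, a, b => a + b
  | .sub, a, b => a - b
  | .mul, a, b => a * b
  | .div, a, b => a / b

/-- Programs of a random access machine, which has registers `R 0, R 1, …` (addressed directly, so
that each program uses finitely many of them) and a random access memory `M` (addressed through
registers). All cells hold natural numbers. -/
inductive Prog where
  /-- do nothing -/
  | skip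
  /-- `R i := a` -/
  | const (i a : ℕ)
  /-- `R i := R j ∘ R k` -/
  | arith (o : Op) (i j k : ℕ)
  /-- `R i := M (R j)` -/
  | load (i j : ℕ)
  /-- `M (R i) := R j` -/
  | store (i j : ℕ)
  /-- first `p`, then `q` -/
  | seq (p q : Prog)
  /-- if `R i ≠ 0` then `p` else `q` -/
  | cond (i : ℕ) (p q : Prog)
  /-- as long as `R i ≠ 0`, do `p` -/
  | loop (i : ℕ) (p : Prog)

/-- A configuration: the contents of the registers and of the memory. -/
structure State where
  reg : ℕ → ℕ
  mem : ℕ → ℕ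

/-- Set the register `i` to `a`. -/
def State.setReg (s : State) (i a : ℕ) : State :=
  ⟨Function.update s.reg i a, s.mem⟩

/-- Set the memory cell `i` to `a`. -/
def State.setMem (s : State) (i a : ℕ) : State :=
  ⟨s.reg, Function.update s.mem i a⟩

/-- The length of the binary representation of `a` (with `len 0 = 1`). -/
def len (a : ℕ) : ℕ := Nat.log 2 a + 1

/-- `Exec p s t s'`: started in `s`, the program `p` halts in `s'` after time `t`.
The time is the logarithmic cost: each elementary step is charged the total binary length of the
numbers and memory addresses that it handles. Up to factors that are polynomial in the logarithm of
the running time, this is the running time on a word RAM. -/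
inductive Exec : Prog → State → ℕ → State → Prop where
  | skip (s : State) : Exec .skip s 1 s
  | const (s : State) (i a : ℕ) : Exec (.const i a) s (len a) (s.setReg i a)
  | arith (s : State) (o : Op) (i j k : ℕ) :
      Exec (.arith o i j k) s (len (s.reg j) + len (s.reg k))
        (s.setReg i (o.eval (s.reg j) (s.reg k)))
  | load (s : State) (i j : ℕ) :
      Exec (.load i j) s (len (s.reg j) + len (s.mem (s.reg j)))
        (s.setReg i (s.mem (s.reg j)))
  | store (s : State) (i j : ℕ) :
      Exec (.store i j) s (len (s.reg i) + len (s.reg j))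
        (s.setMem (s.reg i) (s.reg j))
  | seq {p q : Prog} {s s₁ s₂ : State} {t₁ t₂ : ℕ} :
      Exec p s t₁ s₁ → Exec q s₁ t₂ s₂ → Exec (.seq p q) s (t₁ + t₂) s₂
  | condTrue {i : ℕ} {p q : Prog} {s s₁ : State} {t : ℕ} :
      s.reg i ≠ 0 → Exec p s t s₁ → Exec (.cond i p q) s (len (s.reg i) + t) s₁
  | condFalse {i : ℕ} {p q : Prog} {s s₁ : State} {t : ℕ} :
      s.reg i = 0 → Exec q s t s₁ → Exec (.cond i p q) s (len (s.reg i) + t) s₁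
  | loopDone {i : ℕ} {p : Prog} {s : State} :
      s.reg i = 0 → Exec (.loop i p) s (len (s.reg i)) s
  | loopStep {i : ℕ} {p : Prog} {s s₁ s₂ : State} {t₁ t₂ : ℕ} :
      s.reg i ≠ 0 → Exec p s t₁ s₁ → Exec (.loop i p) s₁ t₂ s₂ →
        Exec (.loop i p) s (len (s.reg i) + t₁ + t₂) s₂

/-- The initial configuration on the input `x`: the memory holds `x` from address `0` on, the
register `0` holds the length of `x`, and everything else is `0`. -/
def init (x : List ℕ) : State :=
  ⟨fun i => if i = 0 then x.length else 0, fun a => x.getD a 0⟩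

/-- On the input `x` the program `p` halts within time `T` with the output `y` in register `0`. -/
def ComputesIn (p : Prog) (x : List ℕ) (y : ℕ) (T : ℝ) : Prop :=
  ∃ (t : ℕ) (s : State), Exec p (init x) t s ∧ (t : ℝ) ≤ T ∧ s.reg 0 = y

end RAM

/-! ### The Strong Exponential Time Hypothesis -/

/-- CNF formulas in `n` variables: lists of clauses, which are lists of literals `(v, b)`; the
literal `(v, true)` is the variable `v`, and `(v, false)` is its negation. -/
abbrev CNF (n : ℕ) := List (List (Fin n × Bool))

namespace CNF

/-- Some assignment satisfies a literal in each clause. -/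
def Satisfiable {n : ℕ} (φ : CNF n) : Prop :=
  ∃ a : Fin n → Bool, ∀ c ∈ φ, ∃ l ∈ c, a l.1 = l.2

/-- The instances of `k`-SAT: no clause has more than `k` literals, and no clause is listed twice
(so that, for fixed `k`, the length of the formula is polynomial in `n`). -/
def IsKCNF {n : ℕ} (k : ℕ) (φ : CNF n) : Prop :=
  φ.Nodup ∧ ∀ c ∈ φ, c.length ≤ k

/-- The input format: the number of variables, the number of clauses, and each clause as its length
followed by its literals. -/
def encode {n : ℕ} (φ : CNF n) : List ℕ :=
  n :: φ.length :: φ.flatMap fun c =>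
    c.length :: c.map fun l => 2 * (l.1 : ℕ) + l.2.toNat

end CNF

open Classical in
/-- The program `p` decides `k`-SAT in `n` variables in time `O(2 ^ ((1 - ε) n) poly(n))`. -/
def DecidesKSAT (p : RAM.Prog) (k : ℕ) (ε : ℝ) : Prop :=
  ∃ c : ℕ, ∀ (n : ℕ) (φ : CNF n), φ.IsKCNF k →
    RAM.ComputesIn p φ.encode (if φ.Satisfiable then 1 else 0)
      (c * (2 : ℝ) ^ ((1 - ε) * n) * ((n : ℝ) + 1) ^ c)

/-- The Strong Exponential Time Hypothesis: for every `ε > 0` there is a `k` such that `k`-SAT in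
`n` variables cannot be decided in time `O(2 ^ ((1 - ε) n) poly(n))`. -/
def SETH : Prop :=
  ∀ ε : ℝ, 0 < ε → ∃ k : ℕ, ¬ ∃ p : RAM.Prog, DecidesKSAT p k ε

/-! ### Rooted trees and the largest common subtree -/

/-- Rooted (unordered, unlabelled) trees with vertex set `Fin n`, given by the root and the parent
of each vertex, where the root counts as its own parent. -/
structure RTree (n : ℕ) where
  root : Fin n
  parent : Fin n → Fin n
  parent_root : parent root = root
  reaches_root : ∀ v, ∃ k : ℕ, parent^[k] v = root

namespace RTree

/-- The distance of `v` from the root. -/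
noncomputable def depth {n : ℕ} (T : RTree n) (v : Fin n) : ℕ :=
  sInf {k : ℕ | T.parent^[k] v = T.root}

/-- The height: the largest distance of a vertex from the root. -/
noncomputable def height {n : ℕ} (T : RTree n) : ℕ :=
  Finset.univ.sup T.depth

/-- The set of children of `v`. -/
def children {n : ℕ} (T : RTree n) (v : Fin n) : Finset (Fin n) :=
  Finset.univ.filter fun u => u ≠ T.root ∧ T.parent u = v

/-- Degree at most `d`: each vertex has at most `d` children (binary trees have degree `2`). -/
def DegreeLE {n : ℕ} (T : RTree n) (d : ℕ) : Prop :=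
  ∀ v, (T.children v).card ≤ d

/-- `S` is isomorphic to a subtree of `T`, the root of `S` corresponding to the root of `T`. -/
def Embeds {k n : ℕ} (S : RTree k) (T : RTree n) : Prop :=
  ∃ f : Fin k → Fin n, Function.Injective f ∧ f S.root = T.root ∧
    ∀ v, f (S.parent v) = T.parent (f v)

/-- The number of vertices of a largest common subtree of `H` and `G`. -/
noncomputable def lcst {m n : ℕ} (H : RTree m) (G : RTree n) : ℕ :=
  sSup {k : ℕ | ∃ S : RTree k, S.Embeds H ∧ S.Embeds G}

/-- The input format: the number of vertices, the root, and the list of parents. -/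
def encode {n : ℕ} (T : RTree n) : List ℕ :=
  n :: (T.root : ℕ) :: List.ofFn fun v => (T.parent v : ℕ)

end RTree

/-- Given two rooted trees `H` and `G` of degree at most `d` and height at most
`log_d n + C log log n`, where `n` is the larger one of their numbers of vertices, the program `p`
computes the size of a largest common subtree of `H` and `G` in time `O(n ^ (2 - ε))`. -/
def SolvesLCST (p : RAM.Prog) (d : ℕ) (C ε : ℝ) : Prop :=
  ∃ c : ℝ, ∀ (n n₁ n₂ : ℕ) (H : RTree n₁) (G : RTree n₂), n = max n₁ n₂ →
    H.DegreeLE d → G.DegreeLE d →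
    (H.height : ℝ) ≤ Real.logb d n + C * Real.logb 2 (Real.logb 2 n) →
    (G.height : ℝ) ≤ Real.logb d n + C * Real.logb 2 (Real.logb 2 n) →
    RAM.ComputesIn p (H.encode ++ G.encode) (H.lcst G) (c * (n : ℝ) ^ (2 - ε))

/-!
A program `p` that computes largest common subtrees of trees of height at most `log_d n` in time
`O(n ^ (2 - ε))` is turned into a program for `k`-SAT, for every `k`, with running time
`2 ^ ((1 - min ε 1 / 2) n)` up to polynomial factors, which contradicts SETH. So `C = 0` is possible.

*Splitting.* The assignments of each half of the variables are numbered by `g < N`, where `N` is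
about `2 ^ (n / 2)`. For the first half, let the bits of `g` be the clauses that `g` leaves
unsatisfied; for the second half, those that `g` satisfies. The formula is satisfiable if and only if
there is a pair `(g₀, g₁)` such that each bit of `g₀` is also a bit of `g₁`
(`KSAT.satisfiable_iff`).

*Trees.* A sequence of `m` bits is encoded in a gadget with `O(m)` vertices and height `O(log m)`: a
binary heap with `m` leaves, made rigid by marks at the even vertices, with two vertices below each
leaf that are siblings or a path, depending on the bit. The gadgets of the second tree have
additional vertices, so that a gadget of the first tree embeds in one of the second tree if and only
if its bits are bits of the latter. In both trees the gadgets hang below the leaves of a complete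
`d`-ary tree, the selector. To the second tree one adds, below each leaf, a further gadget in which
all bits but the bit `0` are set. As the bit `0` is set in all gadgets of the first tree, these do
not embed in the additional gadgets, but they do so without one vertex. Hence, if `(g₀, g₁)` is a
pair as above, then an automorphism of the selector that maps the leaf of `g₀` to the leaf of `g₁`
gives a common subtree that misses only `N - 1` vertices of the first tree
(`Shape.le_lcst_of_compatible`). Conversely, if only `N - 1` vertices are missing, then one of the
`N` disjoint gadgets is embedded completely, and there is such a pair
(`Shape.exists_compatible_of_le_lcst`).

*Height.* Both trees also contain the heap `[0, d ^ h)`, in which the parent of `v` is `v / d`. Its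
height is `h`, the selector with the gadgets is lower, and so the height is at most `log_d n`. It
contains at least `N` vertices in each subtree at the last level, where the rest of the tree has
none, so that a common subtree that misses at most `N - 1` vertices has to map padding to padding.
Since the gadgets have height `O(log m)`, where `m` is polynomial in the number of variables, the
padding only costs a polynomial factor (`KSAT.total_le`).

*Programs.* The vertices are numbered such that the number of the parent of a vertex can be computed
in polynomial time from the formula. `RAM.Cpt` is the corresponding notion of computability; it is
closed under arithmetic, case distinction, reading of the input and bounded iteration, and its time
bounds are existential, so that no running time has to be computed. Two loops around such a
computation (`KSAT.exists_reduction`) prepare the memory for `p`. The threshold survives the run of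
`p` in a register that `p` does not mention (`RAM.Exec.frame`).
-/

/-! ### Binary lengths -/

namespace RAM

theorem len_pos (a : ℕ) : 1 ≤ len a := Nat.succ_le_succ (Nat.zero_le _)

theorem lt_two_pow_len (a : ℕ) : a < 2 ^ len a := Nat.lt_pow_succ_log_self (by norm_num) a

theorem len_le_of_lt {a c : ℕ} (hc : 1 ≤ c) (h : a < 2 ^ c) : len a ≤ c := by
  rcases Nat.eq_zero_or_pos a with rfl | ha
  · simpa [len] using hc
  · exact Nat.log_lt_of_lt_pow ha.ne' h

theorem len_mono {a b : ℕ} (h : a ≤ b) : len a ≤ len b :=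
  Nat.succ_le_succ (Nat.log_mono_right h)

theorem len_le_succ (a : ℕ) : len a ≤ a + 1 := by
  rcases Nat.eq_zero_or_pos a with rfl | ha
  · simp [len]
  · exact len_le_of_lt (by omega) (Nat.lt_two_pow_self.trans (Nat.pow_lt_pow_right (by norm_num)
      (Nat.lt_succ_self a)))

theorem len_mul_le (a b : ℕ) : len (a * b) ≤ len a + len b := by
  have ha := len_pos a
  refine len_le_of_lt (by omega) ?_
  rw [pow_add]
  exact Nat.mul_lt_mul'' (lt_two_pow_len a) (lt_two_pow_len b)

theorem len_add_le (a b : ℕ) : len (a + b) ≤ len a + len b := by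
  have ha := len_pos a
  refine len_le_of_lt (by omega) ?_
  have h1 := lt_two_pow_len a
  have h2 := lt_two_pow_len b
  have h3 : 2 ≤ 2 ^ len a := Nat.le_self_pow (by omega) 2
  have h4 : 2 ≤ 2 ^ len b := Nat.le_self_pow (by have := len_pos b; omega) 2
  rw [pow_add]
  nlinarith

theorem len_pow_le (b i : ℕ) : len (b ^ i) ≤ i * len b + 1 := by
  induction i with
  | zero => simp [len]
  | succ i ih =>
    rw [pow_succ]
    have := len_mul_le (b ^ i) b
    linarith

theorem len_eval_le (o : Op) (a b : ℕ) : len (o.eval a b) ≤ len a + len b := by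
  cases o with
  | add => exact len_add_le a b
  | sub => exact (len_mono (Nat.sub_le a b)).trans (Nat.le_add_right _ _)
  | mul => exact len_mul_le a b
  | div => exact (len_mono (Nat.div_le_self a b)).trans (Nat.le_add_right _ _)

/-! ### Registers that a program does not mention -/

/-- A strict upper bound for the registers that occur in a program. -/
def Prog.bound : Prog → ℕ
  | .skip => 0
  | .const i _ => i + 1
  | .arith _ i j k => max (i + 1) (max (j + 1) (k + 1))
  | .load i j => max (i + 1) (j + 1)
  | .store i j => max (i + 1) (j + 1)
  | .seq p q => max p.bound q.bound
  | .cond i p q => max (i + 1) (max p.bound q.bound)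
  | .loop i p => max (i + 1) p.bound

/-- Registers from `R` on, which the program does not mention, neither influence the run nor are
changed by it. -/
theorem Exec.frame {p : Prog} {s s' : State} {t : ℕ} (h : Exec p s t s') {R : ℕ}
    (hR : p.bound ≤ R) (u : State) (hreg : ∀ i < R, u.reg i = s.reg i) (hmem : u.mem = s.mem) :
    ∃ u', Exec p u t u' ∧ (∀ i < R, u'.reg i = s'.reg i) ∧ u'.mem = s'.mem ∧
      ∀ i, R ≤ i → u'.reg i = u.reg i := by
  have upd : ∀ {u s : State} (i a : ℕ), i < R → (∀ i < R, u.reg i = s.reg i) → u.mem = s.mem →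
      (∀ j < R, (u.setReg i a).reg j = (s.setReg i a).reg j) ∧
        (u.setReg i a).mem = (s.setReg i a).mem ∧ ∀ j, R ≤ j → (u.setReg i a).reg j = u.reg j := by
    intro u s i a hi h1 h2
    refine ⟨fun j hj => ?_, h2, fun j hj => ?_⟩
    · by_cases hji : j = i
      · subst hji; simp [State.setReg]
      · simp [State.setReg, hji, h1 j hj]
    · have : j ≠ i := by omega
      simp [State.setReg, this]
  induction h generalizing u with
  | skip s => exact ⟨u, .skip u, hreg, hmem, fun _ _ => rfl⟩
  | const s i a =>
    simp only [Prog.bound] at hR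
    exact ⟨_, .const u i a, upd i a (by omega) hreg hmem⟩
  | arith s o i j k =>
    simp only [Prog.bound] at hR
    have := Exec.arith u o i j k
    rw [hreg j (by omega), hreg k (by omega)] at this
    exact ⟨_, this, upd _ _ (by omega) hreg hmem⟩
  | load s i j =>
    simp only [Prog.bound] at hR
    have := Exec.load u i j
    rw [hreg j (by omega), hmem] at this
    exact ⟨_, this, upd _ _ (by omega) hreg hmem⟩
  | store s i j =>
    simp only [Prog.bound] at hR
    have := Exec.store u i j
    rw [hreg i (by omega), hreg j (by omega)] at this
    exact ⟨_, this, hreg, by simp [State.setMem, hmem], fun _ _ => rfl⟩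
  | seq _ _ ih1 ih2 =>
    simp only [Prog.bound] at hR
    obtain ⟨u1, e1, r1, m1, f1⟩ := ih1 (by omega) u hreg hmem
    obtain ⟨u2, e2, r2, m2, f2⟩ := ih2 (by omega) u1 r1 m1
    exact ⟨u2, .seq e1 e2, r2, m2, fun i hi => (f2 i hi).trans (f1 i hi)⟩
  | @condTrue i p q s s₁ t h _ ih =>
    simp only [Prog.bound] at hR
    obtain ⟨u1, e1, r1, m1, f1⟩ := ih (by omega) u hreg hmem
    have hi := hreg i (by omega)
    exact ⟨u1, hi ▸ .condTrue (hi ▸ h) e1, r1, m1, f1⟩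
  | @condFalse i p q s s₁ t h _ ih =>
    simp only [Prog.bound] at hR
    obtain ⟨u1, e1, r1, m1, f1⟩ := ih (by omega) u hreg hmem
    have hi := hreg i (by omega)
    exact ⟨u1, hi ▸ .condFalse (hi ▸ h) e1, r1, m1, f1⟩
  | @loopDone i p s h =>
    simp only [Prog.bound] at hR
    have hi := hreg i (by omega)
    exact ⟨u, hi ▸ .loopDone (hi ▸ h), hreg, hmem, fun _ _ => rfl⟩
  | @loopStep i p s s₁ s₂ t₁ t₂ h _ _ ih1 ih2 =>
    have hR' := hR
    simp only [Prog.bound] at hR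
    obtain ⟨u1, e1, r1, m1, f1⟩ := ih1 (by omega) u hreg hmem
    obtain ⟨u2, e2, r2, m2, f2⟩ := ih2 hR' u1 r1 m1
    have hi := hreg i (by omega)
    exact ⟨u2, hi ▸ .loopStep (hi ▸ h) e1 e2, r2, m2, fun i hi => (f2 i hi).trans (f1 i hi)⟩

/-- A loop whose register `r` counts down to `0`. -/
theorem Exec.countdown {r : ℕ} {p : Prog} {T : ℕ} (Inv : ℕ → State → Prop)
    (hr : ∀ a s, Inv a s → s.reg r = a) (n : ℕ)
    (hbody : ∀ a < n, ∀ s, Inv (a + 1) s → ∃ t s', Exec p s t s' ∧ t ≤ T ∧ Inv a s') :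
    ∀ s, Inv n s → ∃ t s', Exec (.loop r p) s t s' ∧ t ≤ n * (T + len n) + 1 ∧ Inv 0 s' := by
  induction n with
  | zero =>
    intro s hs
    have h0 := hr 0 s hs
    exact ⟨_, s, .loopDone h0, by simp [h0, len], hs⟩
  | succ n ih =>
    intro s hs
    obtain ⟨t1, s1, e1, ht1, h1⟩ := hbody n (Nat.lt_succ_self n) s hs
    obtain ⟨t2, s2, e2, ht2, h2⟩ := ih (fun a ha => hbody a (by omega)) s1 h1
    have h0 := hr _ s hs
    refine ⟨_, s2, .loopStep (by omega) e1 e2, ?_, h2⟩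
    rw [h0]
    have : n * (T + len n) ≤ n * (T + len (n + 1)) :=
      Nat.mul_le_mul_left _ (Nat.add_le_add_left (len_mono (Nat.le_succ n)) _)
    linarith

/-! ### Polynomially bounded quantities -/

/-- `u` is bounded by a polynomial in the size. -/
def PolyBdd {X : Type} (size u : X → ℕ) : Prop := ∃ c, ∀ x, u x ≤ (size x + 2) ^ c

namespace PolyBdd

variable {X Y : Type} {size u v : X → ℕ}

theorem mono (h : PolyBdd size u) (hvu : ∀ x, v x ≤ u x) : PolyBdd size v := by
  obtain ⟨c, hc⟩ := h
  exact ⟨c, fun x => (hvu x).trans (hc x)⟩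

theorem const (size : X → ℕ) (a : ℕ) : PolyBdd size fun _ => a :=
  ⟨a, fun _ => Nat.lt_two_pow_self.le.trans (Nat.pow_le_pow_left (by omega) a)⟩

theorem self (size : X → ℕ) : PolyBdd size size := ⟨1, fun x => by simp⟩

theorem mul (hu : PolyBdd size u) (hv : PolyBdd size v) : PolyBdd size fun x => u x * v x := by
  obtain ⟨c, hc⟩ := hu
  obtain ⟨e, he⟩ := hv
  exact ⟨c + e, fun x => by rw [pow_add]; exact Nat.mul_le_mul (hc x) (he x)⟩

theorem add (hu : PolyBdd size u) (hv : PolyBdd size v) : PolyBdd size fun x => u x + v x := by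
  obtain ⟨c, hc⟩ := hu
  obtain ⟨e, he⟩ := hv
  refine ⟨c + e + 1, fun x => ?_⟩
  have h1 : (size x + 2) ^ c ≤ (size x + 2) ^ (c + e) := Nat.pow_le_pow_right (by omega) (by omega)
  have h2 : (size x + 2) ^ e ≤ (size x + 2) ^ (c + e) := Nat.pow_le_pow_right (by omega) (by omega)
  have h3 : 2 * (size x + 2) ^ (c + e) ≤ (size x + 2) ^ (c + e + 1) := by
    rw [pow_succ, mul_comm]; exact Nat.mul_le_mul_left _ (by omega)
  have h4 := hc x
  have h5 := he x
  dsimp only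
  omega

theorem pow (hu : PolyBdd size u) (a : ℕ) : PolyBdd size fun x => u x ^ a := by
  obtain ⟨c, hc⟩ := hu
  exact ⟨c * a, fun x => by rw [pow_mul]; exact Nat.pow_le_pow_left (hc x) a⟩

theorem comp (hu : PolyBdd size u) {size' : Y → ℕ} (π : Y → X)
    (h : ∀ y, size' y = size (π y)) : PolyBdd size' fun y => u (π y) := by
  obtain ⟨c, hc⟩ := hu
  exact ⟨c, fun y => by rw [h]; exact hc _⟩

end PolyBdd

/-! ### Functions that are computable in polynomial time -/

/-- The way in which data `x : X` are laid out in the machine: the list `list x` is in the memory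
from address `0` on, its length is in register `0`, and the registers in `vars`, all of which
precede the register `K`, hold further numbers. The numbers have polynomial length in `size x`. -/
structure View (X : Type) where
  K : ℕ
  vars : Set ℕ
  reg : X → ℕ → ℕ
  list : X → List ℕ
  size : X → ℕ
  lt_of_mem : ∀ i ∈ vars, i < K
  zero_mem : 0 ∈ vars
  reg_zero : ∀ x, reg x 0 = (list x).length
  regBdd : ∀ i ∈ vars, PolyBdd size fun x => len (reg x i)
  listBdd : ∃ c, ∀ x, ∀ e ∈ list x, len e ≤ (size x + 2) ^ c

/-- The state `s` holds the data `x`. -/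
def View.Holds {X : Type} (V : View X) (x : X) (s : State) : Prop :=
  (∀ i ∈ V.vars, s.reg i = V.reg x i) ∧
    ∀ a < (V.list x).length, s.mem a = (V.list x).getD a 0

/-- Started in `s`, the program puts `v` into register `k` within time `T`, and changes neither the
preceding registers nor the memory. -/
def Yields (p : Prog) (k : ℕ) (s : State) (v T : ℕ) : Prop :=
  ∃ t s', Exec p s t s' ∧ t ≤ T ∧ s'.reg k = v ∧ (∀ i < k, s'.reg i = s.reg i) ∧ s'.mem = s.mem

/-- `f` has values of polynomial length and is computable in polynomial time. The result can be put
into any register `k` that does not precede `V.K`, and the registers before `k` are kept, so that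
they can hold intermediate results. -/
structure Cpt {X : Type} (V : View X) (f : X → ℕ) : Prop where
  bdd : PolyBdd V.size fun x => len (f x)
  run : ∀ k, V.K ≤ k → ∃ p T, PolyBdd V.size T ∧
    ∀ x s, V.Holds x s → Yields p k s (f x) (T x)

/-- `V'` extends `V`: along `π` it holds all that `V` holds. -/
structure View.Extends {X Y : Type} (V : View X) (V' : View Y) (π : Y → X) : Prop where
  K_le : V.K ≤ V'.K
  vars : ∀ i ∈ V.vars, i ∈ V'.vars ∧ ∀ y, V'.reg y i = V.reg (π y) i
  list : ∀ y, V'.list y = V.list (π y)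
  size : ∀ y, V'.size y = V.size (π y)

variable {X Y : Type} {V : View X}

theorem View.Holds.congr {x : X} {s s' : State} {k : ℕ} (h : V.Holds x s) (hk : V.K ≤ k)
    (hreg : ∀ i < k, s'.reg i = s.reg i) (hmem : s'.mem = s.mem) : V.Holds x s' :=
  ⟨fun i hi => (hreg i ((V.lt_of_mem i hi).trans_le hk)).trans (h.1 i hi),
    fun a ha => by rw [hmem]; exact h.2 a ha⟩

theorem View.Extends.holds {V' : View Y} {π : Y → X} (hE : V.Extends V' π) {y : Y} {s : State}
    (h : V'.Holds y s) : V.Holds (π y) s :=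
  ⟨fun i hi => (h.1 i (hE.vars i hi).1).trans ((hE.vars i hi).2 y),
    fun a ha => by rw [← hE.list] at ha ⊢; exact h.2 a ha⟩

namespace Cpt

variable {f g : X → ℕ}

theorem lift {V' : View Y} {π : Y → X} (hf : Cpt V f) (hE : V.Extends V' π) :
    Cpt V' fun y => f (π y) where
  bdd := hf.bdd.comp π hE.size
  run k hk := by
    obtain ⟨p, T, hT, h⟩ := hf.run k (hE.K_le.trans hk)
    exact ⟨p, _, hT.comp π hE.size, fun y s hs => h (π y) s (hE.holds hs)⟩

theorem congr (hf : Cpt V f) (h : ∀ x, g x = f x) : Cpt V g := by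
  rwa [show g = f from funext h]

theorem const (V : View X) (a : ℕ) : Cpt V fun _ => a where
  bdd := .const _ _
  run k _ := ⟨.const k a, _, .const _ (len a), fun x s _ =>
    ⟨_, _, .const s k a, le_rfl, by simp [State.setReg],
      fun i hi => by simp [State.setReg, hi.ne], rfl⟩⟩

theorem reg (V : View X) {i : ℕ} (hi : i ∈ V.vars) : Cpt V fun x => V.reg x i where
  bdd := V.regBdd i hi
  run k hk := by
    refine ⟨.seq (.const k 0) (.arith .add k i k), _, (PolyBdd.const _ (len 0)).add
      ((V.regBdd i hi).add (PolyBdd.const _ (len 0))), fun x s hs => ?_⟩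
    have hik : i ≠ k := ((V.lt_of_mem i hi).trans_le hk).ne
    refine ⟨_, _, .seq (.const s k 0) (.arith _ .add k i k), ?_, ?_, fun j hj => ?_, rfl⟩
    · simp [State.setReg, hik, hs.1 i hi]
    · simp [State.setReg, hik, hs.1 i hi, Op.eval]
    · simp [State.setReg, hj.ne]

theorem op (o : Op) (hf : Cpt V f) (hg : Cpt V g) : Cpt V fun x => o.eval (f x) (g x) where
  bdd := (hf.bdd.add hg.bdd).mono fun x => len_eval_le o _ _
  run k hk := by
    obtain ⟨p, T, hT, hp⟩ := hf.run k hk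
    obtain ⟨q, U, hU, hq⟩ := hg.run (k + 1) (by omega)
    refine ⟨.seq p (.seq q (.arith o k k (k + 1))), _, hT.add (hU.add (hf.bdd.add hg.bdd)),
      fun x s hs => ?_⟩
    obtain ⟨t, s1, e1, ht, hv, hr, hm⟩ := hp x s hs
    obtain ⟨u, s2, e2, hu, hv', hr', hm'⟩ := hq x s1 (hs.congr hk hr hm)
    have hk2 : s2.reg k = f x := by rw [hr' k (by omega), hv]
    refine ⟨_, _, .seq e1 (.seq e2 (.arith s2 o k k (k + 1))), ?_, ?_, fun i hi => ?_, ?_⟩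
    · rw [hk2, hv']; omega
    · simp [State.setReg, hk2, hv']
    · simp [State.setReg, hi.ne, hr' i (by omega), hr i hi]
    · simp [State.setReg, hm, hm']

theorem add (hf : Cpt V f) (hg : Cpt V g) : Cpt V fun x => f x + g x := op .add hf hg
theorem sub (hf : Cpt V f) (hg : Cpt V g) : Cpt V fun x => f x - g x := op .sub hf hg
theorem mul (hf : Cpt V f) (hg : Cpt V g) : Cpt V fun x => f x * g x := op .mul hf hg
theorem div (hf : Cpt V f) (hg : Cpt V g) : Cpt V fun x => f x / g x := op .div hf hg

theorem mod (hf : Cpt V f) (hg : Cpt V g) : Cpt V fun x => f x % g x :=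
  (hf.sub (hg.mul (hf.div hg))).congr fun _ => Nat.mod_eq_sub _ _

/-- Case distinction on a computed number. -/
theorem ite_ne_zero {h : X → ℕ} (hh : Cpt V h) (hf : Cpt V f) (hg : Cpt V g) :
    Cpt V fun x => if h x ≠ 0 then f x else g x where
  bdd := (hf.bdd.add hg.bdd).mono fun x => by split_ifs <;> omega
  run k hk := by
    obtain ⟨r, S, hS, hr⟩ := hh.run k hk
    obtain ⟨p, T, hT, hp⟩ := hf.run k hk
    obtain ⟨q, U, hU, hq⟩ := hg.run k hk
    refine ⟨.seq r (.cond k p q), _, hS.add (hh.bdd.add (hT.add hU)), fun x s hs => ?_⟩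
    obtain ⟨t, s1, e1, ht, hv, hr1, hm1⟩ := hr x s hs
    by_cases h0 : h x = 0
    · obtain ⟨u, s2, e2, hu, hv2, hr2, hm2⟩ := hq x s1 (hs.congr hk hr1 hm1)
      refine ⟨_, s2, .seq e1 (.condFalse (hv.trans h0) e2), ?_, by simp [h0, hv2],
        fun i hi => (hr2 i hi).trans (hr1 i hi), hm2.trans hm1⟩
      rw [hv]; omega
    · obtain ⟨u, s2, e2, hu, hv2, hr2, hm2⟩ := hp x s1 (hs.congr hk hr1 hm1)
      refine ⟨_, s2, .seq e1 (.condTrue (hv.trans_ne h0) e2), ?_, by simp [h0, hv2],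
        fun i hi => (hr2 i hi).trans (hr1 i hi), hm2.trans hm1⟩
      rw [hv]; omega

end Cpt

/-- A property that can be tested in polynomial time. -/
def CptProp {X : Type} (V : View X) (P : X → Prop) : Prop :=
  ∃ h : X → ℕ, Cpt V h ∧ ∀ x, P x ↔ h x ≠ 0

namespace CptProp

variable {f g : X → ℕ} {P Q : X → Prop}

theorem lt (hf : Cpt V f) (hg : Cpt V g) : CptProp V fun x => f x < g x :=
  ⟨_, hg.sub hf, fun x => by omega⟩

theorem not (hP : CptProp V P) : CptProp V fun x => ¬ P x := by
  obtain ⟨h, hh, hPh⟩ := hP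
  exact ⟨_, (Cpt.const V 1).sub hh, fun x => by simp only [hPh x]; omega⟩

theorem and (hP : CptProp V P) (hQ : CptProp V Q) : CptProp V fun x => P x ∧ Q x := by
  obtain ⟨h, hh, hPh⟩ := hP
  obtain ⟨h', hh', hQh⟩ := hQ
  exact ⟨_, hh.mul hh', fun x => by simp only [hPh x, hQh x, ← mul_ne_zero_iff]⟩

theorem or (hP : CptProp V P) (hQ : CptProp V Q) : CptProp V fun x => P x ∨ Q x := by
  obtain ⟨h, hh, hPh⟩ := hP
  obtain ⟨h', hh', hQh⟩ := hQ
  exact ⟨_, hh.add hh', fun x => by simp only [hPh x, hQh x]; omega⟩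

theorem congr (hP : CptProp V P) (h : ∀ x, Q x ↔ P x) : CptProp V Q := by
  rwa [show Q = P from funext fun x => propext (h x)]

theorem le (hf : Cpt V f) (hg : Cpt V g) : CptProp V fun x => f x ≤ g x :=
  (lt hg hf).not.congr fun _ => not_lt.symm

theorem eq (hf : Cpt V f) (hg : Cpt V g) : CptProp V fun x => f x = g x :=
  ((le hf hg).and (le hg hf)).congr fun _ => le_antisymm_iff

end CptProp

namespace Cpt

variable {f g : X → ℕ}

theorem ite {P : X → Prop} [∀ x, Decidable (P x)] (hP : CptProp V P) (hf : Cpt V f)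
    (hg : Cpt V g) : Cpt V fun x => if P x then f x else g x := by
  obtain ⟨h, hh, hPh⟩ := hP
  exact (ite_ne_zero hh hf hg).congr fun x => if_congr (hPh x) rfl rfl

theorem min (hf : Cpt V f) (hg : Cpt V g) : Cpt V fun x => min (f x) (g x) :=
  (ite (.le hf hg) hf hg).congr fun _ => min_def _ _

/-- Reading an entry of the list; the entries beyond its end count as `0`. -/
theorem getD (hf : Cpt V f) : Cpt V fun x => (V.list x).getD (f x) 0 := by
  have hbdd : PolyBdd V.size fun x => len ((V.list x).getD (f x) 0) := by
    obtain ⟨c, hc⟩ := V.listBdd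
    refine PolyBdd.mono ⟨c, fun x => le_rfl⟩ fun x => ?_
    by_cases h : f x < (V.list x).length
    · rw [List.getD_eq_getElem _ _ h]
      exact hc x _ (List.getElem_mem h)
    · rw [List.getD_eq_default _ _ (by omega)]
      exact (len_le_of_lt le_rfl (by norm_num)).trans (Nat.one_le_pow _ _ (by omega))
  refine ⟨hbdd, fun k hk => ?_⟩
  have hlen : Cpt V fun x => (V.list x).length - f x :=
    ((reg V V.zero_mem).congr fun x => (V.reg_zero x).symm).sub hf
  obtain ⟨p, T, hT, hp⟩ := hf.run (k + 1) (by omega)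
  obtain ⟨w, W, hW, hw⟩ := hlen.run k hk
  refine ⟨.seq w (.seq p (.cond k (.load k (k + 1)) (.const k 0))), _,
    hW.add (hT.add (hlen.bdd.add ((hf.bdd.add hbdd).add (.const _ (len 0))))),
    fun x s hs => ?_⟩
  obtain ⟨t, s1, e1, ht, hv, hr1, hm1⟩ := hw x s hs
  obtain ⟨u, s2, e2, hu, hv2, hr2, hm2⟩ := hp x s1 (hs.congr hk hr1 hm1)
  have hk2 : s2.reg k = (V.list x).length - f x := by rw [hr2 k (by omega), hv]
  by_cases h : f x < (V.list x).length
  · have e3 := Exec.load s2 k (k + 1)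
    have hmem : s2.mem (f x) = (V.list x).getD (f x) 0 := by rw [hm2, hm1]; exact hs.2 _ h
    rw [hv2, hmem] at e3
    refine ⟨_, _, .seq e1 (.seq e2 (.condTrue (by omega) e3)), ?_, by simp [State.setReg],
      fun i hi => ?_, ?_⟩
    · rw [hk2]; omega
    · simp [State.setReg, hi.ne, hr2 i (by omega), hr1 i hi]
    · simp [State.setReg, hm2, hm1]
  · refine ⟨_, _, .seq e1 (.seq e2 (.condFalse (by omega) (.const s2 k 0))), ?_, ?_,
      fun i hi => ?_, ?_⟩
    · rw [hk2]; omega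
    · rw [List.getD_eq_default _ _ (not_lt.1 h)]; simp [State.setReg]
    · simp [State.setReg, hi.ne, hr2 i (by omega), hr1 i hi]
    · simp [State.setReg, hm2, hm1]

end Cpt

/-- The indices of an iteration of `f x` steps, for data `x`. -/
abbrev Steps {X : Type} (f : X → ℕ) : Type := {y : X × ℕ // y.2 < f y.1}

/-- Inside an iteration: register `k` holds the current value, register `k + 1` the index. -/
def View.iter (V : View X) (k : ℕ) (hk : V.K ≤ k) (f : X → ℕ) (hf : PolyBdd V.size f)
    (acc : X → ℕ → ℕ) (hacc : ∃ c, ∀ x, ∀ i ≤ f x, len (acc x i) ≤ (V.size x + 2) ^ c) :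
    View (Steps f) where
  K := k + 3
  vars := insert k (insert (k + 1) V.vars)
  reg y i := if i = k then acc y.1.1 y.1.2 else if i = k + 1 then y.1.2 else V.reg y.1.1 i
  list y := V.list y.1.1
  size y := V.size y.1.1
  lt_of_mem i hi := by
    rcases hi with rfl | rfl | hi
    · omega
    · omega
    · have := V.lt_of_mem i hi; omega
  zero_mem := .inr (.inr V.zero_mem)
  reg_zero y := by
    have := V.lt_of_mem 0 V.zero_mem
    rw [if_neg (by omega), if_neg (by omega), V.reg_zero]
  regBdd i hi := by
    by_cases h1 : i = k
    · obtain ⟨c, hc⟩ := hacc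
      exact ⟨c, fun y => by simpa [h1] using hc y.1.1 y.1.2 y.2.le⟩
    · by_cases h2 : i = k + 1
      · subst h2
        simp only [Nat.add_eq_left, one_ne_zero, if_false, if_true]
        refine ((hf.add (.const _ 1)).comp (fun y : Steps f => y.1.1) fun _ => rfl).mono
          fun y => (len_le_succ _).trans ?_
        have := y.2
        omega
      · simp only [h1, h2, if_false]
        exact (V.regBdd i ((hi.resolve_left h1).resolve_left h2)).comp _ fun _ => rfl
  listBdd := by
    obtain ⟨c, hc⟩ := V.listBdd
    exact ⟨c, fun y => hc y.1.1⟩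

namespace Cpt

variable {f g : X → ℕ}

/-- Bounded iteration with a polynomial number of steps; the values have to stay of polynomial
length. -/
theorem iterate (hf : Cpt V f) (hfb : PolyBdd V.size f) (acc : X → ℕ → ℕ)
    (h0 : Cpt V fun x => acc x 0)
    (hacc : ∃ c, ∀ x, ∀ i ≤ f x, len (acc x i) ≤ (V.size x + 2) ^ c)
    (hstep : ∀ V' : View (Steps f), V.Extends V' (fun y => y.1.1) → Cpt V' (fun y => y.1.2) →
      Cpt V' (fun y => acc y.1.1 y.1.2) → Cpt V' fun y => acc y.1.1 (y.1.2 + 1)) :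
    Cpt V fun x => acc x (f x) where
  bdd := by
    obtain ⟨c, hc⟩ := hacc
    exact ⟨c, fun x => hc x _ le_rfl⟩
  run k hk := by
    set V' := V.iter k hk f hfb acc hacc with hV'
    have hE : V.Extends V' fun y => y.1.1 := by
      refine ⟨by simp only [hV', View.iter]; omega, fun i hi => ⟨.inr (.inr hi), fun y => ?_⟩,
        fun _ => rfl, fun _ => rfl⟩
      have := V.lt_of_mem i hi
      simp only [hV', View.iter]
      rw [if_neg (by omega), if_neg (by omega)]
    have hidx : Cpt V' fun y => y.1.2 :=
      (reg V' (i := k + 1) (.inr (.inl rfl))).congr fun y => by simp [hV', View.iter]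
    have hcur : Cpt V' fun y => acc y.1.1 y.1.2 :=
      (reg V' (i := k) (.inl rfl)).congr fun y => by simp [hV', View.iter]
    have hnext := hstep V' hE hidx hcur
    obtain ⟨b, T, ⟨c, hT⟩, hb⟩ := hnext.run (k + 3) le_rfl
    obtain ⟨p, T₁, hT₁, hp⟩ := h0.run k hk
    obtain ⟨q, T₂, hT₂, hq⟩ := hf.run (k + 2) (by omega)
    obtain ⟨e, he⟩ := hacc
    have hB : PolyBdd V.size fun x => (V.size x + 2) ^ c +
        ((V.size x + 2) ^ e + 1 + (f x + 1 + 1 + (f x + 1 + 1) + 10)) :=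
      (PolyBdd.add ⟨c, fun _ => le_rfl⟩ (((PolyBdd.add ⟨e, fun _ => le_rfl⟩ (.const _ 1))).add
        ((((hfb.add (.const _ 1)).add (.const _ 1)).add
          ((hfb.add (.const _ 1)).add (.const _ 1))).add (.const _ 10))))
    refine ⟨.seq p (.seq q (.seq (.const (k + 1) 0) (.loop (k + 2) (.seq b (.seq (.const (k + 4) 0)
      (.seq (.arith .add k (k + 3) (k + 4)) (.seq (.const (k + 4) 1)
      (.seq (.arith .add (k + 1) (k + 1) (k + 4)) (.arith .sub (k + 2) (k + 2) (k + 4)))))))))), _,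
      hT₁.add (hT₂.add ((PolyBdd.const _ 1).add ((hfb.mul (hB.add hf.bdd)).add (.const _ 1)))),
      fun x s hs => ?_⟩
    obtain ⟨t1, s1, e1, ht1, hv1, hr1, hm1⟩ := hp x s hs
    obtain ⟨t2, s2, e2, ht2, hv2, hr2, hm2⟩ := hq x s1 (hs.congr hk hr1 hm1)
    have e3 := Exec.const s2 (k + 1) 0
    let Inv : ℕ → State → Prop := fun a u => u.reg (k + 2) = a ∧ a ≤ f x ∧
      u.reg k = acc x (f x - a) ∧ u.reg (k + 1) = f x - a ∧ (∀ i < k, u.reg i = s.reg i) ∧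
      u.mem = s.mem
    obtain ⟨t4, s4, e4, ht4, h4⟩ := Exec.countdown (r := k + 2) (T := (V.size x + 2) ^ c +
        ((V.size x + 2) ^ e + 1 + (f x + 1 + 1 + (f x + 1 + 1) + 10))) Inv (fun a u h => h.1) (f x)
      (p := (.seq b (.seq (.const (k + 4) 0) (.seq (.arith .add k (k + 3) (k + 4))
        (.seq (.const (k + 4) 1) (.seq (.arith .add (k + 1) (k + 1) (k + 4))
        (.arith .sub (k + 2) (k + 2) (k + 4)))))))) (by
        rintro a ha u ⟨hu1, -, hu2, hu3, hu4, hu5⟩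
        let y : Steps f := ⟨(x, f x - (a + 1)), by dsimp only; omega⟩
        have hy : V'.Holds y u := by
          refine ⟨fun i hi => ?_, fun j hj => ?_⟩
          · by_cases h1 : i = k
            · simp [hV', View.iter, h1, hu2, y]
            · by_cases h2 : i = k + 1
              · simp [hV', View.iter, h2, hu3, y]
              · have hi' := (hi.resolve_left h1).resolve_left h2
                simp only [hV', View.iter, h1, h2, if_false]
                rw [hu4 i ((V.lt_of_mem i hi').trans_le hk), hs.1 i hi']
          · rw [hu5]; exact hs.2 j hj
        obtain ⟨t, u1, e, ht, hv, hr, hm⟩ := hb y u hy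
        have hsub : f x - (a + 1) + 1 = f x - a := by omega
        simp only [y, hsub] at hv
        have ht' : t ≤ (V.size x + 2) ^ c := ht.trans (hT y)
        have hl0 : len 0 = 1 := by simp [len]
        have hl1 : len 1 = 1 := by simp [len]
        refine ⟨_, _, .seq e (.seq (.const _ _ _) (.seq (.arith _ .add _ _ _) (.seq (.const _ _ _)
          (.seq (.arith _ .add _ _ _) (.arith _ .sub _ _ _))))), ?_, ?_, by omega, ?_, ?_,
          fun i hi => ?_, ?_⟩
        · have h1 := len_le_succ (f x - (a + 1))
          have h2 := len_le_succ (a + 1)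
          have h3 := he x (f x - a) (by omega)
          simp [State.setReg, Op.eval, hv, hr (k + 1) (by omega), hr (k + 2) (by omega), hu1, hu3,
            hl0, hl1]
          omega
        · simp [State.setReg, Op.eval, hr (k + 2) (by omega), hu1]
        · simp [State.setReg, Op.eval, hv]
        · simp [State.setReg, Op.eval, hr (k + 1) (by omega), hu3, hsub]
        · have h1 : i ≠ k + 1 := by omega
          have h2 : i ≠ k + 2 := by omega
          have h4 : i ≠ k + 4 := by omega
          simp [State.setReg, hi.ne, h1, h2, h4, hr i (by omega), hu4 i hi]
        · simp [State.setReg, hm, hu5]) (s2.setReg (k + 1) 0) (by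
        refine ⟨by simp [State.setReg, hv2], le_rfl, ?_, by simp [State.setReg], fun i hi => ?_,
          by simp [State.setReg, hm1, hm2]⟩
        · simp [State.setReg, hr2 k (by omega), hv1]
        · have h1 : i ≠ k + 1 := by omega
          simp [State.setReg, h1, hr2 i (by omega), hr1 i hi])
    refine ⟨_, s4, .seq e1 (.seq e2 (.seq e3 e4)), ?_, by simpa using h4.2.2.1, h4.2.2.2.2.1,
      h4.2.2.2.2.2⟩
    have hl0 : len 0 = 1 := by simp [len]
    rw [hl0]
    omega

/-- Sums of polynomially many terms. -/
theorem sum (hf : Cpt V f) (hfb : PolyBdd V.size f) (g : X → ℕ → ℕ)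
    (hg : ∀ V' : View (Steps f), V.Extends V' (fun y => y.1.1) → Cpt V' (fun y => y.1.2) →
      Cpt V' fun y => g y.1.1 y.1.2)
    (hgb : ∃ c, ∀ x, ∀ i < f x, g x i ≤ 2 ^ (V.size x + 2) ^ c) :
    Cpt V fun x => ∑ i ∈ Finset.range (f x), g x i := by
  refine iterate hf hfb (fun x i => ∑ j ∈ Finset.range i, g x j) (by simpa using const V 0) ?_ ?_
  · obtain ⟨c, hc⟩ := hgb
    obtain ⟨e, he⟩ : PolyBdd V.size fun x => f x + 1 + ((V.size x + 2) ^ c + 1) :=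
      (hfb.add (.const _ 1)).add (PolyBdd.add ⟨c, fun _ => le_rfl⟩ (.const _ 1))
    refine ⟨e, fun x i hi => le_trans ?_ (he x)⟩
    have h1 : ∑ j ∈ Finset.range i, g x j ≤ f x * 2 ^ (V.size x + 2) ^ c := by
      refine (Finset.sum_le_card_nsmul _ _ _ fun j hj => hc x j ?_).trans ?_
      · have := Finset.mem_range.1 hj; omega
      · rw [Finset.card_range, smul_eq_mul]; exact Nat.mul_le_mul_right _ hi
    refine (len_mono h1).trans ((len_mul_le _ _).trans (Nat.add_le_add (len_le_succ _) ?_))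
    exact len_le_of_lt (by omega) (Nat.pow_lt_pow_right (by norm_num) (Nat.lt_succ_self _))
  · intro V' hE hi hcur
    exact (hcur.add (hg V' hE hi)).congr fun y => Finset.sum_range_succ _ _

/-- Powers of a constant with polynomially bounded exponents. -/
theorem const_pow (b : ℕ) (hf : Cpt V f) (hfb : PolyBdd V.size f) : Cpt V fun x => b ^ f x := by
  refine iterate hf hfb (fun _ i => b ^ i) (by simpa using const V 1) ?_ ?_
  · obtain ⟨c, hc⟩ := (hfb.mul (.const _ (len b))).add (.const _ 1)
    refine ⟨c, fun x i hi => (len_pow_le b i).trans (le_trans ?_ (hc x))⟩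
    dsimp only
    gcongr
  · intro V' _ _ hcur
    exact (hcur.mul (const V' b)).congr fun y => pow_succ _ _

theorem clog {b : ℕ} (hb : 1 < b) (hg : Cpt V g) (hf : Cpt V f) (hfb : PolyBdd V.size f)
    (hle : ∀ x, g x ≤ b ^ f x) : Cpt V fun x => Nat.clog b (g x) := by
  refine (sum hf hfb (fun x i => if b ^ i < g x then 1 else 0) (fun V' hE hi => ?_) ?_).congr
    fun x => ?_
  · refine ite (.lt (const_pow b hi ?_) (hg.lift hE)) (const V' 1) (const V' 0)
    exact (hfb.comp (fun y : Steps f => y.1.1) hE.size).mono fun y => y.2.le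
  · exact ⟨0, fun x i _ => by split_ifs <;> simp⟩
  · rw [Finset.sum_ite, Finset.sum_const_zero, Finset.sum_const, smul_eq_mul, mul_one, add_zero]
    have : (Finset.range (f x)).filter (fun i => b ^ i < g x) = Finset.range (Nat.clog b (g x)) := by
      ext i
      have h1 := Nat.clog_le_of_le_pow (hle x)
      simp only [Finset.mem_filter, Finset.mem_range, Nat.lt_clog_iff_pow_lt hb]
      constructor
      · exact fun h => h.2
      · intro h
        exact ⟨((Nat.lt_clog_iff_pow_lt hb).2 h).trans_le h1, h⟩
    rw [this, Finset.card_range]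

end Cpt

end RAM

/-! ### Common subtrees as partial maps -/

namespace RTree

variable {a b : ℕ} {H : RTree a} {G : RTree b}

theorem Embeds.card_le {k n : ℕ} {S : RTree k} {T : RTree n} (h : S.Embeds T) : k ≤ n := by
  obtain ⟨f, hf, -⟩ := h
  simpa using Fintype.card_le_of_injective f hf

theorem bddAbove_common (H : RTree a) (G : RTree b) :
    BddAbove {k : ℕ | ∃ S : RTree k, S.Embeds H ∧ S.Embeds G} :=
  ⟨a, fun _ ⟨_, h, _⟩ => h.card_le⟩

/-- A set of vertices that contains the root and is closed under parents, and that is mapped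
injectively with root and parents respected, is a common subtree. -/
theorem card_le_lcst (W : Finset (Fin a)) (hroot : H.root ∈ W) (hW : ∀ v ∈ W, H.parent v ∈ W)
    (φ : Fin a → Fin b) (hinj : Set.InjOn φ W) (hφ : φ H.root = G.root)
    (hpar : ∀ v ∈ W, φ (H.parent v) = G.parent (φ v)) : W.card ≤ H.lcst G := by
  let e : W ≃ Fin W.card := W.equivFin
  have hit : ∀ (k : ℕ) (v : Fin W.card),
      ((e.symm ((fun v => e ⟨H.parent (e.symm v), hW _ (e.symm v).2⟩)^[k] v) : W) : Fin a) =
        H.parent^[k] (e.symm v : W) := by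
    intro k v
    induction k with
    | zero => rfl
    | succ k ih => rw [Function.iterate_succ_apply', Function.iterate_succ_apply', ← ih]; simp
  let S : RTree W.card :=
    { root := e ⟨H.root, hroot⟩
      parent := fun v => e ⟨H.parent (e.symm v), hW _ (e.symm v).2⟩
      parent_root := by simp [H.parent_root]
      reaches_root := fun v => by
        obtain ⟨k, hk⟩ := H.reaches_root (e.symm v : W)
        refine ⟨k, ?_⟩
        rw [← e.symm.injective.eq_iff, e.symm_apply_apply]
        exact Subtype.ext ((hit k v).trans hk) }
  refine le_csSup (bddAbove_common H G) ⟨S, ⟨fun v => (e.symm v : W), ?_, by simp [S], fun v => by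
    simp [S]⟩, ⟨fun v => φ (e.symm v : W), ?_, by simp [S, hφ], fun v => ?_⟩⟩
  · exact Subtype.val_injective.comp e.symm.injective
  · intro v w hvw
    exact e.symm.injective (Subtype.ext (hinj (e.symm v).2 (e.symm w).2 hvw))
  · simp [S, hpar _ (e.symm v).2]

/-- A largest common subtree, as a set of vertices of `H` with a map to the vertices of `G`. -/
theorem exists_card_eq_lcst (H : RTree a) (G : RTree b) : ∃ (W : Finset (Fin a))
    (φ : Fin a → Fin b), H.root ∈ W ∧ (∀ v ∈ W, H.parent v ∈ W) ∧ Set.InjOn φ W ∧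
      φ H.root = G.root ∧ (∀ v ∈ W, φ (H.parent v) = G.parent (φ v)) ∧ W.card = H.lcst G := by
  have hne : {k : ℕ | ∃ S : RTree k, S.Embeds H ∧ S.Embeds G}.Nonempty :=
    ⟨1, ⟨0, id, rfl, fun v => ⟨0, Subsingleton.elim _ _⟩⟩,
      ⟨fun _ => H.root, fun _ _ _ => Subsingleton.elim _ _, rfl, fun _ => H.parent_root.symm⟩,
      ⟨fun _ => G.root, fun _ _ _ => Subsingleton.elim _ _, rfl, fun _ => G.parent_root.symm⟩⟩
  obtain ⟨S, ⟨f, hf, hfr, hfp⟩, ⟨g, hg, hgr, hgp⟩⟩ := Nat.sSup_mem hne (bddAbove_common H G)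
  have : Nonempty (Fin _) := ⟨S.root⟩
  have hinv : ∀ v, Function.invFun f (f v) = v := Function.leftInverse_invFun hf
  refine ⟨Finset.univ.image f, fun v => g (Function.invFun f v), ?_, ?_, ?_, ?_, ?_, ?_⟩
  · exact Finset.mem_image.2 ⟨S.root, Finset.mem_univ _, hfr⟩
  · intro v hv
    obtain ⟨u, -, rfl⟩ := Finset.mem_image.1 hv
    exact Finset.mem_image.2 ⟨S.parent u, Finset.mem_univ _, hfp u⟩
  · intro v hv w hw hvw
    obtain ⟨u, -, rfl⟩ := Finset.mem_image.1 (Finset.mem_coe.1 hv)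
    obtain ⟨t, -, rfl⟩ := Finset.mem_image.1 (Finset.mem_coe.1 hw)
    simp only [hinv] at hvw
    rw [hg hvw]
  · simp only [← hfr, hinv, hgr]
  · intro v hv
    obtain ⟨u, -, rfl⟩ := Finset.mem_image.1 hv
    simp only [← hfp, hinv, hgp]
  · rw [Finset.card_image_of_injective _ hf, Finset.card_univ, Fintype.card_fin]; rfl

/-- The children of a vertex are counted by labels that distinguish siblings. -/
theorem degreeLE_of_label {d : ℕ} (l : Fin a → ℕ) (hl : ∀ v, l v < d)
    (h : ∀ u v, u ≠ H.root → v ≠ H.root → H.parent u = H.parent v → l u = l v → u = v) :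
    H.DegreeLE d := by
  intro v
  refine (Finset.card_le_card_of_injOn l (fun u _ => Finset.mem_coe.2 (Finset.mem_range.2 (hl u)))
    ?_).trans (Finset.card_range d).le
  intro u hu w hw huw
  simp only [children, Finset.coe_filter, Finset.mem_univ, true_and, Set.mem_ofPred_eq] at hu hw
  exact h u w hu.1 hw.1 (hu.2.trans hw.2.symm) huw

theorem height_le {k : ℕ} (h : ∀ v, H.parent^[k] v = H.root) : H.height ≤ k :=
  Finset.sup_le fun v _ => Nat.sInf_le (h v)

end RTree

/-! ### Automorphisms of the `d`-ary heap -/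

/-- The map on the `d`-ary heap, in which `v / d` is the parent of `v`, that exchanges the subtrees
below `b` and `c`. -/
def heapSwap (d b c v : ℕ) : ℕ :=
  if v = b then c else if v = c then b else
    if _h : v = 0 ∨ d < 2 then v else d * heapSwap d b c (v / d) + v % d
termination_by v
decreasing_by exact Nat.div_lt_self (by omega) (by omega)

section heapSwap

variable {d b c : ℕ}

theorem heapSwap_left : heapSwap d b c b = c := by rw [heapSwap, if_pos rfl]

theorem heapSwap_right : heapSwap d b c c = b := by
  rw [heapSwap]; split_ifs with h <;> simp_all

theorem heapSwap_zero (hb : b ≠ 0) (hc : c ≠ 0) : heapSwap d b c 0 = 0 := by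
  rw [heapSwap, if_neg hb.symm, if_neg hc.symm, dif_pos (.inl rfl)]

theorem heapSwap_of_ne (hd : 2 ≤ d) {v : ℕ} (hb : v ≠ b) (hc : v ≠ c) (hv : v ≠ 0) :
    heapSwap d b c v = d * heapSwap d b c (v / d) + v % d := by
  rw [heapSwap, if_neg hb, if_neg hc, dif_neg (by omega)]

theorem heapSwap_div_fixed (hd : 2 ≤ d) (hb : b ≠ 0) (hc : c ≠ 0) (hbc : b / d = c / d) :
    ∀ w ≤ b / d, heapSwap d b c w = w := by
  intro w
  induction w using Nat.strong_induction_on with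
  | _ w ih =>
    intro hw
    rcases eq_or_ne w 0 with rfl | h0
    · exact heapSwap_zero hb hc
    · have h1 : b / d < b := Nat.div_lt_self (by omega) (by omega)
      have h2 : c / d < c := Nat.div_lt_self (by omega) (by omega)
      have h3 : w / d < w := Nat.div_lt_self (by omega) (by omega)
      rw [heapSwap_of_ne hd (by omega) (by omega) h0, ih _ h3 (by omega), Nat.div_add_mod]

theorem heapSwap_div (hd : 2 ≤ d) (hb : b ≠ 0) (hc : c ≠ 0) (hbc : b / d = c / d) (v : ℕ) :
    heapSwap d b c (v / d) = heapSwap d b c v / d := by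
  by_cases h1 : v = b
  · rw [h1, heapSwap_left, heapSwap_div_fixed hd hb hc hbc _ le_rfl, hbc]
  by_cases h2 : v = c
  · rw [h2, heapSwap_right, heapSwap_div_fixed hd hb hc hbc _ hbc.ge, hbc]
  by_cases h3 : v = 0
  · simp [h3, heapSwap_zero hb hc]
  · rw [heapSwap_of_ne hd h1 h2 h3, Nat.mul_add_div (by omega),
      Nat.div_eq_of_lt (Nat.mod_lt v (by omega)), add_zero]

theorem heapSwap_heapSwap (hd : 2 ≤ d) (hb : b ≠ 0) (hc : c ≠ 0) (hbc : b / d = c / d) (v : ℕ) :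
    heapSwap d b c (heapSwap d b c v) = v := by
  induction v using Nat.strong_induction_on with
  | _ v ih =>
    by_cases h1 : v = b
    · rw [h1, heapSwap_left, heapSwap_right]
    by_cases h2 : v = c
    · rw [h2, heapSwap_right, heapSwap_left]
    by_cases h3 : v = 0
    · simp [h3, heapSwap_zero hb hc]
    have h4 := heapSwap_of_ne hd h1 h2 h3
    have ih' := ih (v / d) (Nat.div_lt_self (by omega) (by omega))
    set w := heapSwap d b c v with hw
    have hwd : w / d = heapSwap d b c (v / d) := (heapSwap_div hd hb hc hbc v).symm
    have hwm : w % d = v % d := by rw [h4]; simp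
    have key : heapSwap d b c (w / d) = v / d := by rw [hwd, ih']
    have hne : ∀ u, heapSwap d b c (u / d) = u / d → w = u → v = u := by
      rintro u hu rfl
      rw [← Nat.div_add_mod v d, ← Nat.div_add_mod w d, ← hwm, ← key, hu]
    have hwb : w ≠ b := fun h => h1 (hne b (heapSwap_div_fixed hd hb hc hbc _ le_rfl) h)
    have hwc : w ≠ c := fun h => h2 (hne c (heapSwap_div_fixed hd hb hc hbc _ hbc.ge) h)
    have hw0 : w ≠ 0 := fun h => h3 (hne 0 (by simp [heapSwap_zero hb hc]) h)
    rw [heapSwap_of_ne hd hwb hwc hw0, key, hwm, Nat.div_add_mod]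

end heapSwap

/-- Any two vertices of the same level are related by an automorphism of the `d`-ary heap. -/
theorem exists_heap_automorphism {d : ℕ} (hd : 2 ≤ d) (a : ℕ) : ∀ b : ℕ,
    (∀ i, a < d ^ i ↔ b < d ^ i) → ∃ π : ℕ → ℕ, Function.Injective π ∧ π 0 = 0 ∧
      (∀ v, π (v / d) = π v / d) ∧ π a = b := by
  induction a using Nat.strong_induction_on with
  | _ a ih =>
    intro b hab
    rcases eq_or_ne a 0 with rfl | ha
    · have := (hab 0).1 (by simp)
      exact ⟨id, Function.injective_id, rfl, fun _ => rfl, by simp at this; simp [this]⟩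
    have hb : b ≠ 0 := fun h => ha (by have := (hab 0).2 (by simp [h]); simpa using this)
    obtain ⟨π, hinj, h0, hdiv, hπ⟩ := ih (a / d) (Nat.div_lt_self (by omega) (by omega)) (b / d)
      fun i => by
        rw [Nat.div_lt_iff_lt_mul (by omega), Nat.div_lt_iff_lt_mul (by omega), ← pow_succ]
        exact hab (i + 1)
    have hc : π a ≠ 0 := fun h => ha (hinj (h.trans h0.symm))
    have hcb : π a / d = b / d := by rw [← hdiv, hπ]
    refine ⟨fun v => heapSwap d (π a) b (π v), fun v w hvw => hinj ?_, ?_, fun v => ?_,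
      heapSwap_left⟩
    · have := congrArg (heapSwap d (π a) b) hvw
      simpa only [heapSwap_heapSwap hd hc hb hcb] using this
    · simp only [h0, heapSwap_zero hc hb]
    · simp only [hdiv, heapSwap_div hd hc hb hcb]

/-! ### The trees of the reduction -/

/-- The common parameters of the two trees: `d` is the degree, the selector is a `d`-ary heap with
`L + 1` digits, each gadget encodes `m` bits, and `r` bounds the number of binary digits of
`2 * m`. -/
structure Shape where
  d : ℕ
  L : ℕ
  r : ℕ
  m : ℕ
  two_le_d : 2 ≤ d
  m_pos : 0 < m
  le_two_pow : 2 * m ≤ 2 ^ r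

namespace Shape

/-- The common height of the trees. -/
def h (P : Shape) : ℕ := P.L + 2 * P.r + 10

/-- The number of leaves of the selector. -/
def N (P : Shape) : ℕ := (P.d - 1) * P.d ^ P.L

theorem d_pos (P : Shape) : 0 < P.d := by have := P.two_le_d; omega

theorem pow_succ_eq (P : Shape) : P.d ^ (P.L + 1) = P.d ^ P.L + P.N := by
  obtain ⟨e, he⟩ := Nat.exists_eq_add_of_le' P.d_pos
  simp only [N, he, Nat.add_sub_cancel, pow_succ]
  ring

theorem N_lt (P : Shape) : P.N < P.d ^ (P.h - 1) := by
  have h1 : P.d ^ (P.L + 1) ≤ P.d ^ (P.h - 1) :=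
    Nat.pow_le_pow_right P.d_pos (by simp only [h]; omega)
  have h2 := P.pow_succ_eq
  have h3 : 0 < P.d ^ P.L := Nat.pow_pos P.d_pos
  omega

/-- What distinguishes the two trees: the number `κ` of gadgets below each leaf of the selector, the
number `q` of additional vertices in each gadget, and the bits that the gadgets encode. -/
structure Filling (P : Shape) where
  κ : ℕ
  q : ℕ
  bit : ℕ → ℕ → Bool
  κ_pos : 0 < κ
  κ_le : κ ≤ 2
  q_le : q ≤ P.m

end Shape

/-- The vertices: padding, selector, and four kinds of vertices of the `g`-th gadget. -/
inductive Vert where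
  | pad (v : ℕ)
  | sel (v : ℕ)
  | top (g t : ℕ)
  | bot (g s : ℕ)
  | mark (g s : ℕ)
  | ext (g e : ℕ)

namespace Shape.Filling

variable {P : Shape} (F : P.Filling)

/-- The parents. The padding and the selector are heaps. In a gadget, `top g s` and `bot g s` with
`s < 2 * m` are the upper and the lower half of the vertex `s` of a binary heap; the vertices
`mark g s` distinguish the even vertices of the heap from the odd ones. Below the leaf
`s = m + c` of the heap hang `top g (2 * s)` and `top g (2 * s + 1)`, as siblings if the bit `c` is
set and as a path if not. -/
def par : Vert → Vert
  | .pad v => .pad (v / P.d)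
  | .sel v => if v = 0 then .pad 0 else .sel (v / P.d)
  | .top g t => if t = 0 then .sel (P.d ^ P.L + g / F.κ) else
      if 2 * P.m ≤ t ∧ t % 2 = 1 ∧ F.bit g (t / 2 - P.m) = false then .top g (t - 1)
      else .bot g (t / 2)
  | .bot g s => .top g s
  | .mark g s => if s % 2 = 0 then .top g s else .mark g (s - 1)
  | .ext g e => .top g (2 * P.m + 2 * e)

/-- The vertices that occur in the tree. -/
def Valid : Vert → Prop
  | .pad v => v < P.d ^ P.h
  | .sel v => v < P.d ^ (P.L + 1)
  | .top g t => g < F.κ * P.N ∧ t < 4 * P.m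
  | .bot g s => g < F.κ * P.N ∧ s < 2 * P.m
  | .mark g s => g < F.κ * P.N ∧ s < 2 * P.m
  | .ext g e => g < F.κ * P.N ∧ e < F.q

/-- The number of vertices of a gadget. -/
def E : ℕ := 8 * P.m + F.q

/-- The number of vertices of the tree. -/
def n : ℕ := P.d ^ P.h + P.d ^ (P.L + 1) + F.κ * P.N * F.E

/-- The number of the `w`-th vertex of the `g`-th gadget. -/
def gadget (g w : ℕ) : ℕ := P.d ^ P.h + P.d ^ (P.L + 1) + (g * F.E + w)

/-- The numbering of the vertices. -/
def code : Vert → ℕ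
  | .pad v => v
  | .sel v => P.d ^ P.h + v
  | .top g t => F.gadget g t
  | .bot g s => F.gadget g (4 * P.m + s)
  | .mark g s => F.gadget g (6 * P.m + s)
  | .ext g e => F.gadget g (8 * P.m + e)

/-- The `w`-th vertex of the `g`-th gadget. -/
def gadgetVert (P : Shape) (g w : ℕ) : Vert :=
  if w < 4 * P.m then .top g w else if w < 6 * P.m then .bot g (w - 4 * P.m) else
    if w < 8 * P.m then .mark g (w - 6 * P.m) else .ext g (w - 8 * P.m)

/-- The vertex with a given number. -/
def decode (u : ℕ) : Vert :=
  if u < P.d ^ P.h then .pad u else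
    if u < P.d ^ P.h + P.d ^ (P.L + 1) then .sel (u - P.d ^ P.h) else
      gadgetVert P ((u - (P.d ^ P.h + P.d ^ (P.L + 1))) / F.E)
        ((u - (P.d ^ P.h + P.d ^ (P.L + 1))) % F.E)

theorem E_pos : 0 < F.E := by have := P.m_pos; simp only [E]; omega

theorem decode_gadget {g w : ℕ} (hw : w < F.E) : F.decode (F.gadget g w) = gadgetVert P g w := by
  have h1 : (g * F.E + w) / F.E = g := by
    rw [mul_comm, Nat.mul_add_div F.E_pos, Nat.div_eq_of_lt hw, add_zero]
  have h2 : (g * F.E + w) % F.E = w := by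
    rw [mul_comm, Nat.mul_add_mod, Nat.mod_eq_of_lt hw]
  rw [decode, gadget, if_neg (by omega), if_neg (by omega), Nat.add_sub_cancel_left, h1, h2]

theorem decode_code {v : Vert} (hv : F.Valid v) : F.decode (F.code v) = v := by
  have hm := P.m_pos
  cases v with
  | pad v => simp only [Valid] at hv; simp [code, decode, hv]
  | sel v => simp only [Valid] at hv; simp [code, decode, hv]
  | top g t =>
    simp only [Valid] at hv
    rw [code, F.decode_gadget (by simp only [E]; omega), gadgetVert, if_pos hv.2]
  | bot g t =>
    simp only [Valid] at hv
    rw [code, F.decode_gadget (by simp only [E]; omega), gadgetVert, if_neg (by omega),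
      if_pos (by omega), Nat.add_sub_cancel_left]
  | mark g t =>
    simp only [Valid] at hv
    rw [code, F.decode_gadget (by simp only [E]; omega), gadgetVert, if_neg (by omega),
      if_neg (by omega), if_pos (by omega), Nat.add_sub_cancel_left]
  | ext g t =>
    simp only [Valid] at hv
    rw [code, F.decode_gadget (by simp only [E]; omega), gadgetVert, if_neg (by omega),
      if_neg (by omega), if_neg (by omega), Nat.add_sub_cancel_left]

theorem gadget_lt {g w : ℕ} (hg : g < F.κ * P.N) (hw : w < F.E) : F.gadget g w < F.n := by
  have : (g + 1) * F.E ≤ F.κ * P.N * F.E := Nat.mul_le_mul_right _ hg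
  have h2 : (g + 1) * F.E = g * F.E + F.E := by ring
  simp only [gadget, n]
  omega

theorem code_lt {v : Vert} (hv : F.Valid v) : F.code v < F.n := by
  have hm := P.m_pos
  cases v with
  | pad v => simp only [Valid] at hv; simp only [code, n]; omega
  | sel v => simp only [Valid] at hv; simp only [code, n]; omega
  | _ => simp only [Valid] at hv; exact F.gadget_lt hv.1 (by simp only [E]; omega)

theorem code_gadgetVert {g w : ℕ} : F.code (gadgetVert P g w) = F.gadget g w := by
  unfold gadgetVert
  split_ifs <;> simp only [code] <;> congr 1 <;> omega

theorem code_decode (u : ℕ) : F.code (F.decode u) = u := by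
  unfold decode
  split_ifs with h1 h2
  · rfl
  · simp only [code]; omega
  · rw [code_gadgetVert, gadget]
    have := Nat.div_add_mod' (u - (P.d ^ P.h + P.d ^ (P.L + 1))) F.E
    omega

theorem valid_decode {u : ℕ} (hu : u < F.n) : F.Valid (F.decode u) := by
  unfold decode
  split_ifs with h1 h2
  · exact h1
  · simp only [Valid]; omega
  · simp only [n] at hu
    have hg : (u - (P.d ^ P.h + P.d ^ (P.L + 1))) / F.E < F.κ * P.N := by
      rw [Nat.div_lt_iff_lt_mul F.E_pos]; omega
    have hw := Nat.mod_lt (u - (P.d ^ P.h + P.d ^ (P.L + 1))) F.E_pos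
    simp only [E] at hw hg ⊢
    unfold gadgetVert
    split_ifs <;> refine ⟨hg, ?_⟩ <;> omega

theorem div_κ_lt {g : ℕ} (hg : g < F.κ * P.N) : P.d ^ P.L + g / F.κ < P.d ^ (P.L + 1) := by
  rw [P.pow_succ_eq]
  exact Nat.add_lt_add_left (Nat.div_lt_of_lt_mul hg) _

theorem valid_par {v : Vert} (hv : F.Valid v) : F.Valid (F.par v) := by
  have hd := P.two_le_d
  have hm := P.m_pos
  have hq := F.q_le
  cases v with
  | pad v => exact (Nat.div_le_self _ _).trans_lt hv
  | sel v =>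
    simp only [par]
    split_ifs
    · exact Nat.pow_pos P.d_pos
    · exact (Nat.div_le_self _ _).trans_lt hv
  | top g t =>
    simp only [Valid] at hv
    simp only [par]
    split_ifs
    · exact F.div_κ_lt hv.1
    · exact ⟨hv.1, by omega⟩
    · exact ⟨hv.1, by omega⟩
  | bot g s => simp only [Valid] at hv; exact ⟨hv.1, by omega⟩
  | mark g s =>
    simp only [Valid] at hv
    simp only [par]
    split_ifs
    · exact ⟨hv.1, by omega⟩
    · exact ⟨hv.1, by omega⟩
  | ext g e => simp only [Valid] at hv; exact ⟨hv.1, by omega⟩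

/-! ### The height of the trees -/

theorem par_root : F.par (.pad 0) = .pad 0 := by simp [par]

theorem iterate_par_root (k : ℕ) : F.par^[k] (.pad 0) = .pad 0 :=
  Function.iterate_fixed F.par_root k

theorem reach_mono {v : Vert} {j k : ℕ} (h : F.par^[j] v = .pad 0) (hjk : j ≤ k) :
    F.par^[k] v = .pad 0 := by
  obtain ⟨i, rfl⟩ := Nat.exists_eq_add_of_le' hjk
  rw [Function.iterate_add_apply, h, iterate_par_root]

theorem iterate_par_pad (k v : ℕ) : F.par^[k] (.pad v) = .pad (v / P.d ^ k) := by
  induction k generalizing v with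
  | zero => simp
  | succ k ih =>
    rw [Function.iterate_succ_apply, par, ih, Nat.div_div_eq_div_mul, pow_succ, mul_comm]

theorem reach_sel (k v : ℕ) (hv : v < P.d ^ k) : F.par^[k + 1] (.sel v) = .pad 0 := by
  induction k generalizing v with
  | zero => simp at hv; simp [par, hv]
  | succ k ih =>
    rw [Function.iterate_succ_apply, par]
    split_ifs with h0
    · exact F.iterate_par_root _
    · refine ih _ ?_
      rwa [Nat.div_lt_iff_lt_mul P.d_pos, ← pow_succ]

theorem reach_top {g : ℕ} (hg : g < F.κ * P.N) (j s : ℕ) (hs : s < 2 ^ j) (hsm : s < 2 * P.m) :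
    F.par^[P.L + 3 + 2 * j] (.top g s) = .pad 0 := by
  have h0 : F.par^[P.L + 3] (.top g 0) = .pad 0 := by
    rw [Function.iterate_succ_apply, par, if_pos rfl]
    exact F.reach_sel _ _ (F.div_κ_lt hg)
  induction j generalizing s with
  | zero => simp at hs; simpa [hs] using h0
  | succ j ih =>
    rcases eq_or_ne s 0 with rfl | hs0
    · exact F.reach_mono h0 (by omega)
    · rw [show P.L + 3 + 2 * (j + 1) = P.L + 3 + 2 * j + 1 + 1 by ring,
        Function.iterate_succ_apply, par, if_neg hs0, if_neg (by omega),
        Function.iterate_succ_apply, par]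
      exact ih _ (by rw [pow_succ] at hs; omega) (by omega)

theorem reach_of_ne_pad {v : Vert} (hv : F.Valid v) (hp : ∀ w, v ≠ .pad w) :
    F.par^[P.h - 1] v = .pad 0 := by
  have hq := F.q_le
  have hr := P.le_two_pow
  have htop : ∀ g s, g < F.κ * P.N → s < 2 * P.m →
      F.par^[P.L + 3 + 2 * P.r] (.top g s) = .pad 0 := fun g s hg hs =>
    F.reach_top hg _ s (by omega) hs
  have hbot : ∀ g s, g < F.κ * P.N → s < 2 * P.m →
      F.par^[P.L + 3 + 2 * P.r + 1] (.bot g s) = .pad 0 := fun g s hg hs => by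
    rw [Function.iterate_succ_apply]; exact htop g s hg hs
  have heven : ∀ g t, g < F.κ * P.N → t < 4 * P.m → t % 2 = 0 →
      F.par^[P.L + 3 + 2 * P.r + 2] (.top g t) = .pad 0 := fun g t hg ht ht2 => by
    rw [Function.iterate_succ_apply, par]
    split_ifs with h0 h1
    · exact F.reach_mono (F.reach_sel _ _ (F.div_κ_lt hg)) (by omega)
    · omega
    · exact hbot g _ hg (by omega)
  have hmark : ∀ g s, g < F.κ * P.N → s < 2 * P.m → s % 2 = 0 →
      F.par^[P.L + 3 + 2 * P.r + 1] (.mark g s) = .pad 0 := fun g s hg hs hs2 => by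
    rw [Function.iterate_succ_apply, par, if_pos hs2]; exact htop g s hg hs
  have hle : P.L + 3 + 2 * P.r + 4 ≤ P.h - 1 := by simp only [h]; omega
  refine F.reach_mono (j := P.L + 3 + 2 * P.r + 3) ?_ (by omega)
  cases v with
  | pad v => exact absurd rfl (hp v)
  | sel v => exact F.reach_mono (F.reach_sel _ _ hv) (by omega)
  | top g t =>
    simp only [Valid] at hv
    rw [Function.iterate_succ_apply, par]
    split_ifs with h0 h1
    · exact F.reach_mono (F.reach_sel _ _ (F.div_κ_lt hv.1)) (by omega)
    · exact heven g _ hv.1 (by omega) (by omega)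
    · exact F.reach_mono (hbot g _ hv.1 (by omega)) (by omega)
  | bot g s => exact F.reach_mono (hbot g s hv.1 hv.2) (by omega)
  | mark g s =>
    simp only [Valid] at hv
    rw [Function.iterate_succ_apply, par]
    split_ifs with h0
    · exact F.reach_mono (htop g s hv.1 hv.2) (by omega)
    · exact F.reach_mono (hmark g (s - 1) hv.1 (by omega) (by omega)) (by omega)
  | ext g e =>
    simp only [Valid] at hv
    rw [Function.iterate_succ_apply, par]
    exact heven g _ hv.1 (by omega) (by omega)

theorem reach {v : Vert} (hv : F.Valid v) : F.par^[P.h] v = .pad 0 := by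
  by_cases hp : ∃ w, v = .pad w
  · obtain ⟨w, rfl⟩ := hp
    rw [iterate_par_pad, Nat.div_eq_of_lt hv]
  · exact F.reach_mono (F.reach_of_ne_pad hv fun w hw => hp ⟨w, hw⟩) (Nat.sub_le _ _)

/-! ### The trees as rooted trees with numbered vertices -/

theorem n_pos : 0 < F.n := by
  have : 0 < P.d ^ P.h := Nat.pow_pos P.d_pos
  simp only [n]; omega

/-- The number of the parent. -/
def parNum (u : ℕ) : ℕ := F.code (F.par (F.decode u))

theorem parNum_lt {u : ℕ} (hu : u < F.n) : F.parNum u < F.n :=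
  F.code_lt (F.valid_par (F.valid_decode hu))

theorem decode_parNum {u : ℕ} (hu : u < F.n) : F.decode (F.parNum u) = F.par (F.decode u) :=
  F.decode_code (F.valid_par (F.valid_decode hu))

theorem decode_zero : F.decode 0 = .pad 0 := by
  rw [decode, if_pos (Nat.pow_pos P.d_pos)]

theorem decode_iterate (k : ℕ) (v : Fin F.n) :
    F.decode ((fun v : Fin F.n => (⟨F.parNum v, F.parNum_lt v.2⟩ : Fin F.n))^[k] v) =
      F.par^[k] (F.decode v) := by
  induction k with
  | zero => rfl
  | succ k ih =>
    rw [Function.iterate_succ_apply', Function.iterate_succ_apply', ← ih]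
    exact F.decode_parNum (Fin.is_lt _)

theorem iterate_eq_root (v : Fin F.n) :
    (fun v : Fin F.n => (⟨F.parNum v, F.parNum_lt v.2⟩ : Fin F.n))^[P.h] v = ⟨0, F.n_pos⟩ := by
  have h := congrArg F.code (F.decode_iterate P.h v)
  rw [F.code_decode, F.reach (F.valid_decode v.2)] at h
  exact Fin.ext h

/-- The tree with the given shape and filling. -/
def tree : RTree F.n where
  root := ⟨0, F.n_pos⟩
  parent v := ⟨F.parNum v, F.parNum_lt v.2⟩
  parent_root := Fin.ext (by simp [parNum, decode_zero, par_root, code])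
  reaches_root v := ⟨P.h, F.iterate_eq_root v⟩

theorem height_tree : F.tree.height ≤ P.h := RTree.height_le F.iterate_eq_root

theorem pow_h_le_n : P.d ^ P.h ≤ F.n := by simp only [n]; omega

/-! ### The children of a vertex -/

theorem child_pad {u : Vert} {w : ℕ} (h : F.par u = .pad w) :
    (∃ v, u = .pad v ∧ v / P.d = w) ∨ u = .sel 0 ∧ w = 0 := by
  cases u <;> simp only [par] at h <;> (try split_ifs at h) <;> simp_all

theorem child_sel {u : Vert} {w : ℕ} (h : F.par u = .sel w) :
    (∃ v, v ≠ 0 ∧ u = .sel v ∧ v / P.d = w) ∨ ∃ g, u = .top g 0 ∧ P.d ^ P.L + g / F.κ = w := by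
  cases u with
  | sel v =>
    simp only [par] at h
    split_ifs at h with h0
    exact .inl ⟨v, h0, rfl, by simpa using h⟩
  | _ => simp only [par] at h; (try split_ifs at h) <;> simp_all

theorem child_top {u : Vert} {g t : ℕ} (h : F.par u = .top g t) :
    u = .bot g t ∨ t % 2 = 0 ∧ u = .mark g t ∨ t % 2 = 0 ∧ 2 * P.m ≤ t ∧ u = .top g (t + 1) ∨
      ∃ e, t = 2 * P.m + 2 * e ∧ u = .ext g e := by
  have hm := P.m_pos
  cases u with
  | top g' t' =>
    simp only [par] at h
    split_ifs at h with h1 h2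
    simp only [Vert.top.injEq] at h
    obtain ⟨rfl, rfl⟩ := h
    refine .inr (.inr (.inl ⟨by omega, by omega, ?_⟩))
    congr 1; omega
  | ext g' e => simp_all [par]
  | mark g' s => simp only [par] at h; split_ifs at h; simp_all
  | bot g' s => simp_all [par]
  | pad v => simp [par] at h
  | sel v => simp only [par] at h; split_ifs at h

theorem child_bot {u : Vert} {g s : ℕ} (h : F.par u = .bot g s) :
    ∃ t, t ≠ 0 ∧ u = .top g t ∧ t / 2 = s ∧
      (2 * P.m ≤ t → t % 2 = 1 → F.bit g (s - P.m) = true) := by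
  cases u with
  | top g' t' =>
    simp only [par] at h
    split_ifs at h with h1 h2
    simp only [Vert.bot.injEq] at h
    obtain ⟨rfl, rfl⟩ := h
    refine ⟨t', h1, rfl, rfl, fun h3 h4 => ?_⟩
    simpa [h3, h4] using h2
  | _ => simp only [par] at h; (try split_ifs at h) <;> simp_all

theorem child_mark {u : Vert} {g s : ℕ} (h : F.par u = .mark g s) :
    s % 2 = 0 ∧ u = .mark g (s + 1) := by
  cases u with
  | mark g' s' =>
    simp only [par] at h
    split_ifs at h with h1
    simp only [Vert.mark.injEq] at h
    obtain ⟨rfl, rfl⟩ := h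
    exact ⟨by omega, by congr 1; omega⟩
  | _ => simp only [par] at h; (try split_ifs at h) <;> simp_all

theorem no_child_ext {g e : ℕ} (u : Vert) : F.par u ≠ .ext g e := by
  cases u <;> simp only [par] <;> (try split_ifs) <;> simp

/-! ### The degree of the trees -/

/-- Labels that distinguish siblings. -/
def label : Vert → ℕ
  | .pad v => v % P.d
  | .sel v => v % P.d
  | .top g t => if t = 0 then g % F.κ else t % 2
  | .mark _ _ => 1
  | _ => 0

theorem label_lt (v : Vert) : F.label v < P.d := by
  have hd := P.two_le_d
  have hκ := F.κ_le
  have hκ' := F.κ_pos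
  cases v with
  | pad v => exact Nat.mod_lt _ P.d_pos
  | sel v => exact Nat.mod_lt _ P.d_pos
  | top g t =>
    simp only [label]
    split_ifs
    · have := Nat.mod_lt g hκ'; omega
    · omega
  | _ => simp only [label]; omega

theorem eq_of_div_mod {a b k : ℕ} (h1 : a / k = b / k) (h2 : a % k = b % k) : a = b := by
  rw [← Nat.div_add_mod a k, ← Nat.div_add_mod b k, h1, h2]

theorem label_injective {u v : Vert} (hu : F.Valid u) (hv : F.Valid v) (hu0 : u ≠ .pad 0)
    (hv0 : v ≠ .pad 0) (hp : F.par u = F.par v) (hl : F.label u = F.label v) : u = v := by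
  have key : ∀ w, w ≠ 0 → w / P.d = 0 → w % P.d ≠ 0 := fun w h0 h1 h2 =>
    h0 (eq_of_div_mod (k := P.d) (by simpa using h1) (by simpa using h2))
  have hsel : ∀ w g, w < P.d ^ (P.L + 1) → w / P.d ≠ P.d ^ P.L + g := by
    intro w g hw h
    have : w / P.d < P.d ^ P.L := by rwa [Nat.div_lt_iff_lt_mul P.d_pos, ← pow_succ]
    omega
  generalize hw : F.par v = w at hp
  cases w with
  | pad w =>
    rcases F.child_pad hp with ⟨a, rfl, ha⟩ | ⟨rfl, ha⟩ <;>
      rcases F.child_pad hw with ⟨b, rfl, hb⟩ | ⟨rfl, hb⟩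
    · rw [eq_of_div_mod (ha.trans hb.symm) hl]
    · exact absurd (by simpa [label] using hl)
        (key a (fun h => hu0 (by rw [h])) (ha.trans hb))
    · exact absurd (by simpa [label] using hl.symm)
        (key b (fun h => hv0 (by rw [h])) (hb.trans ha))
    · rfl
  | sel w =>
    rcases F.child_sel hp with ⟨a, -, rfl, ha⟩ | ⟨a, rfl, ha⟩ <;>
      rcases F.child_sel hw with ⟨b, -, rfl, hb⟩ | ⟨b, rfl, hb⟩
    · rw [eq_of_div_mod (ha.trans hb.symm) hl]
    · exact absurd (ha.trans hb.symm) (hsel _ _ hu)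
    · exact absurd (hb.trans ha.symm) (hsel _ _ hv)
    · simp only [label, if_true] at hl
      rw [eq_of_div_mod (k := F.κ) (by omega) hl]
  | top g t =>
    have hm := P.m_pos
    rcases F.child_top hp with rfl | ⟨h1, rfl⟩ | ⟨h1, h2, rfl⟩ | ⟨e, h1, rfl⟩ <;>
      rcases F.child_top hw with rfl | ⟨h3, rfl⟩ | ⟨h3, h4, rfl⟩ | ⟨e', h3, rfl⟩ <;>
      simp only [Valid, label, Nat.add_eq_zero_iff, one_ne_zero, and_false, if_false] at hu hv hl <;>
      first
      | rfl
      | omega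
      | (obtain rfl : e = e' := by omega
         rfl)
  | bot g s =>
    obtain ⟨a, ha0, rfl, ha, -⟩ := F.child_bot hp
    obtain ⟨b, hb0, rfl, hb, -⟩ := F.child_bot hw
    simp only [label, ha0, hb0, if_false] at hl
    rw [eq_of_div_mod (ha.trans hb.symm) hl]
  | mark g s => rw [(F.child_mark hp).2, (F.child_mark hw).2]
  | ext g e => exact absurd hw (F.no_child_ext _)

theorem degreeLE_tree : F.tree.DegreeLE P.d := by
  have hne : ∀ v : Fin F.n, v ≠ F.tree.root → F.decode v ≠ .pad 0 := fun v hv h =>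
    hv (Fin.ext ((F.code_decode v).symm.trans (by rw [h]; rfl)))
  refine RTree.degreeLE_of_label (fun v => F.label (F.decode v)) (fun v => F.label_lt _)
    fun u v hu hv hp hl => ?_
  have hp' := congrArg (fun v : Fin F.n => F.decode v) hp
  simp only [tree, F.decode_parNum (Fin.is_lt _)] at hp'
  have := congrArg F.code
    (F.label_injective (F.valid_decode u.2) (F.valid_decode v.2) (hne u hu) (hne v hv) hp' hl)
  rw [F.code_decode, F.code_decode] at this
  exact Fin.ext this

end Shape.Filling

namespace Shape

variable {P : Shape}

/-- The filling of the first tree: one gadget below each leaf of the selector, with the bits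
`x g`. -/
def source (P : Shape) (x : ℕ → ℕ → Bool) : P.Filling where
  κ := 1
  q := 0
  bit := x
  κ_pos := one_pos
  κ_le := one_le_two
  q_le := Nat.zero_le _

/-- The filling of the second tree: below each leaf of the selector one gadget with the bits `z g`
and one in which all bits but the bit `0` are set. -/
def target (P : Shape) (z : ℕ → ℕ → Bool) : P.Filling where
  κ := 2
  q := P.m
  bit g c := if g % 2 = 0 then z (g / 2) c else decide (c ≠ 0)
  κ_pos := two_pos
  κ_le := le_rfl
  q_le := le_rfl

variable {x z : ℕ → ℕ → Bool}

/-! ### A large common subtree from a pair of compatible gadgets -/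

theorem heap_level {d : ℕ} {π : ℕ → ℕ} (hinj : Function.Injective π) (h0 : π 0 = 0)
    (hdiv : ∀ v, π (v / d) = π v / d) (hd : 0 < d) (i v : ℕ) : π v < d ^ i ↔ v < d ^ i := by
  have h : π (v / d ^ i) = π v / d ^ i := by
    induction i generalizing v with
    | zero => simp
    | succ i ih =>
      rw [pow_succ', ← Nat.div_div_eq_div_mul, ← Nat.div_div_eq_div_mul, ih, hdiv]
  have hp : 0 < d ^ i := Nat.pow_pos hd
  rw [← Nat.div_eq_zero_iff_lt hp, ← Nat.div_eq_zero_iff_lt hp, ← h]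
  exact ⟨fun h => hinj (h.trans h0.symm), fun h => h ▸ h0⟩

/-- The gadget of the second tree to which the gadget `g` of the first tree is mapped, for an
automorphism `π` of the selector: the gadget `g₀` is mapped to a gadget with bits of `z`. -/
def gadgetMap (P : Shape) (π : ℕ → ℕ) (g₀ g : ℕ) : ℕ :=
  2 * (π (P.d ^ P.L + g) - P.d ^ P.L) + if g = g₀ then 0 else 1

/-- The map from the first to the second tree given by an automorphism `π` of the selector. -/
def vertMap (P : Shape) (x : ℕ → ℕ → Bool) (π : ℕ → ℕ) (g₀ : ℕ) : Vert → Vert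
  | .sel v => .sel (π v)
  | .top g t =>
    if 2 * P.m ≤ t ∧ t % 2 = 1 ∧ x g (t / 2 - P.m) = false then
      .ext (P.gadgetMap π g₀ g) (t / 2 - P.m)
    else .top (P.gadgetMap π g₀ g) t
  | .bot g s => .bot (P.gadgetMap π g₀ g) s
  | .mark g s => .mark (P.gadgetMap π g₀ g) s
  | v => v

section vertMap

variable {π : ℕ → ℕ} {g₀ g₁ : ℕ}

theorem leaf_le (hinj : Function.Injective π) (h0 : π 0 = 0)
    (hdiv : ∀ v, π (v / P.d) = π v / P.d) (g : ℕ) : P.d ^ P.L ≤ π (P.d ^ P.L + g) := by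
  have := heap_level hinj h0 hdiv P.d_pos P.L (P.d ^ P.L + g)
  omega

theorem gadgetMap_lt (hinj : Function.Injective π) (h0 : π 0 = 0)
    (hdiv : ∀ v, π (v / P.d) = π v / P.d) {g : ℕ} (hg : g < P.N) :
    P.gadgetMap π g₀ g < 2 * P.N := by
  have h1 := (heap_level hinj h0 hdiv P.d_pos (P.L + 1) (P.d ^ P.L + g)).2
    (by rw [P.pow_succ_eq]; omega)
  have h2 := leaf_le hinj h0 hdiv g
  rw [P.pow_succ_eq] at h1
  simp only [gadgetMap]
  split_ifs <;> omega

theorem gadgetMap_injective (hinj : Function.Injective π) (h0 : π 0 = 0)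
    (hdiv : ∀ v, π (v / P.d) = π v / P.d) : Function.Injective (P.gadgetMap π g₀) := by
  intro a b hab
  have ha := leaf_le hinj h0 hdiv a
  have hb := leaf_le hinj h0 hdiv b
  have : π (P.d ^ P.L + a) = π (P.d ^ P.L + b) := by
    simp only [gadgetMap] at hab
    split_ifs at hab <;> omega
  have := hinj this
  omega

theorem valid_vertMap (hinj : Function.Injective π) (h0 : π 0 = 0)
    (hdiv : ∀ v, π (v / P.d) = π v / P.d) {u : Vert} (hu : (P.source x).Valid u) :
    (P.target z).Valid (P.vertMap x π g₀ u) := by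
  have hg : ∀ {g}, g < (P.source x).κ * P.N → P.gadgetMap π g₀ g < (P.target z).κ * P.N :=
    fun h => gadgetMap_lt hinj h0 hdiv (by simpa [source] using h)
  cases u with
  | pad v => exact hu
  | sel v => exact (heap_level hinj h0 hdiv P.d_pos _ _).2 hu
  | top g t =>
    simp only [Filling.Valid] at hu
    simp only [vertMap]
    split_ifs with h
    · exact ⟨hg hu.1, show t / 2 - P.m < P.m by omega⟩
    · exact ⟨hg hu.1, hu.2⟩
  | bot g s => exact ⟨hg hu.1, hu.2⟩
  | mark g s => exact ⟨hg hu.1, hu.2⟩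
  | ext g e => exact absurd hu.2 (Nat.not_lt_zero e)

theorem vertMap_injective (hinj : Function.Injective π) (h0 : π 0 = 0)
    (hdiv : ∀ v, π (v / P.d) = π v / P.d) {u v : Vert} (hu : (P.source x).Valid u)
    (hv : (P.source x).Valid v) (h : P.vertMap x π g₀ u = P.vertMap x π g₀ v) : u = v := by
  have hg : ∀ {a b}, P.gadgetMap π g₀ a = P.gadgetMap π g₀ b ↔ a = b :=
    (gadgetMap_injective hinj h0 hdiv).eq_iff
  cases u with
  | ext g e => exact absurd hu.2 (Nat.not_lt_zero e)
  | top g t =>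
    cases v with
    | ext g e => exact absurd hv.2 (Nat.not_lt_zero e)
    | top g' t' =>
      simp only [vertMap] at h
      split_ifs at h <;> simp only [Vert.ext.injEq, Vert.top.injEq, hg] at h ⊢ <;> omega
    | _ => simp only [vertMap] at h; split_ifs at h
  | _ =>
    cases v with
    | ext g e => exact absurd hv.2 (Nat.not_lt_zero e)
    | top g' t' => simp only [vertMap] at h; split_ifs at h
    | _ => simp_all [vertMap, hinj.eq_iff]

theorem vertMap_par (hinj : Function.Injective π) (h0 : π 0 = 0)
    (hdiv : ∀ v, π (v / P.d) = π v / P.d) (hπ : π (P.d ^ P.L + g₀) = P.d ^ P.L + g₁)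
    (hxz : ∀ c < P.m, x g₀ c = true → z g₁ c = true) {u : Vert} (hu : (P.source x).Valid u)
    (hkeep : ∀ g, g ≠ g₀ → u ≠ .top g (2 * P.m + 1)) :
    P.vertMap x π g₀ ((P.source x).par u) = (P.target z).par (P.vertMap x π g₀ u) := by
  have hm := P.m_pos
  cases u with
  | ext g e => exact absurd hu.2 (Nat.not_lt_zero e)
  | pad v => rfl
  | sel v =>
    have hv : π v = 0 ↔ v = 0 := ⟨fun h => hinj (h.trans h0.symm), fun h => h ▸ h0⟩
    by_cases h : v = 0
    · simp [vertMap, Filling.par, h, h0]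
    · simp [vertMap, Filling.par, h, hv, hdiv]
  | bot g s =>
    simp only [Filling.Valid] at hu
    have : ¬ (2 * P.m ≤ s ∧ s % 2 = 1 ∧ x g (s / 2 - P.m) = false) := by omega
    simp [vertMap, Filling.par, this]
  | mark g s =>
    simp only [Filling.Valid] at hu
    have : ¬ (2 * P.m ≤ s ∧ s % 2 = 1 ∧ x g (s / 2 - P.m) = false) := by omega
    by_cases h : s % 2 = 0 <;> simp [vertMap, Filling.par, h, hu.2.not_ge]
  | top g t =>
    simp only [Filling.Valid] at hu
    by_cases ht0 : t = 0
    · subst ht0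
      have h1 := leaf_le hinj h0 hdiv g
      have h2 : (P.gadgetMap π g₀ g) / 2 = π (P.d ^ P.L + g) - P.d ^ P.L := by
        simp only [gadgetMap]; split_ifs <;> omega
      have h3 : ¬ (2 * P.m ≤ 0) := by omega
      simp only [Filling.par, vertMap, source, target, h3, false_and, if_false, if_true, h2,
        Nat.div_one]
      congr 1; omega
    by_cases hx : 2 * P.m ≤ t ∧ t % 2 = 1 ∧ x g (t / 2 - P.m) = false
    · have h1 : ¬ ((t - 1) % 2 = 1) := by omega
      have h2 : t - 1 = 2 * P.m + 2 * (t / 2 - P.m) := by omega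
      have h3 : (P.source x).par (.top g t) = .top g (t - 1) := by
        rw [Filling.par, if_neg ht0]
        exact if_pos hx
      rw [h3]
      simp only [vertMap, if_pos hx, h1, false_and, and_false, if_false, Filling.par]
      rw [h2]
    · have hy : ¬ (2 * P.m ≤ t ∧ t % 2 = 1 ∧
          (P.target z).bit (P.gadgetMap π g₀ g) (t / 2 - P.m) = false) := by
        rintro ⟨h1, h2, h3⟩
        have h4 : x g (t / 2 - P.m) = true := by
          simpa [h1, h2] using hx
        by_cases hg : g = g₀
        · subst hg
          have h5 : P.gadgetMap π g g = 2 * g₁ := by simp [gadgetMap, hπ]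
          have h6 := hxz _ (by omega) h4
          simp [target, h5, h6] at h3
        · have h5 : P.gadgetMap π g₀ g % 2 = 1 := by
            simp only [gadgetMap, hg, if_false]; omega
          have h6 : t ≠ 2 * P.m + 1 := fun h => hkeep g hg (by rw [h])
          have h7 : t / 2 - P.m ≠ 0 := by omega
          simp [target, h5] at h3
          omega
      have hx' : ¬ (2 * P.m ≤ t ∧ t % 2 = 1 ∧ (P.source x).bit g (t / 2 - P.m) = false) := hx
      simp only [Filling.par, vertMap, ht0, if_false, if_neg hx, if_neg hx', if_neg hy]

end vertMap

/-- If the bits of some gadget of the first tree are also set in a gadget of the second tree, then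
all but `N - 1` of the vertices of the first tree are in a common subtree. -/
theorem le_lcst_of_compatible {g₀ g₁ : ℕ} (hg₀ : g₀ < P.N) (hg₁ : g₁ < P.N)
    (hxz : ∀ c < P.m, x g₀ c = true → z g₁ c = true) :
    (P.source x).n + 1 ≤ (P.source x).tree.lcst (P.target z).tree + P.N := by
  have hm := P.m_pos
  obtain ⟨π, hinj, h0, hdiv, hπ⟩ := exists_heap_automorphism P.two_le_d (P.d ^ P.L + g₀)
    (P.d ^ P.L + g₁) fun i => by
      have h1 := P.pow_succ_eq
      rcases le_or_gt i P.L with h | h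
      · have := Nat.pow_le_pow_right P.d_pos h
        omega
      · have := Nat.pow_le_pow_right P.d_pos (show P.L + 1 ≤ i from h)
        omega
  set F := P.source x
  set G := P.target z
  classical
  let W : Finset (Fin F.n) :=
    Finset.univ.filter fun v => ∀ g, g ≠ g₀ → F.decode v ≠ .top g (2 * P.m + 1)
  let φ : Fin F.n → Fin G.n := fun v => ⟨G.code (P.vertMap x π g₀ (F.decode v)),
    G.code_lt (valid_vertMap hinj h0 hdiv (F.valid_decode v.2))⟩
  have hdec : ∀ v : Fin F.n, G.decode (φ v) = P.vertMap x π g₀ (F.decode v) := fun v =>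
    G.decode_code (valid_vertMap hinj h0 hdiv (F.valid_decode v.2))
  have hpardec : ∀ v : Fin F.n, F.decode (F.tree.parent v) = F.par (F.decode v) :=
    fun v => F.decode_parNum v.2
  have hW : W.card ≤ F.tree.lcst G.tree := by
    refine RTree.card_le_lcst W ?_ ?_ φ ?_ ?_ ?_
    · simp only [W, Finset.mem_filter, Finset.mem_univ, true_and]
      intro g _
      simp [Filling.tree, F.decode_zero]
    · intro v hv
      simp only [W, Finset.mem_filter, Finset.mem_univ, true_and, hpardec] at hv ⊢
      intro g hg h
      rcases F.child_top h with h1 | ⟨h1, -⟩ | ⟨h1, -⟩ | ⟨e, h1, -⟩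
      · have := F.valid_decode v.2
        rw [h1] at this
        have := this.2
        omega
      all_goals omega
    · intro u _ v _ huv
      have := congrArg (fun v : Fin G.n => G.decode v) huv
      simp only [hdec] at this
      have := congrArg F.code
        (vertMap_injective hinj h0 hdiv (F.valid_decode u.2) (F.valid_decode v.2) this)
      rw [F.code_decode, F.code_decode] at this
      exact Fin.ext this
    · refine Fin.ext ?_
      simp [φ, Filling.tree, F.decode_zero, vertMap, Filling.code]
    · intro v hv
      simp only [W, Finset.mem_filter, Finset.mem_univ, true_and] at hv
      refine Fin.ext ?_
      simp only [φ, hpardec]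
      rw [vertMap_par hinj h0 hdiv hπ hxz (F.valid_decode v.2) hv]
      simp only [Filling.tree, Filling.parNum]
      congr 2
      exact (hdec v).symm
  have hcard : Wᶜ.card ≤ ((Finset.range P.N).erase g₀).card := by
    have hex : ∀ v ∈ Wᶜ, ∃ g, g ≠ g₀ ∧ F.decode v = .top g (2 * P.m + 1) := by
      intro v hv
      simpa [W] using hv
    choose! f hf using hex
    refine Finset.card_le_card_of_injOn f (fun v hv => ?_) fun u hu v hv huv => ?_
    · have h1 := hf v hv
      have h2 := F.valid_decode v.2
      rw [h1.2] at h2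
      have h3 : f v < P.N := by simpa [F, source] using h2.1
      simp [h1.1, h3]
    · have h1 := (hf u hu).2
      rw [huv, ← (hf v hv).2] at h1
      have := congrArg F.code h1
      rw [F.code_decode, F.code_decode] at this
      exact Fin.ext this
  rw [Finset.card_erase_of_mem (Finset.mem_range.2 hg₀), Finset.card_range] at hcard
  have h1 := W.card_add_card_compl
  rw [Fintype.card_fin] at h1
  omega

/-! ### A pair of compatible gadgets from a large common subtree -/

/-- A common subtree, seen as a map `Φ` that is defined on the vertices with the property `D`. -/
structure IsCommon (F G : P.Filling) (D : Vert → Prop) (Φ : Vert → Vert) : Prop where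
  valid : ∀ u, D u → F.Valid u
  par : ∀ u, D u → D (F.par u)
  map_valid : ∀ u, D u → G.Valid (Φ u)
  map_root : Φ (.pad 0) = .pad 0
  map_par : ∀ u, D u → G.par (Φ u) = Φ (F.par u)
  inj : ∀ u v, D u → D v → Φ u = Φ v → u = v

theorem exists_isCommon (F G : P.Filling) : ∃ (D : Vert → Prop) (Φ : Vert → Vert),
    IsCommon F G D Φ ∧ ∀ (I : Finset ℕ) (f : ℕ → Vert), (∀ i ∈ I, F.Valid (f i)) →
      (∀ i ∈ I, ¬ D (f i)) → Set.InjOn f I → I.card + F.tree.lcst G.tree ≤ F.n := by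
  obtain ⟨W, φ, -, hpar, hinj, hφ, hφp, hcard⟩ := RTree.exists_card_eq_lcst F.tree G.tree
  have hdec : ∀ v : Fin F.n, F.decode (F.tree.parent v) = F.par (F.decode v) :=
    fun v => F.decode_parNum v.2
  have hdec' : ∀ v : Fin G.n, G.decode (G.tree.parent v) = G.par (G.decode v) :=
    fun v => G.decode_parNum v.2
  let Φ : Vert → Vert := fun u => if h : F.code u < F.n then G.decode (φ ⟨F.code u, h⟩) else u
  have hΦ : ∀ v : Fin F.n, Φ (F.decode v) = G.decode (φ v) := fun v => by
    simp only [Φ, F.code_decode, Fin.is_lt, dif_pos]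
  refine ⟨fun u => ∃ v ∈ W, F.decode v = u, Φ, ⟨?_, ?_, ?_, ?_, ?_, ?_⟩, ?_⟩
  · rintro _ ⟨v, -, rfl⟩
    exact F.valid_decode v.2
  · rintro _ ⟨v, hv, rfl⟩
    exact ⟨_, hpar v hv, hdec v⟩
  · rintro _ ⟨v, -, rfl⟩
    rw [hΦ]
    exact G.valid_decode (Fin.is_lt _)
  · have h := hΦ F.tree.root
    rw [hφ] at h
    simpa [Filling.tree, Filling.decode_zero] using h
  · rintro _ ⟨v, hv, rfl⟩
    rw [hΦ, ← hdec', ← hφp v hv, ← hΦ, hdec]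
  · rintro _ _ ⟨u, hu, rfl⟩ ⟨v, hv, rfl⟩ huv
    rw [hΦ, hΦ] at huv
    have := congrArg G.code huv
    rw [G.code_decode, G.code_decode] at this
    rw [hinj hu hv (Fin.ext this)]
  · intro I f hf hD hfi
    have h1 : I.card ≤ Wᶜ.card := by
      have hlt : ∀ i ∈ I, F.code (f i) < F.n := fun i hi => F.code_lt (hf i hi)
      let k : ℕ → Fin F.n := fun i => if h : F.code (f i) < F.n then ⟨F.code (f i), h⟩
        else ⟨0, F.n_pos⟩
      have hk : ∀ i ∈ I, F.decode (k i) = f i := fun i hi => by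
        simp only [k, hlt i hi, dif_pos]
        exact F.decode_code (hf i hi)
      refine Finset.card_le_card_of_injOn k (fun i hi => ?_) fun i hi j hj hij => ?_
      · rw [Finset.mem_coe, Finset.mem_compl]
        exact fun h => hD i hi ⟨_, h, hk i hi⟩
      · exact hfi hi hj (by rw [← hk i hi, ← hk j hj, hij])
    have h2 := W.card_add_card_compl
    rw [Fintype.card_fin] at h2
    omega

/-- The gadget to which a vertex belongs. -/
def _root_.Vert.gadget : Vert → ℕ
  | .top g _ => g
  | .bot g _ => g
  | .mark g _ => g
  | .ext g _ => g
  | _ => 0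

namespace IsCommon

variable {F G : P.Filling} {D : Vert → Prop} {Φ : Vert → Vert}

/-- The selector is mapped to the selector and not to the padding, provided that below each vertex
`1, …, d - 1` of the padding some vertex of the last level is kept: there is nothing on this level
outside the padding, so that these vertices use up all of the padding. -/
theorem map_sel_zero (hC : IsCommon F G D Φ)
    (hpad : ∀ q, 0 < q → q < P.d → ∃ v, v / P.d ^ (P.h - 1) = q ∧ D (.pad v))
    (hsel : D (.sel 0)) : Φ (.sel 0) = .sel 0 := by
  have hroot : D (.pad 0) := by simpa [Filling.par] using hC.par _ hsel
  have hDit : ∀ k u, D u → D (F.par^[k] u) ∧ G.par^[k] (Φ u) = Φ (F.par^[k] u) := by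
    intro k
    induction k with
    | zero => exact fun u hu => ⟨hu, rfl⟩
    | succ k ih =>
      intro u hu
      rw [Function.iterate_succ_apply, Function.iterate_succ_apply, hC.map_par u hu]
      exact ih _ (hC.par u hu)
  have hq : ∀ q, 0 < q → q < P.d → ∃ r, 0 < r ∧ r < P.d ∧ D (.pad q) ∧ Φ (.pad q) = .pad r := by
    intro q hq0 hqd
    obtain ⟨v, hv, hDv⟩ := hpad q hq0 hqd
    have hDq := (hDit (P.h - 1) _ hDv)
    rw [F.iterate_par_pad, hv] at hDq
    have h1 : G.par (Φ (.pad q)) = .pad 0 := by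
      rw [hC.map_par _ hDq.1, Filling.par, Nat.div_eq_of_lt hqd, hC.map_root]
    rcases G.child_pad h1 with ⟨r, hr, hr0⟩ | ⟨hs, -⟩
    · refine ⟨r, Nat.pos_of_ne_zero fun h => ?_, ?_, hDq.1, hr⟩
      · subst h
        have := hC.inj _ _ hDq.1 hroot (hr.trans hC.map_root.symm)
        simp only [Vert.pad.injEq] at this
        omega
      · have := Nat.div_eq_zero_iff.1 hr0
        have := P.d_pos
        omega
    · exfalso
      by_cases hp : ∃ w, Φ (.pad v) = .pad w
      · obtain ⟨w, hw⟩ := hp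
        rw [hw, G.iterate_par_pad, hs] at hDq
        exact absurd hDq.2 (by simp)
      · have h2 := G.reach_of_ne_pad (hC.map_valid _ hDv) fun w hw => hp ⟨w, hw⟩
        rw [hDq.2, hs] at h2
        exact absurd h2 (by simp)
  have h1 : G.par (Φ (.sel 0)) = .pad 0 := by
    rw [hC.map_par _ hsel, Filling.par, if_pos rfl, hC.map_root]
  rcases G.child_pad h1 with ⟨v, hv, hv0⟩ | ⟨hs, -⟩
  · exfalso
    have hvd : v < P.d := by
      have := Nat.div_eq_zero_iff.1 hv0
      have := P.d_pos
      omega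
    have hv1 : v ≠ 0 := by
      rintro rfl
      exact absurd (hC.inj _ _ hsel hroot (hv.trans hC.map_root.symm)) (by simp)
    choose! ρ hρ using hq
    have hsurj : Set.SurjOn ρ (Finset.Ico 1 P.d) (Finset.Ico 1 P.d) := by
      refine Finset.surjOn_of_injOn_of_card_le ρ (fun q hq => ?_) (fun a ha b hb hab => ?_) le_rfl
      · have hq' := Finset.mem_Ico.1 hq
        have := hρ q hq'.1 hq'.2
        exact Finset.mem_coe.2 (Finset.mem_Ico.2 ⟨this.1, this.2.1⟩)
      · have ha' := Finset.mem_Ico.1 ha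
        have hb' := Finset.mem_Ico.1 hb
        have h2 := hρ a ha'.1 ha'.2
        have h3 := hρ b hb'.1 hb'.2
        have := hC.inj _ _ h2.2.2.1 h3.2.2.1 (by rw [h2.2.2.2, h3.2.2.2, hab])
        simpa using this
    obtain ⟨q, hq, hqv⟩ := hsurj (Finset.mem_coe.2 (Finset.mem_Ico.2
      ⟨Nat.pos_of_ne_zero hv1, hvd⟩))
    have hq' := Finset.mem_Ico.1 hq
    have h2 := hρ q hq'.1 hq'.2
    exact absurd (hC.inj _ _ h2.2.2.1 hsel (by rw [h2.2.2.2, hqv, hv])) (by simp)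
  · exact hs

theorem map_sel (hC : IsCommon F G D Φ) (h0 : Φ (.sel 0) = .sel 0) (v : ℕ) :
    D (.sel v) → ∃ w, Φ (.sel v) = .sel w ∧ ∀ i, v < P.d ^ i ↔ w < P.d ^ i := by
  induction v using Nat.strong_induction_on with
  | _ v ih =>
    intro hv
    rcases eq_or_ne v 0 with rfl | hv0
    · exact ⟨0, h0, fun _ => Iff.rfl⟩
    have hd := P.two_le_d
    have hvalid : v < P.d ^ (P.L + 1) := hC.valid _ hv
    have hp : F.par (.sel v) = .sel (v / P.d) := by simp [Filling.par, hv0]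
    obtain ⟨w, hw, hlev⟩ := ih (v / P.d) (Nat.div_lt_self (by omega) (by omega)) (hp ▸ hC.par _ hv)
    have h1 : G.par (Φ (.sel v)) = .sel w := by rw [hC.map_par _ hv, hp, hw]
    rcases G.child_sel h1 with ⟨w', hw0, hw', hdiv⟩ | ⟨g, -, hg⟩
    · refine ⟨w', hw', fun i => ?_⟩
      cases i with
      | zero => simp [hv0, hw0]
      | succ i =>
        rw [pow_succ, ← Nat.div_lt_iff_lt_mul P.d_pos, ← Nat.div_lt_iff_lt_mul P.d_pos, hdiv]
        exact hlev i
    · have h2 := (hlev P.L).1 (by rwa [Nat.div_lt_iff_lt_mul P.d_pos, ← pow_succ])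
      have := Nat.zero_le (g / G.κ)
      omega

theorem map_top_zero (hC : IsCommon F G D Φ) (h0 : Φ (.sel 0) = .sel 0) {g : ℕ}
    (hg : D (.top g 0)) : ∃ g', Φ (.top g 0) = .top g' 0 := by
  have hp : F.par (.top g 0) = .sel (P.d ^ P.L + g / F.κ) := by simp [Filling.par]
  obtain ⟨w, hw, hlev⟩ := hC.map_sel h0 _ (hp ▸ hC.par _ hg)
  have h1 : G.par (Φ (.top g 0)) = .sel w := by rw [hC.map_par _ hg, hp, hw]
  rcases G.child_sel h1 with ⟨w', -, hw', hdiv⟩ | ⟨g', hg', -⟩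
  · exfalso
    have h2 := hC.map_valid _ hg
    rw [hw'] at h2
    have h3 : w' / P.d < P.d ^ P.L := by
      rw [Nat.div_lt_iff_lt_mul P.d_pos, ← pow_succ]; exact h2
    have := (hlev P.L).2 (hdiv ▸ h3)
    have := Nat.zero_le (g / F.κ)
    omega
  · exact ⟨g', hg'⟩

/-- If two vertices hang below `bot g s`, then so do their images. -/
theorem map_pair (hC : IsCommon F G D Φ) {g g' s : ℕ} (hs : s < 2 * P.m)
    (htop : Φ (.top g s) = .top g' s) {u v : Vert} (hu : D u) (hv : D v) (huv : u ≠ v)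
    (hup : F.par u = .bot g s) (hvp : F.par v = .bot g s) :
    G.par (Φ u) = .bot g' s ∧ G.par (Φ v) = .bot g' s := by
  have hbot : D (.bot g s) := hup ▸ hC.par _ hu
  have h1 : G.par (Φ (.bot g s)) = .top g' s := by rw [hC.map_par _ hbot, Filling.par, htop]
  have h2 : G.par (Φ u) = Φ (.bot g s) := by rw [hC.map_par _ hu, hup]
  have h3 : G.par (Φ v) = Φ (.bot g s) := by rw [hC.map_par _ hv, hvp]
  rcases G.child_top h1 with h | ⟨-, h⟩ | ⟨-, h, -⟩ | ⟨e, h, -⟩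
  · exact ⟨h2.trans h, h3.trans h⟩
  · exfalso
    rw [h] at h2 h3
    exact huv (hC.inj _ _ hu hv ((G.child_mark h2).2.trans (G.child_mark h3).2.symm))
  · omega
  · omega

/-- A gadget that is kept completely is mapped to a gadget in the only possible way. -/
theorem map_top (hC : IsCommon F G D Φ) {g g' : ℕ} (hg : g < F.κ * P.N)
    (hD : ∀ u, F.Valid u → u.gadget = g → (∀ v, u ≠ .pad v) → (∀ v, u ≠ .sel v) → D u)
    (h0 : Φ (.top g 0) = .top g' 0) (s : ℕ) (hs : s < 2 * P.m) : Φ (.top g s) = .top g' s := by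
  have hm := P.m_pos
  have hDt : ∀ t, t < 4 * P.m → D (.top g t) := fun t ht =>
    hD _ ⟨hg, ht⟩ rfl (by simp) (by simp)
  have hDb : ∀ t, t < 2 * P.m → D (.bot g t) := fun t ht =>
    hD _ ⟨hg, ht⟩ rfl (by simp) (by simp)
  have hDm : ∀ t, t < 2 * P.m → D (.mark g t) := fun t ht =>
    hD _ ⟨hg, ht⟩ rfl (by simp) (by simp)
  have hpt : ∀ t, t ≠ 0 → t < 2 * P.m → F.par (.top g t) = .bot g (t / 2) := fun t h1 h2 => by
    rw [Filling.par, if_neg h1, if_neg (by omega)]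
  induction s using Nat.strong_induction_on with
  | _ s ih =>
    rcases eq_or_ne s 0 with rfl | hs0
    · exact h0
    rcases eq_or_ne s 1 with rfl | hs1
    · -- The vertex `mark g' 0` has no grandchildren, so it cannot be the image of `bot g 0`.
      have h1 : G.par (Φ (.bot g 0)) = .top g' 0 := by
        rw [hC.map_par _ (hDb 0 (by omega)), Filling.par, h0]
      have h2 : G.par (Φ (.top g 1)) = Φ (.bot g 0) := by
        rw [hC.map_par _ (hDt 1 (by omega)), hpt 1 one_ne_zero hs]
      have h3 : G.par (Φ (.bot g 1)) = Φ (.top g 1) := by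
        rw [hC.map_par _ (hDb 1 hs), Filling.par]
      rcases G.child_top h1 with h | ⟨-, h⟩ | ⟨-, h, -⟩ | ⟨e, h, -⟩
      · rw [h] at h2
        obtain ⟨t, ht0, ht, ht2, -⟩ := G.child_bot h2
        rw [ht]
        congr 1; omega
      · exfalso
        rw [h] at h2
        rw [(G.child_mark h2).2] at h3
        exact absurd (G.child_mark h3).1 (by norm_num)
      · omega
      · omega
    -- A vertex `s ≥ 2` of the heap, with its sibling.
    have hpair : ∀ a, a ≠ 0 → a < P.m → Φ (.top g a) = .top g' a →
        Φ (.top g (2 * a)) = .top g' (2 * a) ∧ Φ (.top g (2 * a + 1)) = .top g' (2 * a + 1) := by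
      intro a ha0 ha htop
      obtain ⟨h1, h2⟩ := hC.map_pair (by omega) htop (hDt (2 * a) (by omega))
        (hDt (2 * a + 1) (by omega)) (by simp) (by rw [hpt _ (by omega) (by omega)]; congr 1; omega)
        (by rw [hpt _ (by omega) (by omega)]; congr 1; omega)
      obtain ⟨t, -, ht, ht2, -⟩ := G.child_bot h1
      obtain ⟨t', -, ht', ht2', -⟩ := G.child_bot h2
      have hne : t ≠ t' := fun h => by
        have := hC.inj _ _ (hDt (2 * a) (by omega)) (hDt (2 * a + 1) (by omega))
          (by rw [ht, ht', h])
        simp at this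
      have htne : t ≠ 2 * a + 1 := fun h => by
        have h3 : G.par (Φ (.bot g (2 * a))) = .top g' (2 * a + 1) := by
          rw [hC.map_par _ (hDb _ (by omega)), Filling.par, ht, h]
        have h4 : G.par (Φ (.mark g (2 * a))) = .top g' (2 * a + 1) := by
          rw [hC.map_par _ (hDm _ (by omega)), Filling.par, if_pos (by omega), ht, h]
        have key : ∀ u, G.par u = .top g' (2 * a + 1) → u = .bot g' (2 * a + 1) := by
          intro u hu
          rcases G.child_top hu with h | ⟨h, -⟩ | ⟨h, -⟩ | ⟨e, h, -⟩
          · exact h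
          all_goals omega
        exact absurd (hC.inj _ _ (hDb (2 * a) (by omega)) (hDm (2 * a) (by omega))
          ((key _ h3).trans (key _ h4).symm)) (by simp)
      rw [ht, ht']
      constructor <;> congr 1 <;> omega
    have := hpair (s / 2) (by omega) (by omega) (ih (s / 2) (by omega) (by omega))
    rcases Nat.mod_two_eq_zero_or_one s with h | h
    · rw [show s = 2 * (s / 2) by omega]; exact this.1
    · rw [show s = 2 * (s / 2) + 1 by omega]; exact this.2

theorem bit_of_bit (hC : IsCommon F G D Φ) {g g' : ℕ} (hg : g < F.κ * P.N)
    (hD : ∀ u, F.Valid u → u.gadget = g → (∀ v, u ≠ .pad v) → (∀ v, u ≠ .sel v) → D u)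
    (h0 : Φ (.top g 0) = .top g' 0) {c : ℕ} (hc : c < P.m) (hb : F.bit g c = true) :
    G.bit g' c = true := by
  have hDt : ∀ t, t < 4 * P.m → D (.top g t) := fun t ht =>
    hD _ ⟨hg, ht⟩ rfl (by simp) (by simp)
  have htop := hC.map_top hg hD h0 (P.m + c) (by omega)
  have hp1 : F.par (.top g (2 * (P.m + c))) = .bot g (P.m + c) := by
    rw [Filling.par, if_neg (by omega), if_neg (by omega)]; congr 1; omega
  have hp2 : F.par (.top g (2 * (P.m + c) + 1)) = .bot g (P.m + c) := by
    have h1 : (2 * (P.m + c) + 1) / 2 = P.m + c := by omega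
    rw [Filling.par, if_neg (by omega), h1, Nat.add_sub_cancel_left, hb, if_neg (by simp)]
  obtain ⟨h1, h2⟩ := hC.map_pair (by omega) htop (hDt _ (by omega)) (hDt _ (by omega)) (by simp)
    hp1 hp2
  obtain ⟨t, -, ht, ht2, htb⟩ := G.child_bot h1
  obtain ⟨t', -, ht', ht2', htb'⟩ := G.child_bot h2
  rw [Nat.add_sub_cancel_left] at htb htb'
  have hne : t ≠ t' := fun h => by
    have := hC.inj _ _ (hDt (2 * (P.m + c)) (by omega)) (hDt (2 * (P.m + c) + 1) (by omega))
      (by rw [ht, ht', h])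
    simp at this
  rcases Nat.mod_two_eq_zero_or_one t with h | h
  · exact htb' (by omega) (by omega)
  · exact htb (by omega) h

end IsCommon

/-- If all but `N - 1` of the vertices of the first tree are in a common subtree, then one of its
gadgets is mapped completely, and its bits are set in the gadget of the second tree to which it is
mapped. -/
theorem exists_compatible_of_le_lcst (hx : ∀ g, x g 0 = true)
    (h : (P.source x).n + 1 ≤ (P.source x).tree.lcst (P.target z).tree + P.N) :
    ∃ g₀ < P.N, ∃ g₁ < P.N, ∀ c < P.m, x g₀ c = true → z g₁ c = true := by
  have hm := P.m_pos
  obtain ⟨D, Φ, hC, hcount⟩ := exists_isCommon (P.source x) (P.target z)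
  have hκ : (P.source x).κ * P.N = P.N := by simp [source]
  obtain ⟨g, hg, hD⟩ : ∃ g < P.N, ∀ u, (P.source x).Valid u → u.gadget = g →
      (∀ v, u ≠ .pad v) → (∀ v, u ≠ .sel v) → D u := by
    by_contra! hcon
    have : Nonempty Vert := ⟨.pad 0⟩
    choose! f hf using hcon
    have := hcount (Finset.range P.N) f (fun i hi => (hf i (Finset.mem_range.1 hi)).1)
      (fun i hi => (hf i (Finset.mem_range.1 hi)).2.2.2.2) fun i hi j hj hij => by
        rw [← (hf i (Finset.mem_range.1 hi)).2.1, ← (hf j (Finset.mem_range.1 hj)).2.1, hij]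
    rw [Finset.card_range] at this
    omega
  have hpad : ∀ q, 0 < q → q < P.d → ∃ v, v / P.d ^ (P.h - 1) = q ∧ D (.pad v) := by
    intro q _ hqd
    by_contra! hcon
    have hh : P.d ^ P.h = P.d ^ (P.h - 1) * P.d := by
      rw [← pow_succ]; congr 1
    have hpos : 0 < P.d ^ (P.h - 1) := Nat.pow_pos P.d_pos
    have := hcount (Finset.Ico (P.d ^ (P.h - 1) * q) (P.d ^ (P.h - 1) * (q + 1))) Vert.pad
      (fun i hi => ?_) (fun i hi => hcon i ?_) fun i _ j _ hij => by simpa using hij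
    · rw [Nat.card_Ico, mul_add, mul_one, Nat.add_sub_cancel_left] at this
      have := P.N_lt
      omega
    · have h1 := (Finset.mem_Ico.1 hi).2
      have h2 : P.d ^ (P.h - 1) * (q + 1) ≤ P.d ^ (P.h - 1) * P.d := Nat.mul_le_mul_left _ hqd
      simp only [Filling.Valid]
      omega
    · have h1 := Finset.mem_Ico.1 hi
      rw [Nat.div_eq_iff hpos]
      constructor
      · linarith [h1.1]
      · have := h1.2
        rw [mul_add, mul_one, mul_comm] at this
        omega
  have hDt : ∀ t, t < 4 * P.m → D (.top g t) := fun t ht =>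
    hD _ ⟨hκ.symm ▸ hg, ht⟩ rfl (by simp) (by simp)
  have hsel : ∀ v, D (.sel v) → D (.sel 0) := by
    intro v
    induction v using Nat.strong_induction_on with
    | _ v ih =>
      intro hv
      rcases eq_or_ne v 0 with rfl | hv0
      · exact hv
      · have := hC.par _ hv
        simp only [Filling.par, hv0, if_false] at this
        have hd := P.two_le_d
        exact ih _ (Nat.div_lt_self (by omega) (by omega)) this
  have hs0 : Φ (.sel 0) = .sel 0 := by
    refine hC.map_sel_zero hpad (hsel (P.d ^ P.L + g / (P.source x).κ) ?_)
    simpa [Filling.par] using hC.par _ (hDt 0 (by omega))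
  obtain ⟨g', hg'⟩ := hC.map_top_zero hs0 (hDt 0 (by omega))
  have hbit : ∀ c < P.m, x g c = true → (P.target z).bit g' c = true := fun c hc hb =>
    hC.bit_of_bit (hκ.symm ▸ hg) hD hg' hc hb
  have heven : g' % 2 = 0 := by
    by_contra hodd
    have := hbit 0 hm (hx g)
    simp [target, hodd] at this
  have hlt : g' < 2 * P.N := by
    have := hC.map_valid _ (hDt 0 (by omega))
    rw [hg'] at this
    exact this.1
  refine ⟨g, hg, g' / 2, by omega, fun c hc hb => ?_⟩
  have := hbit c hc hb
  simpa [target, heven] using this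

end Shape

/-! ### The numbering of the trees is computable in polynomial time -/

namespace Shape.Filling

variable {P : Shape} (F : P.Filling)

theorem code_par_gadgetVert (g w : ℕ) : F.code (F.par (gadgetVert P g w)) =
    if w < 4 * P.m then
      if w = 0 then P.d ^ P.h + (P.d ^ P.L + g / F.κ) else
      if 2 * P.m ≤ w ∧ w % 2 = 1 ∧ F.bit g (w / 2 - P.m) = false then F.gadget g (w - 1)
      else F.gadget g (4 * P.m + w / 2) else
    if w < 6 * P.m then F.gadget g (w - 4 * P.m) else
    if w < 8 * P.m then
      if (w - 6 * P.m) % 2 = 0 then F.gadget g (w - 6 * P.m)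
      else F.gadget g (6 * P.m + (w - 6 * P.m - 1)) else
    F.gadget g (2 * P.m + 2 * (w - 8 * P.m)) := by
  unfold gadgetVert
  simp only [apply_ite F.par]
  simp only [par, apply_ite F.code]
  simp only [code]

theorem parNum_eq (u : ℕ) : F.parNum u =
    if u < P.d ^ P.h then u / P.d else
    if u < P.d ^ P.h + P.d ^ (P.L + 1) then
      if u - P.d ^ P.h = 0 then 0 else P.d ^ P.h + (u - P.d ^ P.h) / P.d else
    F.code (F.par (gadgetVert P ((u - (P.d ^ P.h + P.d ^ (P.L + 1))) / F.E)
      ((u - (P.d ^ P.h + P.d ^ (P.L + 1))) % F.E))) := by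
  unfold parNum decode
  split_ifs with h1 h2 h3
  · rfl
  · simp only [par, if_pos h3, code]
  · simp only [par, if_neg h3, code]
  · rfl

end Shape.Filling

namespace RAM

/-- The parameters of a shape are computable in polynomial time. -/
structure CptShape {X : Type} (V : View X) (S : X → Shape) : Prop where
  d : Cpt V fun x => (S x).d
  pow_h : Cpt V fun x => (S x).d ^ (S x).h
  pow_L : Cpt V fun x => (S x).d ^ (S x).L
  m : Cpt V fun x => (S x).m

/-- The data of a filling are computable in polynomial time. -/
structure CptFilling {X : Type} (V : View X) {S : X → Shape} (F : ∀ x, (S x).Filling) : Prop where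
  κ : Cpt V fun x => (F x).κ
  q : Cpt V fun x => (F x).q
  bit : ∀ g c : X → ℕ, Cpt V g → Cpt V c → CptProp V fun x => (F x).bit (g x) (c x) = false

variable {X : Type} {V : View X} {S : X → Shape} {F : ∀ x, (S x).Filling}

theorem CptShape.pow_L_succ (hS : CptShape V S) : Cpt V fun x => (S x).d ^ ((S x).L + 1) :=
  (hS.pow_L.mul hS.d).congr fun _ => pow_succ _ _

theorem CptShape.N (hS : CptShape V S) : Cpt V fun x => (S x).N :=
  (hS.d.sub (.const _ 1)).mul hS.pow_L

namespace CptFilling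

theorem E (hS : CptShape V S) (hF : CptFilling V F) : Cpt V fun x => (F x).E :=
  ((Cpt.const _ 8).mul hS.m).add hF.q

theorem n (hS : CptShape V S) (hF : CptFilling V F) : Cpt V fun x => (F x).n :=
  (hS.pow_h.add hS.pow_L_succ).add ((hF.κ.mul hS.N).mul (hF.E hS))

theorem code_par_gadgetVert (hS : CptShape V S) (hF : CptFilling V F) {g w : X → ℕ}
    (hg : Cpt V g) (hw : Cpt V w) :
    Cpt V fun x => (F x).code ((F x).par (Shape.Filling.gadgetVert (S x) (g x) (w x))) := by
  have hE := hF.E hS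
  have c : ∀ a, Cpt V fun _ => a := Cpt.const V
  have hG : ∀ {w : X → ℕ}, Cpt V w → Cpt V fun x => (F x).gadget (g x) (w x) :=
    fun h => (hS.pow_h.add hS.pow_L_succ).add ((hg.mul hE).add h)
  have hm : ∀ a, Cpt V fun x => a * (S x).m := fun a => (c a).mul hS.m
  refine Cpt.congr ?_ fun x => (F x).code_par_gadgetVert (g x) (w x)
  refine .ite (.lt hw (hm 4)) (.ite (.eq hw (c 0)) ?_ (.ite ?_ ?_ ?_)) (.ite (.lt hw (hm 6)) ?_
    (.ite (.lt hw (hm 8)) (.ite ?_ ?_ ?_) ?_))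
  · exact hS.pow_h.add (hS.pow_L.add (hg.div hF.κ))
  · exact .and (.le (hm 2) hw) (.and (.eq (hw.mod (c 2)) (c 1))
      (hF.bit _ _ hg ((hw.div (c 2)).sub hS.m)))
  · exact hG (hw.sub (c 1))
  · exact hG ((hm 4).add (hw.div (c 2)))
  · exact hG (hw.sub (hm 4))
  · exact .eq ((hw.sub (hm 6)).mod (c 2)) (c 0)
  · exact hG (hw.sub (hm 6))
  · exact hG ((hm 6).add ((hw.sub (hm 6)).sub (c 1)))
  · exact hG ((hm 2).add ((c 2).mul (hw.sub (hm 8))))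

theorem parNum (hS : CptShape V S) (hF : CptFilling V F) {u : X → ℕ} (hu : Cpt V u) :
    Cpt V fun x => (F x).parNum (u x) := by
  have hb := hS.pow_h.add hS.pow_L_succ
  have hE := hF.E hS
  refine Cpt.congr ?_ fun x => (F x).parNum_eq (u x)
  exact .ite (.lt hu hS.pow_h) (hu.div hS.d) (.ite (.lt hu hb) (.ite (.eq (hu.sub hS.pow_h)
    (.const _ 0)) (.const _ 0) (hS.pow_h.add ((hu.sub hS.pow_h).div hS.d)))
    (hF.code_par_gadgetVert hS ((hu.sub hb).div hE) ((hu.sub hb).mod hE)))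

end CptFilling

end RAM

/-! ### Reading the formula -/

/-- The instances of `k`-SAT. -/
structure KSAT (k : ℕ) where
  n : ℕ
  φ : CNF n
  isKCNF : φ.IsKCNF k

namespace KSAT

variable {k : ℕ}

/-- The encoding of a clause. -/
def encodeClause {n : ℕ} (c : List (Fin n × Bool)) : List ℕ :=
  c.length :: c.map fun l => 2 * (l.1 : ℕ) + l.2.toNat

/-- The input. -/
def list (x : KSAT k) : List ℕ := x.φ.encode

theorem list_eq (x : KSAT k) : x.list = x.n :: x.φ.length :: x.φ.flatMap encodeClause := rfl

/-- The number of clauses is polynomial for fixed `k`. -/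
theorem length_le (x : KSAT k) : x.φ.length ≤ (2 * x.n + 1) ^ k := by
  classical
  rw [← List.toFinset_card_of_nodup x.isKCNF.1]
  let f : List (Fin x.n × Bool) → Fin k → Option (Fin x.n × Bool) := fun l j => l[(j : ℕ)]?
  have hle := Finset.card_le_card_of_injOn (s := x.φ.toFinset) (t := Finset.univ) f
    (fun _ _ => by simp) (by
      intro l hl l' hl' h
      have h1 := x.isKCNF.2 l (by simpa using hl)
      have h2 := x.isKCNF.2 l' (by simpa using hl')
      refine List.ext_getElem? fun i => ?_
      by_cases hi : i < k
      · exact congrFun h ⟨i, hi⟩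
      · rw [List.getElem?_eq_none (by omega), List.getElem?_eq_none (by omega)])
  refine hle.trans (le_of_eq ?_)
  simp [mul_comm]

theorem le_of_mem_list (x : KSAT k) : ∀ e ∈ x.list, e ≤ 2 * x.n + 1 + x.φ.length + k := by
  intro e he
  rw [list_eq, List.mem_cons, List.mem_cons, List.mem_flatMap] at he
  rcases he with rfl | rfl | ⟨c, hc, he⟩
  · omega
  · omega
  · rw [encodeClause, List.mem_cons, List.mem_map] at he
    rcases he with rfl | ⟨l, -, rfl⟩
    · have := x.isKCNF.2 c hc
      omega
    · have := l.1.2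
      have := l.2.toNat_le
      omega

theorem length_list_le (x : KSAT k) : x.list.length ≤ 2 + x.φ.length * (k + 1) := by
  rw [list_eq, List.length_cons, List.length_cons, List.length_flatMap]
  have : (x.φ.map fun c => (encodeClause c).length).sum ≤
      (x.φ.map fun c => (encodeClause c).length).length • (k + 1) := by
    refine List.sum_le_card_nsmul _ _ fun e he => ?_
    obtain ⟨c, hc, rfl⟩ := List.mem_map.1 he
    simpa [encodeClause] using x.isKCNF.2 c hc
  rw [List.length_map, smul_eq_mul] at this
  omega

/-- The position at which the encoding of the clause `c` starts. -/
def pos (x : KSAT k) : ℕ → ℕ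
  | 0 => 2
  | c + 1 => x.pos c + 1 + x.list.getD (x.pos c) 0

theorem getD_add_of_drop {l l' : List ℕ} {p : ℕ} (h : l.drop p = l') (j : ℕ) :
    l.getD (p + j) 0 = l'.getD j 0 := by
  rw [← h, List.getD_eq_getElem?_getD, List.getD_eq_getElem?_getD, List.getElem?_drop]

theorem drop_pos (x : KSAT k) (c : ℕ) (hc : c ≤ x.φ.length) :
    x.list.drop (x.pos c) = (x.φ.drop c).flatMap encodeClause := by
  induction c with
  | zero => simp [pos, list_eq]
  | succ c ih =>
    have h1 := ih (by omega)
    rw [List.drop_eq_getElem_cons (show c < x.φ.length by omega), List.flatMap_cons] at h1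
    have h2 := getD_add_of_drop h1 0
    rw [pos, ← List.drop_drop, ← List.drop_drop, h1]
    simp only [add_zero] at h2
    rw [h2]
    simp [encodeClause]

theorem pos_le (x : KSAT k) (c : ℕ) (hc : c ≤ x.φ.length) : x.pos c ≤ x.list.length := by
  induction c with
  | zero => simp [pos, list_eq]
  | succ c ih =>
    have h1 := congrArg List.length (x.drop_pos c (by omega))
    have h2 := x.drop_pos c (by omega)
    rw [List.drop_eq_getElem_cons (show c < x.φ.length by omega), List.flatMap_cons] at h1 h2
    have h3 := getD_add_of_drop h2 0
    simp only [add_zero] at h3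
    rw [pos, h3]
    simp only [List.length_drop, List.length_append, encodeClause, List.length_cons,
      List.length_map, List.cons_append, List.getD_cons_zero] at h1 ⊢
    omega

theorem getD_pos (x : KSAT k) {c : ℕ} (hc : c < x.φ.length) :
    x.list.getD (x.pos c) 0 = x.φ[c].length := by
  have h2 := x.drop_pos c hc.le
  rw [List.drop_eq_getElem_cons hc, List.flatMap_cons] at h2
  have h3 := getD_add_of_drop h2 0
  simpa [encodeClause] using h3

theorem getD_literal (x : KSAT k) {c : ℕ} (hc : c < x.φ.length) {j : ℕ}
    (hj : j < x.φ[c].length) : x.list.getD (x.pos c + 1 + j) 0 =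
      2 * ((x.φ[c][j]).1 : ℕ) + (x.φ[c][j]).2.toNat := by
  have h2 := x.drop_pos c hc.le
  rw [List.drop_eq_getElem_cons hc, List.flatMap_cons] at h2
  have h3 := getD_add_of_drop h2 (1 + j)
  rw [add_assoc, h3, add_comm 1 j, encodeClause, List.cons_append, List.getD_cons_succ,
    List.getD_append _ _ _ _ (by simpa using hj),
    List.getD_eq_getElem _ _ (by simpa using hj), List.getElem_map]

/-- The number of literals of the clause `c` that are satisfied when the variables
`lo, lo + 1, …, hi - 1` are set to the binary digits of `g`. -/
def satCount (x : KSAT k) (lo hi g c : ℕ) : ℕ :=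
  ∑ j ∈ Finset.range (x.list.getD (x.pos (min c x.φ.length)) 0),
    if lo ≤ x.list.getD (x.pos (min c x.φ.length) + 1 + j) 0 / 2 ∧
        x.list.getD (x.pos (min c x.φ.length) + 1 + j) 0 / 2 < hi ∧
        g / 2 ^ (x.list.getD (x.pos (min c x.φ.length) + 1 + j) 0 / 2 - lo) % 2 =
          x.list.getD (x.pos (min c x.φ.length) + 1 + j) 0 % 2 then 1 else 0

theorem satCount_ne_zero (x : KSAT k) {lo hi g c : ℕ} (hc : c < x.φ.length) :
    x.satCount lo hi g c ≠ 0 ↔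
      ∃ l ∈ x.φ[c], lo ≤ (l.1 : ℕ) ∧ (l.1 : ℕ) < hi ∧ g / 2 ^ ((l.1 : ℕ) - lo) % 2 = l.2.toNat := by
  have hdiv : ∀ l : Fin x.n × Bool, (2 * (l.1 : ℕ) + l.2.toNat) / 2 = l.1 := fun l => by
    have := l.2.toNat_lt; omega
  have hmod : ∀ l : Fin x.n × Bool, (2 * (l.1 : ℕ) + l.2.toNat) % 2 = l.2.toNat := fun l => by
    have := l.2.toNat_lt; omega
  rw [satCount, min_eq_left hc.le, x.getD_pos hc, Ne, Finset.sum_eq_zero_iff]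
  push Not
  constructor
  · rintro ⟨j, hj, h⟩
    have hj := Finset.mem_range.1 hj
    rw [x.getD_literal hc hj, hdiv, hmod] at h
    exact ⟨_, List.getElem_mem hj, by simpa using h⟩
  · rintro ⟨l, hl, h⟩
    obtain ⟨j, hj, rfl⟩ := List.getElem_of_mem hl
    refine ⟨j, Finset.mem_range.2 hj, ?_⟩
    rw [x.getD_literal hc hj, hdiv, hmod]
    simpa using h

end KSAT

/-! ### The reduction -/

namespace KSAT

variable {k : ℕ}

/-- Half of the number of variables. -/
def half (x : KSAT k) : ℕ := (x.n + 1) / 2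

/-- The bits of the first tree: the bit `c + 1` of the gadget `g` says that the first half of the
variables, set to the digits of `g`, does not satisfy the clause `c`. -/
def bitX (x : KSAT k) (g c : ℕ) : Bool := decide (c = 0 ∨ x.satCount 0 x.half g (c - 1) = 0)

/-- The bits of the second tree: the bit `c + 1` of the gadget `g` says that the second half of the
variables, set to the digits of `g`, satisfies the clause `c`. -/
def bitZ (x : KSAT k) (g c : ℕ) : Bool := decide (c = 0 ∨ x.satCount x.half x.n g (c - 1) ≠ 0)

theorem exists_digits (f : ℕ → Bool) (k : ℕ) :
    ∃ g < 2 ^ k, ∀ v < k, g / 2 ^ v % 2 = (f v).toNat := by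
  induction k generalizing f with
  | zero => exact ⟨0, by simp, by simp⟩
  | succ k ih =>
    obtain ⟨g, hg, h⟩ := ih fun v => f (v + 1)
    have hb := (f 0).toNat_lt
    refine ⟨2 * g + (f 0).toNat, by rw [pow_succ]; omega, fun v hv => ?_⟩
    cases v with
    | zero => rw [pow_zero, Nat.div_one]; omega
    | succ v =>
      rw [pow_succ', ← Nat.div_div_eq_div_mul, show (2 * g + (f 0).toNat) / 2 = g by omega]
      exact h v (by omega)

/-- The formula is satisfiable if and only if a gadget of the first tree is compatible with a gadget
of the second tree. -/
theorem satisfiable_iff (x : KSAT k) {N : ℕ} (hN : 2 ^ x.half ≤ N) :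
    x.φ.Satisfiable ↔ ∃ g₀ < N, ∃ g₁ < N, ∀ c < x.φ.length + 1,
      x.bitX g₀ c = true → x.bitZ g₁ c = true := by
  constructor
  · rintro ⟨a, ha⟩
    let f : ℕ → Bool := fun v => if h : v < x.n then a ⟨v, h⟩ else false
    have hf : ∀ v : Fin x.n, f v = a v := fun v => by simp [f]
    obtain ⟨g₀, hg₀, h₀⟩ := exists_digits f x.half
    obtain ⟨g₁, hg₁, h₁⟩ := exists_digits (fun v => f (x.half + v)) x.half
    refine ⟨g₀, hg₀.trans_le hN, g₁, hg₁.trans_le hN, fun c hc hx => ?_⟩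
    cases c with
    | zero => simp [bitZ]
    | succ c =>
      have hc' : c < x.φ.length := by omega
      obtain ⟨l, hl, hal⟩ := ha _ (List.getElem_mem hc')
      by_cases hlt : (l.1 : ℕ) < x.half
      · exfalso
        have h3 : x.satCount 0 x.half g₀ c ≠ 0 := (x.satCount_ne_zero hc').2
          ⟨l, hl, Nat.zero_le _, hlt, by rw [Nat.sub_zero, h₀ _ hlt, hf, hal]⟩
        simp [bitX, h3] at hx
      · have h3 : x.satCount x.half x.n g₁ c ≠ 0 := by
          refine (x.satCount_ne_zero hc').2 ⟨l, hl, by omega, l.1.2, ?_⟩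
          have := l.1.2
          rw [h₁ _ (by simp only [half] at hlt ⊢; omega)]
          rw [show x.half + ((l.1 : ℕ) - x.half) = l.1 by omega, hf, hal]
        simp [bitZ, h3]
  · rintro ⟨g₀, -, g₁, -, h⟩
    refine ⟨fun v => if (v : ℕ) < x.half then decide (g₀ / 2 ^ (v : ℕ) % 2 = 1)
      else decide (g₁ / 2 ^ ((v : ℕ) - x.half) % 2 = 1), fun c hc => ?_⟩
    obtain ⟨i, hi, rfl⟩ := List.getElem_of_mem hc
    have hdec : ∀ (w : ℕ) (b : Bool), w % 2 = b.toNat → decide (w % 2 = 1) = b := by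
      intro w b hb
      cases b <;> simp_all
    by_cases h0 : x.satCount 0 x.half g₀ i = 0
    · have h1 := h (i + 1) (by omega) (by simp [bitX, h0])
      have h2 : x.satCount x.half x.n g₁ i ≠ 0 := by simpa [bitZ] using h1
      obtain ⟨l, hl, h3, -, h4⟩ := (x.satCount_ne_zero hi).1 h2
      exact ⟨l, hl, by simp only [if_neg (not_lt.2 h3)]; exact hdec _ _ h4⟩
    · obtain ⟨l, hl, -, h3, h4⟩ := (x.satCount_ne_zero hi).1 h0
      exact ⟨l, hl, by simp only [if_pos h3]; exact hdec _ _ (by simpa using h4)⟩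

/-- The shape of the trees. -/
def shape (d : ℕ) (hd : 2 ≤ d) (x : KSAT k) : Shape where
  d := d
  L := Nat.clog d (2 ^ x.half)
  r := Nat.clog 2 (2 * (x.φ.length + 1))
  m := x.φ.length + 1
  two_le_d := hd
  m_pos := Nat.succ_pos _
  le_two_pow := Nat.le_pow_clog (by norm_num) _

variable {d : ℕ} {hd : 2 ≤ d}

/-- The first tree. -/
def F (d : ℕ) (hd : 2 ≤ d) (x : KSAT k) : (x.shape d hd).Filling := (x.shape d hd).source x.bitX

/-- The second tree. -/
def G (d : ℕ) (hd : 2 ≤ d) (x : KSAT k) : (x.shape d hd).Filling := (x.shape d hd).target x.bitZ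

theorem two_pow_half_le_N (x : KSAT k) : 2 ^ x.half ≤ (x.shape d hd).N := by
  have h1 : 2 ^ x.half ≤ d ^ Nat.clog d (2 ^ x.half) := Nat.le_pow_clog (by omega) _
  exact h1.trans (Nat.le_mul_of_pos_left _ (by simp only [shape]; omega))

/-- The formula is satisfiable if and only if the largest common subtree reaches a threshold. -/
theorem satisfiable_iff_le_lcst (x : KSAT k) : x.φ.Satisfiable ↔
    (x.F d hd).n + 1 - (x.shape d hd).N ≤ (x.F d hd).tree.lcst (x.G d hd).tree := by
  rw [x.satisfiable_iff (x.two_pow_half_le_N (d := d) (hd := hd)), Nat.sub_le_iff_le_add]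
  constructor
  · rintro ⟨g₀, hg₀, g₁, hg₁, h⟩
    exact Shape.le_lcst_of_compatible hg₀ hg₁ h
  · exact Shape.exists_compatible_of_le_lcst fun g => by simp [bitX]

end KSAT

/-! ### The reduction is computable in polynomial time per vertex -/

namespace KSAT

open RAM

variable {k : ℕ} {Y : Type} {V : View Y} {π : Y → KSAT k}

/-- The instance `π y` is the input, and the size is its number of variables. -/
structure Reads (V : View Y) (π : Y → KSAT k) : Prop where
  list : ∀ y, V.list y = (π y).list
  size : ∀ y, V.size y = (π y).n

namespace Reads

theorem lift {Z : Type} {V' : View Z} {ρ : Z → Y} (h : Reads V π) (hE : V.Extends V' ρ) :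
    Reads V' fun z => π (ρ z) :=
  ⟨fun z => (hE.list z).trans (h.list _), fun z => (hE.size z).trans (h.size _)⟩

theorem bdd_n (h : Reads V π) : PolyBdd V.size fun y => (π y).n :=
  (PolyBdd.self _).mono fun y => (h.size y).ge

theorem bdd_clauses (h : Reads V π) : PolyBdd V.size fun y => (π y).φ.length :=
  (((((PolyBdd.const _ 2).mul h.bdd_n).add (.const _ 1)).pow k)).mono fun y => (π y).length_le

theorem bdd_length (h : Reads V π) : PolyBdd V.size fun y => (π y).list.length :=
  ((PolyBdd.const _ 2).add (h.bdd_clauses.mul (.const _ (k + 1)))).mono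
    fun y => (π y).length_list_le

theorem bdd_getD (h : Reads V π) (f : Y → ℕ) :
    PolyBdd V.size fun y => (π y).list.getD (f y) 0 := by
  refine (((((PolyBdd.const _ 2).mul h.bdd_n).add (.const _ 1)).add h.bdd_clauses).add
    (.const _ k)).mono fun y => ?_
  by_cases hf : f y < (π y).list.length
  · rw [List.getD_eq_getElem _ _ hf]
    exact (π y).le_of_mem_list _ (List.getElem_mem hf)
  · rw [List.getD_eq_default _ _ (not_lt.1 hf)]
    exact Nat.zero_le _

theorem bdd_half (h : Reads V π) : PolyBdd V.size fun y => (π y).half :=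
  (h.bdd_n.add (.const _ 1)).mono fun _ => Nat.div_le_self _ _

theorem getD (h : Reads V π) {f : Y → ℕ} (hf : Cpt V f) :
    Cpt V fun y => (π y).list.getD (f y) 0 :=
  hf.getD.congr fun y => by rw [h.list]

theorem n (h : Reads V π) : Cpt V fun y => (π y).n := (h.getD (.const V 0)).congr fun _ => rfl

theorem clauses (h : Reads V π) : Cpt V fun y => (π y).φ.length :=
  (h.getD (.const V 1)).congr fun _ => rfl

theorem length (h : Reads V π) : Cpt V fun y => (π y).list.length :=
  (Cpt.reg V V.zero_mem).congr fun y => by rw [V.reg_zero, h.list]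

theorem half (h : Reads V π) : Cpt V fun y => (π y).half :=
  (h.n.add (.const V 1)).div (.const V 2)

theorem pos (h : Reads V π) {c : Y → ℕ} (hc : Cpt V c) :
    Cpt V fun y => (π y).pos (min (c y) (π y).φ.length) := by
  refine Cpt.iterate (hc.min h.clauses) (h.bdd_clauses.mono fun _ => min_le_right _ _)
    (fun y => (π y).pos) (.const V 2) ?_ fun V' hE _ hcur => ?_
  · obtain ⟨e, he⟩ := h.bdd_length.add (.const _ 1)
    exact ⟨e, fun y i hi => (len_le_succ _).trans ((Nat.succ_le_succ ((π y).pos_le i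
      (hi.trans (min_le_right _ _)))).trans (he y))⟩
  · exact (hcur.add (.const V' 1)).add ((h.lift hE).getD hcur)

theorem satCount (h : Reads V π) {lo hi g c : Y → ℕ} (hlo : Cpt V lo) (hhi : Cpt V hi)
    (hg : Cpt V g) (hc : Cpt V c) :
    Cpt V fun y => (π y).satCount (lo y) (hi y) (g y) (c y) := by
  refine Cpt.sum (h.getD (h.pos hc)) (h.bdd_getD _) (fun y j =>
    if lo y ≤ (π y).list.getD ((π y).pos (min (c y) (π y).φ.length) + 1 + j) 0 / 2 ∧
        (π y).list.getD ((π y).pos (min (c y) (π y).φ.length) + 1 + j) 0 / 2 < hi y ∧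
        g y / 2 ^ ((π y).list.getD ((π y).pos (min (c y) (π y).φ.length) + 1 + j) 0 / 2 - lo y) % 2
          = (π y).list.getD ((π y).pos (min (c y) (π y).φ.length) + 1 + j) 0 % 2 then 1 else 0)
    (fun V' hE hj => ?_) ⟨0, fun y j _ => by split_ifs <;> simp⟩
  have h' := h.lift hE
  have hl := h'.getD ((((h.pos hc).lift hE).add (.const V' 1)).add hj)
  have hv := hl.div (.const V' 2)
  have hpow := Cpt.const_pow 2 (hv.sub (hlo.lift hE))
    ((h'.bdd_getD _).mono fun y => (Nat.sub_le _ _).trans (Nat.div_le_self _ _))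
  exact .ite (.and (.le (hlo.lift hE) hv) (.and (.lt hv (hhi.lift hE))
    (.eq (((hg.lift hE).div hpow).mod (.const V' 2)) (hl.mod (.const V' 2))))) (.const V' 1)
    (.const V' 0)

variable {d : ℕ} {hd : 2 ≤ d}

theorem two_pow_half (h : Reads V π) : Cpt V fun y => 2 ^ (π y).half :=
  Cpt.const_pow 2 h.half h.bdd_half

theorem clog_le (hd : 2 ≤ d) (x : KSAT k) : Nat.clog d (2 ^ x.half) ≤ x.half :=
  Nat.clog_le_of_le_pow (Nat.pow_le_pow_left hd _)

theorem bdd_L (h : Reads V π) (hd : 2 ≤ d) :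
    PolyBdd V.size fun y => Nat.clog d (2 ^ (π y).half) :=
  h.bdd_half.mono fun _ => clog_le hd _

theorem cptShape (h : Reads V π) (hd : 2 ≤ d) : CptShape V fun y => (π y).shape d hd := by
  have hL : Cpt V fun y => Nat.clog d (2 ^ (π y).half) :=
    Cpt.clog (by omega) h.two_pow_half h.half h.bdd_half fun y => Nat.pow_le_pow_left hd _
  have hm := h.clauses.add (.const V 1)
  have hmb := (PolyBdd.const V.size 2).mul (h.bdd_clauses.add (.const _ 1))
  have hr : Cpt V fun y => Nat.clog 2 (2 * ((π y).φ.length + 1)) :=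
    Cpt.clog (by norm_num) ((Cpt.const V 2).mul hm) ((Cpt.const V 2).mul hm) hmb
      fun _ => Nat.lt_two_pow_self.le
  have hrb : PolyBdd V.size fun y => Nat.clog 2 (2 * ((π y).φ.length + 1)) :=
    hmb.mono fun _ => Nat.clog_le_of_le_pow Nat.lt_two_pow_self.le
  exact ⟨.const V d, Cpt.const_pow d ((hL.add ((Cpt.const V 2).mul hr)).add (.const V 10))
    (((h.bdd_L hd).add ((PolyBdd.const _ 2).mul hrb)).add (.const _ 10)),
    Cpt.const_pow d hL (h.bdd_L hd), hm⟩

theorem cptFilling_F (h : Reads V π) : CptFilling V fun y => (π y).F d hd := by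
  refine ⟨.const V 1, .const V 0, fun g c hg hc => ?_⟩
  refine (CptProp.not (.or (.eq hc (.const V 0)) (.eq (h.satCount (.const V 0) h.half hg
    (hc.sub (.const V 1))) (.const V 0)))).congr fun y => ?_
  simp [F, Shape.source, bitX]

theorem cptFilling_G (h : Reads V π) : CptFilling V fun y => (π y).G d hd := by
  refine ⟨.const V 2, (h.cptShape hd).m, fun g c hg hc => ?_⟩
  have h0 := CptProp.eq hc (.const V 0)
  have heven := CptProp.eq (hg.mod (.const V 2)) (.const V 0)
  refine (CptProp.or (.and heven (.not (.or h0 (.not (.eq (h.satCount h.half h.n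
    (hg.div (.const V 2)) (hc.sub (.const V 1))) (.const V 0)))))) (.and (.not heven) h0)).congr
    fun y => ?_
  by_cases hy : g y % 2 = 0 <;> simp [G, Shape.target, bitZ, hy]

end Reads

/-! ### The output of the reduction -/

/-- The length of the encoding of the two trees. -/
def total (d : ℕ) (hd : 2 ≤ d) (x : KSAT k) : ℕ := (x.F d hd).n + (x.G d hd).n + 4

/-- The entries of the encoding of the two trees. -/
def out (d : ℕ) (hd : 2 ≤ d) (x : KSAT k) (a : ℕ) : ℕ :=
  if a = 0 then (x.F d hd).n else if a = 1 then 0 else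
  if a < (x.F d hd).n + 2 then (x.F d hd).parNum (a - 2) else
  if a = (x.F d hd).n + 2 then (x.G d hd).n else if a = (x.F d hd).n + 3 then 0 else
  (x.G d hd).parNum (a - ((x.F d hd).n + 4))

/-- The encoding of the two trees. -/
def trees (d : ℕ) (hd : 2 ≤ d) (x : KSAT k) : List ℕ :=
  (x.F d hd).tree.encode ++ (x.G d hd).tree.encode

theorem _root_.Shape.Filling.length_encode {P : Shape} (F : P.Filling) :
    F.tree.encode.length = F.n + 2 := by simp [RTree.encode]

theorem _root_.Shape.Filling.getD_encode {P : Shape} (F : P.Filling) {a : ℕ} (ha : a < F.n) :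
    F.tree.encode.getD (a + 2) 0 = F.parNum a := by
  have h : a < (List.ofFn fun v => (F.tree.parent v : ℕ)).length := by simpa using ha
  rw [RTree.encode, List.getD_cons_succ, List.getD_cons_succ, List.getD_eq_getElem _ _ h,
    List.getElem_ofFn]
  rfl

variable {d : ℕ} {hd : 2 ≤ d}

theorem length_trees (x : KSAT k) : (x.trees d hd).length = x.total d hd := by
  rw [trees, List.length_append, Shape.Filling.length_encode, Shape.Filling.length_encode, total]
  ring

theorem getD_trees (x : KSAT k) {a : ℕ} (ha : a < x.total d hd) :
    (x.trees d hd).getD a 0 = x.out d hd a := by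
  have hl := (x.F d hd).length_encode
  rw [total] at ha
  rw [trees, out]
  by_cases h : a < (x.F d hd).n + 2
  · rw [List.getD_append _ _ _ _ (by omega)]
    split_ifs with h0 h1
    · subst h0; rfl
    · subst h1; rfl
    · obtain ⟨b, rfl⟩ := Nat.exists_eq_add_of_le' (show 2 ≤ a by omega)
      exact (x.F d hd).getD_encode (by omega)
  · rw [List.getD_append_right _ _ _ _ (by omega), hl, if_neg (by omega), if_neg (by omega),
      if_neg h]
    split_ifs with h0 h1
    · rw [h0, Nat.sub_self]; rfl
    · rw [h1, show (x.F d hd).n + 3 - ((x.F d hd).n + 2) = 1 by omega]; rfl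
    · rw [← (x.G d hd).getD_encode (by omega)]
      congr 1; omega

theorem Reads.total (h : Reads V π) : Cpt V fun y => (π y).total d hd :=
  ((h.cptFilling_F.n (h.cptShape hd)).add (h.cptFilling_G.n (h.cptShape hd))).add (.const V 4)

theorem Reads.out (h : Reads V π) {a : Y → ℕ} (ha : Cpt V a) :
    Cpt V fun y => (π y).out d hd (a y) := by
  have hS := h.cptShape hd
  have hF := h.cptFilling_F (hd := hd)
  have hG := h.cptFilling_G (hd := hd)
  have c : ∀ b, Cpt V fun _ => b := Cpt.const V
  exact .ite (.eq ha (c 0)) (hF.n hS) (.ite (.eq ha (c 1)) (c 0)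
    (.ite (.lt ha ((hF.n hS).add (c 2))) (hF.parNum hS (ha.sub (c 2)))
    (.ite (.eq ha ((hF.n hS).add (c 2))) (hG.n hS) (.ite (.eq ha ((hF.n hS).add (c 3))) (c 0)
    (hG.parNum hS (ha.sub ((hF.n hS).add (c 4))))))))

/-- The number of common vertices that decides whether the formula is satisfiable. -/
def threshold (d : ℕ) (hd : 2 ≤ d) (x : KSAT k) : ℕ := (x.F d hd).n + 1 - (x.shape d hd).N

theorem Reads.threshold (h : Reads V π) : Cpt V fun y => (π y).threshold d hd :=
  ((h.cptFilling_F.n (h.cptShape hd)).add (.const V 1)).sub (h.cptShape hd).N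

end KSAT

/-! ### The program of the reduction -/

namespace KSAT

open RAM

variable {k : ℕ}

/-- The input as a `View`, with the registers below `R` reserved. -/
def inputView (k R : ℕ) (hR : 0 < R) : View (KSAT k) where
  K := R
  vars := {0}
  reg x _ := x.list.length
  list := list
  size := n
  lt_of_mem := by simp [hR]
  zero_mem := rfl
  reg_zero _ := rfl
  regBdd _ _ := by
    have h1 : PolyBdd (n : KSAT k → ℕ) fun x => x.φ.length :=
      ((((PolyBdd.const _ 2).mul (.self _)).add (.const _ 1)).pow k).mono length_le
    exact (((PolyBdd.const _ 2).add (h1.mul (.const _ (k + 1)))).add (.const _ 1)).mono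
      fun x => (len_le_succ _).trans (Nat.succ_le_succ x.length_list_le)
  listBdd := by
    have h1 : PolyBdd (n : KSAT k → ℕ) fun x => x.φ.length :=
      ((((PolyBdd.const _ 2).mul (.self _)).add (.const _ 1)).pow k).mono length_le
    obtain ⟨c, hc⟩ := (((((PolyBdd.const _ 2).mul (.self n)).add (.const _ 1)).add h1).add
      (.const _ k)).add (.const _ 1)
    exact ⟨c, fun x e he => (len_le_succ _).trans
      ((Nat.succ_le_succ (x.le_of_mem_list e he)).trans (hc x))⟩

theorem reads_inputView (k R : ℕ) (hR : 0 < R) : Reads (inputView k R hR) id :=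
  ⟨fun _ => rfl, fun _ => rfl⟩

/-- The input together with a number in register `R + 3`. -/
def indexView (R : ℕ) (hR : 0 < R) (f : KSAT k → ℕ)
    (hf : PolyBdd n fun x => len (f x)) : View (Steps f) where
  K := R + 4
  vars := {0, R + 3}
  reg y i := if i = R + 3 then y.1.2 else y.1.1.list.length
  list y := y.1.1.list
  size y := y.1.1.n
  lt_of_mem := by simp
  zero_mem := .inl rfl
  reg_zero _ := by simp
  regBdd i _ := by
    by_cases h : i = R + 3
    · simp only [h, if_true]
      exact (hf.comp (fun y : Steps f => y.1.1) fun _ => rfl).mono fun y => len_mono y.2.le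
    · simp only [h, if_false]
      exact ((inputView k R hR).regBdd 0 rfl).comp _ fun _ => rfl
  listBdd := by
    obtain ⟨c, hc⟩ := (inputView k R hR).listBdd
    exact ⟨c, fun y => hc y.1.1⟩

theorem reads_indexView {R : ℕ} (hR : 0 < R) {f : KSAT k → ℕ}
    (hf : PolyBdd n fun x => len (f x)) : Reads (indexView R hR f hf) fun y => y.1.1 :=
  ⟨fun _ => rfl, fun _ => rfl⟩

theorem len_zero : len 0 = 1 := by simp [len]

theorem len_one : len 1 = 1 := by simp [len]

/-- A program writes the two trees into the memory, and the threshold into the register `R + 1`. The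
trees are first written behind everything else, and then moved to the beginning of the memory. -/
theorem exists_reduction (k d R : ℕ) (hd : 2 ≤ d) (hR : 0 < R) :
    ∃ (q : Prog) (T : KSAT k → ℕ), PolyBdd n T ∧ ∀ x : KSAT k, ∃ t s,
      Exec q (init x.list) t s ∧ t ≤ (x.total d hd + 1) * T x ∧
      (∀ i < R, s.reg i = (init (x.trees d hd)).reg i) ∧ s.mem = (init (x.trees d hd)).mem ∧
      s.reg (R + 1) = x.threshold d hd := by
  have hV := reads_inputView k R hR
  have htot := hV.total (hd := hd)
  have hthr := hV.threshold (hd := hd)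
  have hoff := htot.add hV.length
  have hlenb := hV.bdd_length
  set V := inputView k R hR with hVdef
  simp only [id] at htot hthr hoff hlenb
  have hW := reads_indexView hR htot.bdd
  have hidx : Cpt (indexView R hR (fun x : KSAT k => x.total d hd) htot.bdd) fun y => y.1.2 :=
    (Cpt.reg (indexView R hR (fun x : KSAT k => x.total d hd) htot.bdd) (i := R + 3)
      (.inr rfl)).congr fun y => by simp [indexView]
  have hout := hW.out (hd := hd) hidx
  set W := indexView R hR (fun x : KSAT k => x.total d hd) htot.bdd with hWdef
  obtain ⟨b₁, T₁, hT₁, h₁⟩ := htot.run R le_rfl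
  obtain ⟨b₂, T₂, hT₂, h₂⟩ := hthr.run (R + 1) (Nat.le_add_right _ _)
  obtain ⟨b₃, T₃, hT₃, h₃⟩ := hoff.run (R + 2) (Nat.le_add_right _ _)
  obtain ⟨b₄, T₄, hT₄, h₄⟩ := htot.run (R + 3) (Nat.le_add_right _ _)
  obtain ⟨b₅, T₅, ⟨c₅, hT₅⟩, h₅⟩ := hout.run (R + 5) (Nat.le_succ _)
  obtain ⟨b₆, T₆, hT₆, h₆⟩ := hoff.run (R + 3) (Nat.le_add_right _ _)
  obtain ⟨c₀, hc₀⟩ := hout.bdd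
  have hS₅ : PolyBdd n fun x : KSAT k => (x.n + 2) ^ c₅ := ⟨c₅, fun _ => le_rfl⟩
  have hS₀ : PolyBdd n fun x : KSAT k => (x.n + 2) ^ c₀ + 1 :=
    PolyBdd.add ⟨c₀, fun _ => le_rfl⟩ (.const _ 1)
  -- The number of steps of one round of either of the two loops below.
  let B : KSAT k → ℕ := fun x => (x.n + 2) ^ c₅ + ((((x.n + 2) ^ c₀ + 1) +
    ((x.n + 2) ^ c₀ + 1)) + (8 * len (x.total d hd + x.list.length) + 20))
  have hB : PolyBdd n B := hS₅.add ((hS₀.add hS₀).add (((PolyBdd.const _ 8).mul hoff.bdd).add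
    (.const _ 20)))
  let fill : Prog := .seq (.const (R + 4) 1) (.seq (.arith .sub (R + 3) (R + 3) (R + 4))
    (.seq b₅ (.seq (.arith .add (R + 4) (R + 2) (R + 3)) (.store (R + 4) (R + 5)))))
  let move : Prog := .seq (.const (R + 4) 1) (.seq (.arith .sub (R + 3) (R + 3) (R + 4))
    (.seq (.arith .add (R + 4) (R + 2) (R + 3)) (.seq (.load (R + 5) (R + 4))
    (.seq (.store (R + 3) (R + 5)) (.seq (.const (R + 5) 0) (.store (R + 4) (R + 5)))))))
  refine ⟨.seq b₁ (.seq b₂ (.seq b₃ (.seq b₄ (.seq (.loop (R + 3) fill) (.seq b₆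
    (.seq (.loop (R + 3) move) (.seq (.const (R + 4) 0) (.arith .add 0 R (R + 4))))))))),
    fun x => T₁ x + T₂ x + T₃ x + T₄ x + T₆ x + (x.list.length + 2) *
      (B x + len (x.total d hd + x.list.length)) +
      (len (x.total d hd + x.list.length) + 4), ?_, fun x => ?_⟩
  · exact ((((((hT₁.add hT₂).add hT₃).add hT₄).add hT₆).add ((hlenb.add (.const _ 2)).mul
      (hB.add hoff.bdd))).add (hoff.bdd.add (.const _ 4)))
  set N := x.total d hd with hN
  set l := x.list.length with hl
  have hlist : ∀ a, l ≤ a → x.list.getD a 0 = 0 := fun a ha => List.getD_eq_default _ _ ha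
  have htrees : ∀ a, N ≤ a → (x.trees d hd).getD a 0 = 0 := fun a ha =>
    List.getD_eq_default _ _ (by rw [length_trees]; exact ha)
  have hlen : ∀ a, a ≤ N + l → len a ≤ len (N + l) := fun a ha => len_mono ha
  have hNl : len N ≤ len (N + l) := hlen N (Nat.le_add_right _ _)
  have hout_len : ∀ a, len ((x.trees d hd).getD a 0) ≤ (x.n + 2) ^ c₀ + 1 := by
    intro a
    rcases lt_or_ge a N with ha | ha
    · rw [getD_trees x ha]
      exact (hc₀ ⟨(x, a), ha⟩).trans (Nat.le_succ _)
    · rw [htrees a ha, len_zero]; omega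
  have hs₀ : V.Holds x (init x.list) := by
    refine ⟨fun i hi => ?_, fun a _ => rfl⟩
    obtain rfl : i = 0 := hi
    rfl
  obtain ⟨t₁, s₁, e₁, ht₁, hv₁, hr₁, hm₁⟩ := h₁ x _ hs₀
  have hs₁ := hs₀.congr le_rfl hr₁ hm₁
  obtain ⟨t₂, s₂, e₂, ht₂, hv₂, hr₂, hm₂⟩ := h₂ x _ hs₁
  have hs₂ := hs₁.congr (Nat.le_succ R) hr₂ hm₂
  obtain ⟨t₃, s₃, e₃, ht₃, hv₃, hr₃, hm₃⟩ := h₃ x _ hs₂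
  have hs₃ := hs₂.congr (Nat.le_add_right R 2) hr₃ hm₃
  obtain ⟨t₄, s₄, e₄, ht₄, hv₄, hr₄, hm₄⟩ := h₄ x _ hs₃
  have hmem₄ : s₄.mem = fun a => x.list.getD a 0 := by rw [hm₄, hm₃, hm₂, hm₁]; rfl
  have hoff₄ : s₄.reg (R + 2) = N + l := by rw [hr₄ _ (by omega), hv₃]
  -- The trees are written behind the input, from the last entry to the first.
  obtain ⟨t₅, s₅, e₅, ht₅, -, -, hr₅, hm₅⟩ := Exec.countdown (r := R + 3) (p := fill) (T := B x)
    (fun a u => u.reg (R + 3) = a ∧ a ≤ N ∧ (∀ i < R + 3, u.reg i = s₄.reg i) ∧ ∀ b, u.mem b =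
      if N + l + a ≤ b then (x.trees d hd).getD (b - (N + l)) 0 else x.list.getD b 0)
    (fun a u h => h.1) N (by
      rintro a ha u ⟨hu1, -, hu2, hu3⟩
      let y : Steps fun x : KSAT k => x.total d hd := ⟨(x, a), ha⟩
      have e₁ := Exec.const u (R + 4) 1
      have e₂ := Exec.arith (u.setReg (R + 4) 1) .sub (R + 3) (R + 3) (R + 4)
      set u₂ := State.setReg (u.setReg (R + 4) 1) (R + 3) (Op.eval .sub
        ((u.setReg (R + 4) 1).reg (R + 3)) ((u.setReg (R + 4) 1).reg (R + 4))) with hu₂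
      have ha₂ : u₂.reg (R + 3) = a := by simp [hu₂, State.setReg, Op.eval, hu1]
      have hreg₂ : ∀ i < R + 3, u₂.reg i = s₄.reg i := fun i hi => by
        have h1 : i ≠ R + 3 := by omega
        have h2 : i ≠ R + 4 := by omega
        simp [hu₂, State.setReg, h1, h2, hu2 i hi]
      have hmem₂ : u₂.mem = u.mem := rfl
      have hholds : W.Holds y u₂ := by
        refine ⟨fun i hi => ?_, fun b hb => ?_⟩
        · rcases hi with rfl | rfl
          · have h3 : (0 : ℕ) ≠ R + 3 := by omega
            rw [hreg₂ 0 (by omega), hr₄ 0 (by omega), hs₃.1 0 rfl]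
            simp [hWdef, indexView, hVdef, inputView, y]
          · rw [ha₂]; simp [hWdef, indexView, y]
        · have hb' : b < l := hb
          rw [hmem₂, hu3, if_neg (by omega)]
          rfl
      obtain ⟨t, u₃, e₃, ht, hv, hr, hm⟩ := h₅ y u₂ hholds
      have ht' : t ≤ (x.n + 2) ^ c₅ := ht.trans (hT₅ y)
      have hreg₃ : ∀ i < R + 3, u₃.reg i = s₄.reg i := fun i hi => by
        rw [hr i (by omega), hreg₂ i hi]
      have ha₃ : u₃.reg (R + 3) = a := by rw [hr _ (by omega), ha₂]
      have hoff₃ : u₃.reg (R + 2) = N + l := by rw [hreg₃ _ (by omega), hoff₄]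
      have hv' : u₃.reg (R + 5) = (x.trees d hd).getD a 0 := by rw [hv, getD_trees x ha]
      refine ⟨_, _, .seq e₁ (.seq e₂ (.seq e₃ (.seq (.arith u₃ .add (R + 4) (R + 2) (R + 3))
        (.store _ (R + 4) (R + 5))))), ?_, ?_, ha.le, fun i hi => ?_, fun b => ?_⟩
      · have h1 := len_add_le (N + l) a
        have h2 := hlen a (by omega)
        have h3 := hlen (a + 1) (by omega)
        have h4 := hout_len a
        simp [State.setReg, Op.eval, hu1, hoff₃, ha₃, hv', len_one] at h4 ⊢
        simp only [B, ← hN, ← hl]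
        omega
      · simp [State.setReg, State.setMem, ha₃]
      · have h2 : i ≠ R + 4 := by omega
        simp [State.setReg, State.setMem, h2, hreg₃ i hi]
      · have hmb : u₃.mem b = if N + l + (a + 1) ≤ b then (x.trees d hd).getD (b - (N + l)) 0
            else x.list.getD b 0 := by rw [hm, hmem₂, hu3]
        by_cases hba : b = N + l + a
        · subst hba
          simp only [State.setReg, State.setMem, Op.eval, hoff₃, ha₃, Function.update_self, le_refl,
            if_true, Nat.add_sub_cancel_left]
          rw [Function.update_of_ne (by omega), hv']
        · simp only [State.setReg, State.setMem, Op.eval, hoff₃, ha₃, Function.update_self]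
          rw [Function.update_of_ne hba, hmb]
          exact if_congr (by omega) rfl rfl) s₄ (by
      refine ⟨hv₄, le_rfl, fun _ _ => rfl, fun b => ?_⟩
      rw [hmem₄]
      split_ifs with h
      · simp only [hlist b (by omega), htrees (b - (N + l)) (by omega)]
      · rfl)
  simp only [add_zero] at hm₅
  have hs₅ : V.Holds x s₅ := by
    refine ⟨fun i hi => ?_, fun b hb => ?_⟩
    · obtain rfl : i = 0 := hi
      rw [hr₅ 0 (by omega), hr₄ 0 (by omega), hs₃.1 0 rfl]
    · have hb' : b < l := hb
      rw [hm₅, if_neg (by omega)]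
      rfl
  obtain ⟨t₆, s₆, e₆, ht₆, hv₆, hr₆, hm₆⟩ := h₆ x _ hs₅
  have hreg₆ : ∀ i < R + 3, s₆.reg i = s₄.reg i := fun i hi => by rw [hr₆ i hi, hr₅ i hi]
  -- The trees are moved to the beginning of the memory, and their old cells are cleared.
  obtain ⟨t₇, s₇, e₇, ht₇, -, -, hr₇, hm₇⟩ := Exec.countdown (r := R + 3) (p := move) (T := B x)
    (fun a u => u.reg (R + 3) = a ∧ a ≤ N + l ∧ (∀ i < R + 3, u.reg i = s₄.reg i) ∧ ∀ b, u.mem b =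
      if b < a then x.list.getD b 0 else if b < N + l then (x.trees d hd).getD b 0 else
      if b < N + l + a then (x.trees d hd).getD (b - (N + l)) 0 else 0)
    (fun a u h => h.1) (N + l) (by
      rintro a ha u ⟨hu1, -, hu2, hu3⟩
      have hoff : u.reg (R + 2) = N + l := by rw [hu2 _ (by omega), hoff₄]
      have hload : u.mem (N + l + a) = (x.trees d hd).getD a 0 := by
        rw [hu3, if_neg (by omega), if_neg (by omega), if_pos (by omega), Nat.add_sub_cancel_left]
      have hne : a ≠ N + l + a := by omega
      refine ⟨_, _, .seq (.const u (R + 4) 1) (.seq (.arith _ .sub (R + 3) (R + 3) (R + 4))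
        (.seq (.arith _ .add (R + 4) (R + 2) (R + 3)) (.seq (.load _ (R + 5) (R + 4))
        (.seq (.store _ (R + 3) (R + 5)) (.seq (.const _ (R + 5) 0)
        (.store _ (R + 4) (R + 5))))))), ?_, ?_, ha.le, fun i hi => ?_, fun b => ?_⟩
      · have h1 := len_add_le (N + l) a
        have h2 := hlen a (by omega)
        have h3 := hlen (a + 1) (by omega)
        have h4 := hout_len a
        simp only [State.setReg, State.setMem, Op.eval]
        simp [hu1, hoff, hload, len_one, len_zero] at h4 ⊢
        simp only [B, ← hN, ← hl]
        omega
      · simp [State.setReg, State.setMem, Op.eval, hu1]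
      · have h2 : i ≠ R + 4 := by omega
        have h3 : i ≠ R + 5 := by omega
        have h4 : i ≠ R + 3 := by omega
        simp [State.setReg, State.setMem, h2, h3, h4, hu2 i hi]
      · have key : ∀ m : ℕ → ℕ, m = Function.update (Function.update u.mem a
            ((x.trees d hd).getD a 0)) (N + l + a) 0 → m b = if b < a then x.list.getD b 0 else
            if b < N + l then (x.trees d hd).getD b 0 else
            if b < N + l + a then (x.trees d hd).getD (b - (N + l)) 0 else 0 := by
          rintro _ rfl
          by_cases hb1 : b = N + l + a
          · subst hb1
            rw [Function.update_self, if_neg (by omega), if_neg (by omega), if_neg (by omega)]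
          · rw [Function.update_of_ne hb1]
            by_cases hb2 : b = a
            · subst hb2
              rw [Function.update_self, if_neg (by omega), if_pos ha]
            · rw [Function.update_of_ne hb2, hu3]
              split_ifs <;> first | rfl | omega
        refine key _ ?_
        simp [State.setReg, State.setMem, Op.eval, hu1, hoff, hload]) s₆ (by
      refine ⟨hv₆, le_rfl, hreg₆, fun b => ?_⟩
      rw [hm₆, hm₅]
      split_ifs with h1 h2 h3 <;> first | rfl | omega | exact htrees _ (by omega))
  have hfin : ∀ i < R, s₇.reg i = (init x.list).reg i := fun i hi => by
    rw [hr₇ i (by omega), hr₄ i (by omega), hr₃ i (by omega), hr₂ i (by omega), hr₁ i hi]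
  have hR₇ : s₇.reg R = N := by
    rw [hr₇ R (by omega), hr₄ R (by omega), hr₃ R (by omega), hr₂ R (by omega), hv₁]
  have hne : R ≠ R + 4 := by omega
  refine ⟨_, _, .seq e₁ (.seq e₂ (.seq e₃ (.seq e₄ (.seq e₅ (.seq e₆ (.seq e₇
    (.seq (.const s₇ (R + 4) 0) (.arith _ .add 0 R (R + 4))))))))), ?_, fun i hi => ?_, ?_, ?_⟩
  · have h1 : t₅ ≤ N * (B x + len (N + l)) + 1 :=
      ht₅.trans (Nat.succ_le_succ (Nat.mul_le_mul_left _ (Nat.add_le_add_left hNl _)))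
    have h2 : N * (B x + len (N + l)) + 1 + ((N + l) * (B x + len (N + l)) + 1) ≤
        (N + 1) * ((l + 2) * (B x + len (N + l)) + 2) := by
      generalize B x + len (N + l) = D
      nlinarith [Nat.zero_le (N * l * D), Nat.zero_le (l * D), Nat.zero_le D]
    have h3 : ∀ a, a ≤ (N + 1) * a := fun a => Nat.le_mul_of_pos_left a (Nat.succ_pos N)
    have h4 := h3 (T₁ x + T₂ x + T₃ x + T₄ x + T₆ x + (len (N + l) + 2))
    have h5 : (N + 1) * (T₁ x + T₂ x + T₃ x + T₄ x + T₆ x + (l + 2) * (B x + len (N + l)) +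
        (len (N + l) + 4)) = (N + 1) * (T₁ x + T₂ x + T₃ x + T₄ x + T₆ x + (len (N + l) + 2)) +
        (N + 1) * ((l + 2) * (B x + len (N + l)) + 2) := by ring
    rw [h5]
    simp only [State.setReg, Function.update_self, Function.update_of_ne hne, hR₇, len_zero]
    omega
  · rcases eq_or_ne i 0 with rfl | h0
    · simp [State.setReg, Op.eval, hR₇, init, length_trees, hN]
    · have h4 : i ≠ R + 4 := by omega
      simp [State.setReg, h0, h4, hfin i hi, init]
  · funext b
    simp only [State.setReg, hm₇, init, Nat.not_lt_zero, if_false, add_zero]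
    split_ifs with h
    · rfl
    · exact (htrees b (by omega)).symm
  · have h4 : R + 1 ≠ R + 4 := by omega
    simp only [State.setReg]
    rw [Function.update_of_ne (by omega), Function.update_of_ne h4, hr₇ _ (by omega),
      hr₄ _ (by omega), hr₃ _ (by omega), hv₂]

/-- The output has length `2 ^ (n / 2)`, up to polynomial factors. -/
theorem total_le (k d : ℕ) (hd : 2 ≤ d) :
    ∃ U : KSAT k → ℕ, PolyBdd n U ∧ ∀ x : KSAT k, x.total d hd ≤ 2 ^ x.half * U x := by
  have h1 : PolyBdd (n : KSAT k → ℕ) fun x => x.φ.length + 1 :=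
    ((((PolyBdd.const _ 2).mul (.self _)).add (.const _ 1)).pow k).add (.const _ 1) |>.mono
      fun x => Nat.succ_le_succ x.length_le
  have hp : PolyBdd (n : KSAT k → ℕ) fun x =>
      (4 * (x.φ.length + 1)) ^ (2 * d) * d ^ 10 :=
    (((PolyBdd.const _ 4).mul h1).pow (2 * d)).mul (.const _ (d ^ 10))
  refine ⟨fun x => d * (2 * ((4 * (x.φ.length + 1)) ^ (2 * d) * d ^ 10) + 2 * d +
    d * (27 * (x.φ.length + 1)) + 4), (PolyBdd.const _ d).mul
    (((((PolyBdd.const _ 2).mul hp).add (.const _ (2 * d))).add ((PolyBdd.const _ d).mul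
    ((PolyBdd.const _ 27).mul h1))).add (.const _ 4)), fun x => ?_⟩
  have hclog : ∀ b y : ℕ, 2 ≤ b → 0 < y → b ^ Nat.clog b y ≤ b * y := by
    intro b y hb hy
    rcases Nat.eq_zero_or_pos (Nat.clog b y) with h0 | h0
    · rw [h0, pow_zero]; nlinarith
    · have h2 : 1 < y := by
        by_contra h
        rw [Nat.clog_of_right_le_one (by omega)] at h0
        omega
      have h3 := (Nat.pow_pred_clog_lt_self hb h2).le
      calc b ^ Nat.clog b y = b ^ ((Nat.clog b y).pred + 1) := by rw [Nat.pred_eq_sub_one]; congr 1; omega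
        _ = b * b ^ (Nat.clog b y).pred := pow_succ' _ _
        _ ≤ b * y := Nat.mul_le_mul_left _ h3
  set m := x.φ.length + 1 with hm
  set A := d ^ Nat.clog d (2 ^ x.half) with hA
  have hAle : A ≤ d * 2 ^ x.half := hclog d _ hd (Nat.pow_pos two_pos)
  set r := Nat.clog 2 (2 * m) with hr
  have hr2 : 2 ^ r ≤ 4 * m :=
    (hclog 2 (2 * m) le_rfl (by omega)).trans (by omega)
  have hpowr : d ^ (2 * r + 10) ≤ (4 * m) ^ (2 * d) * d ^ 10 := by
    rw [pow_add]
    refine Nat.mul_le_mul_right _ ?_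
    calc d ^ (2 * r) ≤ (2 ^ d) ^ (2 * r) := Nat.pow_le_pow_left Nat.lt_two_pow_self.le _
      _ = (2 ^ r) ^ (2 * d) := by rw [← pow_mul, ← pow_mul]; congr 1; ring
      _ ≤ (4 * m) ^ (2 * d) := Nat.pow_le_pow_left hr2 _
  have hN : (x.shape d hd).N ≤ d * A := Nat.mul_le_mul_right _ (Nat.sub_le d 1)
  have hh : (x.shape d hd).d ^ (x.shape d hd).h = A * d ^ (2 * r + 10) := by
    rw [hA, ← pow_add]
    simp only [Shape.h, shape]
    congr 1
  have hL : (x.shape d hd).d ^ ((x.shape d hd).L + 1) = A * d := pow_succ _ _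
  have hF : (x.F d hd).n = A * d ^ (2 * r + 10) + A * d + (x.shape d hd).N * (8 * m) := by
    rw [Shape.Filling.n, hh, hL, show (x.F d hd).κ = 1 from rfl, one_mul]
    rfl
  have hG : (x.G d hd).n = A * d ^ (2 * r + 10) + A * d + 2 * (x.shape d hd).N * (8 * m + m) := by
    rw [Shape.Filling.n, hh, hL]
    rfl
  have hApos : 1 ≤ A := Nat.pow_pos (by omega)
  have h5 : (x.shape d hd).N * (26 * m) ≤ d * A * (27 * m) := Nat.mul_le_mul hN (by omega)
  have h6 : A * d ^ (2 * r + 10) ≤ A * ((4 * m) ^ (2 * d) * d ^ 10) := Nat.mul_le_mul_left _ hpowr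
  have h7 : x.total d hd ≤ A * (2 * ((4 * m) ^ (2 * d) * d ^ 10) + 2 * d + d * (27 * m) + 4) := by
    rw [total, hF, hG]
    nlinarith
  calc x.total d hd ≤ _ := h7
    _ ≤ d * 2 ^ x.half * _ := Nat.mul_le_mul_right _ hAle
    _ = _ := by ring

end KSAT

/-! ### The lower bound -/

theorem RTree.lcst_le {a b : ℕ} (H : RTree a) (G : RTree b) : H.lcst G ≤ a := by
  obtain ⟨W, -, -, -, -, -, -, hW⟩ := RTree.exists_card_eq_lcst H G
  simpa [hW] using W.card_le_univ

namespace KSAT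

open RAM

variable {k : ℕ}

theorem height_le_logb {P : Shape} (F : P.Filling) {n : ℕ} (hn : P.d ^ P.h ≤ n) :
    (F.tree.height : ℝ) ≤ Real.logb P.d n := by
  have hd : (1 : ℝ) < P.d := by exact_mod_cast P.two_le_d
  have h1 : (F.tree.height : ℝ) ≤ P.h := by exact_mod_cast F.height_tree
  refine h1.trans ?_
  have h2 : (0 : ℝ) < (P.d : ℝ) ^ P.h := by positivity
  rw [Real.le_logb_iff_rpow_le hd (h2.trans_le (by exact_mod_cast hn)), Real.rpow_natCast]
  exact_mod_cast hn

/-- From a program for largest common subtrees to a program for `k`-SAT. -/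
theorem exists_prog (k d : ℕ) (hd : 2 ≤ d) (p : Prog) :
    ∃ (q : Prog) (T : KSAT k → ℕ), PolyBdd n T ∧ ∀ (x : KSAT k) (t : ℕ) (s : State),
      Exec p (init (x.trees d hd)) t s →
      s.reg 0 = (x.F d hd).tree.lcst (x.G d hd).tree → ∃ (t' : ℕ) (s' : State),
        Exec q (init x.list) t' s' ∧ t' ≤ (x.total d hd + 1) * T x + t ∧
        (x.φ.Satisfiable → s'.reg 0 = 1) ∧ (¬ x.φ.Satisfiable → s'.reg 0 = 0) := by
  set R := max p.bound 1
  obtain ⟨q, T, hT, hq⟩ := exists_reduction k d R hd (by omega)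
  refine ⟨.seq q (.seq p (.seq (.arith .sub (R + 2) (R + 1) 0)
    (.cond (R + 2) (.const 0 0) (.const 0 1)))), fun x => T x + 4, hT.add (.const _ 4),
    fun x t s e hs => ?_⟩
  obtain ⟨t₁, s₁, e₁, ht₁, hr₁, hm₁, hthr⟩ := hq x
  obtain ⟨s₂, e₂, hr₂, -, hf₂⟩ := e.frame (le_max_left _ 1) s₁ hr₁ hm₁
  have h0 : s₂.reg 0 = (x.F d hd).tree.lcst (x.G d hd).tree := by rw [hr₂ 0 (by omega), hs]
  have h1 : s₂.reg (R + 1) = x.threshold d hd := by rw [hf₂ _ (by omega), hthr]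
  have e₃ := Exec.arith s₂ .sub (R + 2) (R + 1) 0
  rw [h0, h1] at e₃
  set lc := (x.F d hd).tree.lcst (x.G d hd).tree with hlc
  set s₃ := s₂.setReg (R + 2) (Op.eval .sub (x.threshold d hd) lc) with hs₃
  have hreg : s₃.reg (R + 2) = x.threshold d hd - lc := by simp [hs₃, State.setReg, Op.eval]
  have hsat := x.satisfiable_iff_le_lcst (d := d) (hd := hd)
  rw [← hlc] at hsat
  have hthr_le : x.threshold d hd ≤ x.total d hd := by
    simp only [threshold, total]; omega
  have hlc_le : lc ≤ x.total d hd := by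
    have := RTree.lcst_le (x.F d hd).tree (x.G d hd).tree
    simp only [total]; omega
  have hlen : ∀ a, a ≤ x.total d hd → len a ≤ x.total d hd + 1 := fun a ha =>
    (len_le_succ a).trans (Nat.succ_le_succ ha)
  have htime : ∀ u, u ≤ 1 → t₁ + (t + (len (x.threshold d hd) + len lc +
      (len (x.threshold d hd - lc) + u))) ≤ (x.total d hd + 1) * (T x + 4) + t := by
    intro u hu
    have h2 := hlen _ hthr_le
    have h3 := hlen _ hlc_le
    have h4 := hlen (x.threshold d hd - lc) (by omega)
    have h5 : (x.total d hd + 1) * (T x + 4) =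
        (x.total d hd + 1) * T x + 4 * (x.total d hd + 1) := by ring
    omega
  by_cases hle : x.threshold d hd ≤ lc
  · have hz : s₃.reg (R + 2) = 0 := by omega
    have e₄ := Exec.condFalse (p := .const 0 0) hz (.const s₃ 0 1)
    rw [hreg, len_one] at e₄
    exact ⟨_, _, .seq e₁ (.seq e₂ (.seq e₃ e₄)), htime 1 le_rfl, fun _ => by simp [State.setReg],
      fun h => absurd (hsat.2 hle) h⟩
  · have hz : s₃.reg (R + 2) ≠ 0 := by omega
    have e₄ := Exec.condTrue (q := .const 0 1) hz (.const s₃ 0 0)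
    rw [hreg, len_zero] at e₄
    exact ⟨_, _, .seq e₁ (.seq e₂ (.seq e₃ e₄)), htime 1 le_rfl,
      fun h => absurd (hsat.1 h) hle, fun _ => by simp [State.setReg]⟩

theorem two_pow_half_le (x : KSAT k) : ((2 : ℝ) ^ x.half) ≤ 2 ^ (((x.n : ℝ) + 1) / 2) := by
  rw [← Real.rpow_natCast]
  refine Real.rpow_le_rpow_of_exponent_le one_le_two ?_
  rw [le_div_iff₀ two_pos]
  have : x.half * 2 ≤ x.n + 1 := Nat.div_mul_le_self _ _
  exact_mod_cast this

/-- The running time of the program for `k`-SAT. -/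
theorem time_le {n W Q a b : ℕ} {ε c₀ : ℝ} (h0 : 0 < ε) (h1 : ε ≤ 1) (half : ℕ)
    (hhalf : (2 : ℝ) ^ half ≤ 2 ^ (((n : ℝ) + 1) / 2)) (hW : W ≤ 2 ^ half * (n + 2) ^ a)
    (hQ : Q ≤ (n + 2) ^ b) :
    (W : ℝ) * Q + |c₀| * (W : ℝ) ^ (2 - ε) ≤
      ((2 * (1 + ⌈|c₀|⌉₊) * 2 ^ (2 * a + b) + (2 * a + b) : ℕ) : ℝ) *
        (2 : ℝ) ^ ((1 - ε / 2) * n) * ((n : ℝ) + 1) ^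
          (2 * (1 + ⌈|c₀|⌉₊) * 2 ^ (2 * a + b) + (2 * a + b)) := by
  set X : ℝ := (2 : ℝ) ^ ((1 - ε / 2) * n) with hX
  set Z : ℝ := (n : ℝ) + 2 with hZ
  have hn : (0 : ℝ) ≤ n := Nat.cast_nonneg n
  have hZ1 : 1 ≤ Z := by linarith
  have hX0 : 0 < X := Real.rpow_pos_of_pos two_pos _
  have hW' : (W : ℝ) ≤ 2 ^ (((n : ℝ) + 1) / 2) * Z ^ a := by
    have : (W : ℝ) ≤ 2 ^ half * Z ^ a := by rw [hZ]; exact_mod_cast hW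
    exact this.trans (mul_le_mul_of_nonneg_right hhalf (by positivity))
  have hQ' : (Q : ℝ) ≤ Z ^ b := by rw [hZ]; exact_mod_cast hQ
  have hpow : ∀ i j : ℕ, i ≤ j → Z ^ i ≤ Z ^ j := fun i j h => pow_le_pow_right₀ hZ1 h
  have hexp1 : (2 : ℝ) ^ (((n : ℝ) + 1) / 2) ≤ 2 * X := by
    rw [hX, ← Real.rpow_one_add' zero_le_two (by nlinarith)]
    exact Real.rpow_le_rpow_of_exponent_le one_le_two (by nlinarith)
  have hexp2 : ((2 : ℝ) ^ (((n : ℝ) + 1) / 2)) ^ (2 - ε) ≤ 2 * X := by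
    rw [hX, ← Real.rpow_one_add' zero_le_two (by nlinarith), ← Real.rpow_mul zero_le_two]
    exact Real.rpow_le_rpow_of_exponent_le one_le_two (by nlinarith)
  have hfirst : (W : ℝ) * Q ≤ 2 * X * Z ^ (2 * a + b) := by
    calc (W : ℝ) * Q ≤ (2 ^ (((n : ℝ) + 1) / 2) * Z ^ a) * Z ^ b :=
          mul_le_mul hW' hQ' (Nat.cast_nonneg _) (by positivity)
      _ = 2 ^ (((n : ℝ) + 1) / 2) * Z ^ (a + b) := by rw [pow_add]; ring
      _ ≤ 2 * X * Z ^ (2 * a + b) :=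
          mul_le_mul hexp1 (hpow _ _ (by omega)) (by positivity) (by positivity)
  have hsecond : (W : ℝ) ^ (2 - ε) ≤ 2 * X * Z ^ (2 * a + b) := by
    calc (W : ℝ) ^ (2 - ε) ≤ (2 ^ (((n : ℝ) + 1) / 2) * Z ^ a) ^ (2 - ε) :=
          Real.rpow_le_rpow (Nat.cast_nonneg _) hW' (by linarith)
      _ = (2 ^ (((n : ℝ) + 1) / 2)) ^ (2 - ε) * (Z ^ a) ^ (2 - ε) :=
          Real.mul_rpow (by positivity) (by positivity)
      _ ≤ 2 * X * Z ^ (2 * a + b) := by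
          refine mul_le_mul hexp2 ?_ (by positivity) (by positivity)
          calc (Z ^ a) ^ (2 - ε) ≤ (Z ^ a) ^ (2 : ℝ) :=
                Real.rpow_le_rpow_of_exponent_le (one_le_pow₀ hZ1) (by linarith)
            _ = Z ^ (2 * a) := by
                rw [Real.rpow_two, ← pow_mul, mul_comm]
            _ ≤ _ := hpow _ _ (by omega)
  have hceil : |c₀| ≤ ⌈|c₀|⌉₊ := Nat.le_ceil _
  set C : ℕ := ⌈|c₀|⌉₊
  set e := 2 * a + b
  have hZn : Z ^ e ≤ 2 ^ e * ((n : ℝ) + 1) ^ e := by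
    rw [← mul_pow]
    exact pow_le_pow_left₀ (by linarith) (by linarith) _
  have hn1 : ((n : ℝ) + 1) ^ e ≤ ((n : ℝ) + 1) ^ (2 * (1 + C) * 2 ^ e + e) :=
    pow_le_pow_right₀ (by linarith) (by omega)
  have hC0 : (0 : ℝ) ≤ C := Nat.cast_nonneg C
  calc (W : ℝ) * Q + |c₀| * (W : ℝ) ^ (2 - ε)
      ≤ 2 * X * Z ^ e + C * (2 * X * Z ^ e) :=
        add_le_add hfirst (mul_le_mul hceil hsecond (by positivity) hC0)
    _ = 2 * (1 + C) * X * Z ^ e := by ring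
    _ ≤ 2 * (1 + C) * X * (2 ^ e * ((n : ℝ) + 1) ^ (2 * (1 + C) * 2 ^ e + e)) := by
        refine mul_le_mul_of_nonneg_left (hZn.trans ?_) (by positivity)
        exact mul_le_mul_of_nonneg_left hn1 (by positivity)
    _ = (2 * (1 + C) * 2 ^ e) * X * ((n : ℝ) + 1) ^ (2 * (1 + C) * 2 ^ e + e) := by ring
    _ ≤ _ := by
        refine mul_le_mul_of_nonneg_right (mul_le_mul_of_nonneg_right ?_ hX0.le) (by positivity)
        push_cast
        linarith [Nat.cast_nonneg (α := ℝ) e]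

/-- A fast program for largest common subtrees of trees whose height is at most `log_d n` gives a
fast program for `k`-SAT. -/
theorem decidesKSAT_of_solvesLCST (k : ℕ) {d : ℕ} (hd : 2 ≤ d) {p : Prog} {ε : ℝ} (hε : 0 < ε)
    (hp : SolvesLCST p d 0 ε) : ∃ q : Prog, DecidesKSAT q k (min ε 1 / 2) := by
  obtain ⟨c₀, hp⟩ := hp
  obtain ⟨q, T, ⟨b, hT⟩, hq⟩ := exists_prog k d hd p
  obtain ⟨U, hU, htot⟩ := total_le k d hd
  obtain ⟨a, ha⟩ := hU.add (.const _ 1)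
  have hmin0 : 0 < min ε 1 := lt_min hε one_pos
  refine ⟨q, 2 * (1 + ⌈|c₀|⌉₊) * 2 ^ (2 * a + b) + (2 * a + b), fun n φ hφ => ?_⟩
  let x : KSAT k := ⟨n, φ, hφ⟩
  have hnF : (x.F d hd).n ≤ max (x.F d hd).n (x.G d hd).n := le_max_left _ _
  have hnG : (x.G d hd).n ≤ max (x.F d hd).n (x.G d hd).n := le_max_right _ _
  obtain ⟨t, s, e, ht, hs⟩ := hp _ _ _ (x.F d hd).tree (x.G d hd).tree rfl
    (x.F d hd).degreeLE_tree (x.G d hd).degreeLE_tree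
    (by rw [zero_mul, add_zero]; exact height_le_logb _ ((x.F d hd).pow_h_le_n.trans hnF))
    (by rw [zero_mul, add_zero]; exact height_le_logb _ ((x.G d hd).pow_h_le_n.trans hnG))
  obtain ⟨t', s', e', ht', hsat, hunsat⟩ := hq x t s e hs
  refine ⟨t', s', e', ?_, ?_⟩
  · have hmax : max (x.F d hd).n (x.G d hd).n ≤ x.total d hd + 1 := by
      simp only [total]; omega
    have hW : x.total d hd + 1 ≤ 2 ^ x.half * (n + 2) ^ a := by
      have h1 : 1 ≤ 2 ^ x.half := Nat.one_le_two_pow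
      calc x.total d hd + 1 ≤ 2 ^ x.half * U x + 2 ^ x.half * 1 := by
            have := htot x; omega
        _ = 2 ^ x.half * (U x + 1) := by ring
        _ ≤ _ := Nat.mul_le_mul_left _ (ha x)
    have hpos : (1 : ℝ) ≤ (max (x.F d hd).n (x.G d hd).n : ℕ) := by
      exact_mod_cast (x.F d hd).n_pos.trans_le hnF
    have h1 : (t : ℝ) ≤ |c₀| * ((x.total d hd + 1 : ℕ) : ℝ) ^ (2 - min ε 1) := by
      refine ht.trans (mul_le_mul (le_abs_self _) ?_ (by positivity) (abs_nonneg _))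
      refine (Real.rpow_le_rpow_of_exponent_le hpos (y := 2 - ε) (z := 2 - min ε 1)
        (by linarith [min_le_left ε 1])).trans ?_
      refine Real.rpow_le_rpow (by positivity) (by exact_mod_cast hmax) ?_
      linarith [min_le_right ε 1]
    have h2 : (t' : ℝ) ≤ ((x.total d hd + 1 : ℕ) : ℝ) * (T x : ℕ) + t := by exact_mod_cast ht'
    refine (h2.trans (add_le_add_right h1 _)).trans ?_
    exact time_le hmin0 (min_le_right _ _) x.half x.two_pow_half_le hW (hT x)
  · split_ifs with h
    · exact hsat h
    · exact hunsat h

end KSAT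

theorem theorem5 (hSETH : SETH) (d : ℕ) (hd : 2 ≤ d) :
    ∃ C : ℝ, ∀ ε : ℝ, 0 < ε → ¬ ∃ p : RAM.Prog, SolvesLCST p d C ε := by
  -- The heights of the trees do not even exceed `log_d n`.
  refine ⟨0, fun ε hε ⟨p, hp⟩ => ?_⟩
  obtain ⟨k, hk⟩ := hSETH (min ε 1 / 2) (half_pos (lt_min hε one_pos))
  exact hk (KSAT.decidesKSAT_of_solvesLCST k hd hε hp)
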